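/- **Theorem (semi-classical regime).** Let $S$ be a quantum harmonic oscillator of mass $m>0$ and angular frequency $\omega>0$, in the number representation with annihilation operator $a$ and number states $|n\rangle$, $n\in\mathbb N_0$. Let $H_S=h\nu\,a^\dagger a$ with $h\nu=\hbar\omega$, $q=\sqrt{\hbar/(2m\omega)}\,(a^\dagger+a)$, $p=i\sqrt{\hbar m\omega/2}\,(a^\dagger-a)$. For $\alpha\in\mathbb C$ and $k\in\mathbb N_0$ put $|\alpha\rangle=e^{\alpha a^\dagger-\alpha^*a}|0\rangle$ and $|\alpha,k\rangle=\Delta^k|\alpha\rangle$, where $\Delta=\sum_{n\ge0}|n+1\rangle\langle n|$, and let $$\mathcal C=\{e^{-iLt}|\alpha,k\rangle:\ k\in\mathbb N_0,\ \alpha\in\mathbb C,\ t\in\mathbb R,\ L=L^\dagger,\ [L,H_S]=0\}.$$ A *weight* $A$ is a Hilbert space with a self-adjoint Hamiltonian $H_A$ and a normalised eigenvector $|0\rangle_A$ of $H_A$, of energy $E_0$. A *coherent work process* $|\psi\rangle\stackrel{\omega}{\longrightarrow}|\phi\rangle$ on $S$ with weight $A$ and output $|\omega\rangle_A$ exists if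 $\psi,\phi,\omega$ are unit vectors and there is a unitary $U$ on $S\otimes A$, commuting with $H_S\otimes 1+1\otimes H_A$, with $U(|\psi\rangle\otimes|0\rangle_A)=|\phi\rangle\otimes|\omega\rangle_A$. The *ladder* is the weight with orthonormal eigenbasis $|n\rangle_A$, $n\in\mathbb Z$, energies $n\,h\nu$ and default state $|0\rangle_A$. For $\lambda\ge0$ and $n\in\mathbb Z$, $|\lambda,n\rangle_A$ denotes the state $\sum_{j\ge0}e^{-\lambda^2/2}\frac{\lambda^j}{\sqrt{j!}}\,|n+j\rangle_A$; for a general weight, "equal to $|\lambda,n\rangle_A$ modulo phases" means equal to $\sum_{j\ge 0}w_j$ with $w_j$ an energy vector of $H_A$ of energy $E_0+(n+j)h\nu$ (possibly zero) and $\|w_j\|=e^{-\lambda^2/2}\lambda^j/\sqrt{j!}$. 1. $\mathcal C$ is closed under coherent work processes: for every weight, if $\psi\in\mathcal C$ and $|\psi\rangle\stackrel{\omega}{\longrightarrow}|\phi\rangle$, then $\phi\in\mathcal C$. 2. For every $\psi\in\mathcal C$ there is a unique pair $(\alpha,k)$ with $\alpha\ge0$ real and $k\in\mathbb N_0$ such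 that $|\psi\rangle\to|\alpha,k\rangle$ and $|\alpha,k\rangle\to|\psi\rangle$ are both coherent work processes with output $|0\rangle_A$; these processes exist with every weight, and with no weight does another pair have this property. Let $\alpha,\alpha'\in\mathbb C$ and $k,k'\in\mathbb N_0$ (in particular $\alpha,\alpha'\ge 0$, the canonical states). If $|\alpha,k\rangle\stackrel{\omega}{\longrightarrow}|\alpha',k'\rangle$ with some weight, then $|\alpha'|\le|\alpha|$ and, modulo phases, $|\omega\rangle_A=|\lambda,n\rangle_A$ with $\lambda=\sqrt{|\alpha|^2-|\alpha'|^2}$ and $n=k-k'$. Conversely, if $|\alpha'|\le|\alpha|$ and $n\in\mathbb Z$ satisfies $n+k'=k$, then with the ladder as weight there is a process $|\alpha,k\rangle\stackrel{\omega}{\longrightarrow}|\alpha',k'\rangle$ exactly for those $\omega$ whose coefficients are those of $|\lambda,n\rangle_A$ up to arbitrary phases $e^{i\theta_j}$, in particular for $|\omega\rangle_A=|\lambda,n\rangle_A$. 3. In the limit of large displacements the classical work processes under a conservative force are recovered, in the following sense. - (Sharpness.) In $|\alpha\rangle$ the observables $q,p,H_S$ have means $\sqrt{\hbar/(2m\omega)}\,2\,\mathrm{Re}\,\alpha$,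 $\sqrt{\hbar m\omega/2}\;2\,\mathrm{Im}\,\alpha$, $\hbar\omega|\alpha|^2$ and standard deviations $\sqrt{\hbar/(2m\omega)}$, $\sqrt{\hbar m\omega/2}$, $\hbar\omega|\alpha|$. The ratio of standard deviation to absolute mean tends to $0$ for $q$ as $|\mathrm{Re}\,\alpha|\to\infty$, for $p$ as $|\mathrm{Im}\,\alpha|\to\infty$, and for $H_S$ as $|\alpha|\to\infty$. - (Path independence.) For $\psi,\phi\in\mathcal C$ there are $\lambda\ge0$ and $n\in\mathbb Z$ such that the output of every process from $\psi$ to $\phi$, with any weight, is $|\lambda,n\rangle_A$ modulo phases; its energy has mean $E_0+\langle H_S\rangle_\psi-\langle H_S\rangle_\phi$ and variance $\mathrm{Var}_\psi(H_S)-\mathrm{Var}_\phi(H_S)$. - (Recovery.) Let $E(x,p)=\frac{p^2}{2m}+\frac{m\omega^2x^2}{2}$. For all classical phase space points $(x_0,p_0),(x_1,p_1)\in\mathbb R^2$ there are coherent work processes $|\alpha_s,k_s\rangle\stackrel{\omega_s}{\longrightarrow}|\alpha'_s,k'_s\rangle$, $s>0$, with the ladder as weight, such that $|\alpha_s|,|\alpha_s'|\to\infty$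 as $s\to\infty$ and such that the rescaled observables $q/s$, $p/s$, $H_S/s^2$ have means tending to $x_0,p_0,E(x_0,p_0)$ in the initial states and to $x_1,p_1,E(x_1,p_1)$ in the final states, the rescaled work $H_A/s^2$ has mean tending to $E(x_0,p_0)-E(x_1,p_1)$ in $\omega_s$, and all the standard deviations of these rescaled observables tend to $0$. -/

import Mathlib

open scoped TensorProduct
open Filter Topology

universe u

noncomputable section

namespace CoherentWork

/-! ### Operators on square-summable sequences -/

/-- The Hilbert space `ℓ²(ι; ℂ)`. -/
abbrev Ell2 (ι : Type*) := lp (fun _ : ι => ℂ) 2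

/-- The (in general unbounded) operator on `ℓ²(ι)` given by a formal linear action on sequences,
with its maximal domain `{ψ ∈ ℓ² : T ψ ∈ ℓ²}`. -/
def maximalOp {ι : Type*} (T : (ι → ℂ) →ₗ[ℂ] (ι → ℂ)) : Ell2 ι →ₗ.[ℂ] Ell2 ι where
  domain :=
    { carrier := {ψ | Memℓp (T ψ) 2}
      add_mem' := fun {a b} ha hb => by
        simp only [Set.mem_ofPred_eq, lp.coeFn_add, map_add] at *
        exact ha.add hb
      zero_mem' := by
        simp only [Set.mem_ofPred_eq, lp.coeFn_zero, map_zero]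
        exact zero_memℓp
      smul_mem' := fun c a ha => by
        simp only [Set.mem_ofPred_eq, lp.coeFn_smul, map_smul] at *
        exact ha.const_smul c }
  toFun :=
    { toFun := fun ψ => ⟨T (ψ : Ell2 ι), ψ.2⟩
      map_add' := fun a b => Subtype.ext (map_add T _ _)
      map_smul' := fun c a => Subtype.ext (map_smul T c _) }

/-- The formal diagonal operator `|i⟩ ↦ E i |i⟩`. -/
def diagonal {ι : Type*} (E : ι → ℝ) : (ι → ℂ) →ₗ[ℂ] (ι → ℂ) where
  toFun := fun ψ i => (E i : ℂ) * ψ i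
  map_add' := fun a b => by ext i; simp [mul_add]
  map_smul' := fun c a => by ext i; simp; ring

open scoped Classical in
theorem single_mem_diagonal_graph {ι : Type*} (E : ι → ℝ) (i : ι) :
    ((lp.single 2 i (1 : ℂ) : Ell2 ι), (E i : ℂ) • (lp.single 2 i (1 : ℂ) : Ell2 ι)) ∈
      (maximalOp (diagonal E)).graph := by
  have key : diagonal E (lp.single 2 i (1 : ℂ) : Ell2 ι) =
      (((E i : ℂ) • (lp.single 2 i (1 : ℂ) : Ell2 ι) : Ell2 ι) : ι → ℂ) := by
    funext j
    change (E j : ℂ) * (lp.single 2 i (1 : ℂ) : Ell2 ι) j =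
      (E i : ℂ) * (lp.single 2 i (1 : ℂ) : Ell2 ι) j
    by_cases h : j = i
    · rw [h]
    · simp [h]
  rw [LinearPMap.mem_graph_iff]
  refine ⟨⟨lp.single 2 i (1 : ℂ), ?_⟩, rfl, ?_⟩
  · change Memℓp (diagonal E (lp.single 2 i (1 : ℂ) : Ell2 ι)) 2
    rw [key]
    exact lp.memℓp _
  · ext j
    exact congrFun key j

/-- A real diagonal operator on its maximal domain is self-adjoint. -/
theorem isSelfAdjoint_diagonal {ι : Type*} (E : ι → ℝ) :
    IsSelfAdjoint (maximalOp (diagonal E)) := by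
  classical
  have hdense : Dense ((maximalOp (diagonal E)).domain : Set (Ell2 ι)) := by
    intro ψ
    have h := lp.hasSum_single (p := 2) (by norm_num) ψ
    refine mem_closure_of_tendsto h (Eventually.of_forall fun s => ?_)
    refine Submodule.sum_mem _ fun i _ => ?_
    have h1 := LinearPMap.mem_domain_of_mem_graph (single_mem_diagonal_graph E i)
    have h2 : (lp.single 2 i (ψ i) : Ell2 ι) = ψ i • (lp.single 2 i (1 : ℂ) : Ell2 ι) := by
      rw [← lp.single_smul]; simp
    rw [h2]
    exact Submodule.smul_mem _ _ h1
  have hformal : (maximalOp (diagonal E)).IsFormalAdjoint (maximalOp (diagonal E)) := by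
    intro x y
    rw [lp.inner_eq_tsum, lp.inner_eq_tsum]
    refine tsum_congr fun i => ?_
    change inner ℂ ((E i : ℂ) * (x : Ell2 ι) i) ((y : Ell2 ι) i) =
      inner ℂ ((x : Ell2 ι) i) ((E i : ℂ) * (y : Ell2 ι) i)
    simp
    ring
  rw [LinearPMap.isSelfAdjoint_def]
  refine le_antisymm ?_ (LinearPMap.IsFormalAdjoint.le_adjoint hdense hformal)
  have hcoord : ∀ y : (LinearPMap.adjoint (maximalOp (diagonal E))).domain,
      (diagonal E (y : Ell2 ι)) =
        ((LinearPMap.adjoint (maximalOp (diagonal E)) y : Ell2 ι) : ι → ℂ) := by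
    intro y
    funext i
    have h1 := single_mem_diagonal_graph E i
    rw [LinearPMap.mem_graph_iff] at h1
    obtain ⟨x, hx, hx2⟩ := h1
    have h2 := LinearPMap.adjoint_isFormalAdjoint hdense y x
    rw [hx2, hx, inner_smul_right, lp.inner_single_right, lp.inner_single_right] at h2
    have h3 := congrArg (starRingEnd ℂ) h2
    simp at h3
    simpa [diagonal] using h3.symm
  refine ⟨fun y hy => ?_, ?_⟩
  · change Memℓp (diagonal E (y : Ell2 ι)) 2
    rw [hcoord ⟨y, hy⟩]
    exact lp.memℓp _
  · intro x y hxy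
    ext i
    have := congrFun (hcoord x) i
    rw [← this, hxy]
    rfl

theorem memℓp_extend {ι κ : Type*} (f : ι ↪ κ) (ψ : Ell2 ι) :
    Memℓp (Function.extend f (ψ : ι → ℂ) 0) 2 := by
  have h : Summable fun i => ‖ψ i‖ ^ (2 : ENNReal).toReal :=
    (memℓp_gen_iff (by norm_num)).1 (lp.memℓp ψ)
  refine memℓp_gen ?_
  rw [← f.injective.summable_iff]
  · refine h.congr fun i => ?_
    simp [Function.comp, f.injective.extend_apply]
  · intro x hx
    rw [Function.extend_apply' _ _ _ (by simpa using hx)]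
    simp

/-- The isometric embedding `|i⟩ ↦ |f i⟩` of `ℓ²(ι)` in `ℓ²(κ)`. -/
def relabel {ι κ : Type*} (f : ι ↪ κ) : Ell2 ι →ₗ[ℂ] Ell2 κ where
  toFun := fun ψ => ⟨Function.extend f (ψ : ι → ℂ) 0, memℓp_extend f ψ⟩
  map_add' := fun a b => by
    ext j
    change Function.extend f ((a : ι → ℂ) + (b : ι → ℂ)) (0 : κ → ℂ) j =
      Function.extend f (a : ι → ℂ) (0 : κ → ℂ) j + Function.extend f (b : ι → ℂ) (0 : κ → ℂ) j
    by_cases h : ∃ i, f i = j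
    · obtain ⟨i, rfl⟩ := h
      simp only [f.injective.extend_apply, Pi.add_apply]
    · simp [Function.extend_apply' _ _ _ h]
  map_smul' := fun c a => by
    ext j
    change Function.extend f (c • (a : ι → ℂ)) (0 : κ → ℂ) j = c • Function.extend f (a : ι → ℂ) (0 : κ → ℂ) j
    by_cases h : ∃ i, f i = j
    · obtain ⟨i, rfl⟩ := h
      simp only [f.injective.extend_apply, Pi.smul_apply]
    · simp [Function.extend_apply' _ _ _ h]

/-! ### The harmonic oscillator in the number representation -/

/-- The state space of the oscillator, with the number states `|n⟩` as standard basis. -/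
abbrev Fock := Ell2 ℕ

/-- The formal action of the annihilation operator: `a |n⟩ = √n |n - 1⟩`. -/
def lower : (ℕ → ℂ) →ₗ[ℂ] (ℕ → ℂ) where
  toFun := fun ψ n => (√((n : ℝ) + 1) : ℂ) * ψ (n + 1)
  map_add' := fun a b => by ext i; simp [mul_add]
  map_smul' := fun c a => by ext i; simp; ring

/-- The formal action of the creation operator: `a† |n⟩ = √(n + 1) |n + 1⟩`. -/
def raise : (ℕ → ℂ) →ₗ[ℂ] (ℕ → ℂ) where
  toFun := fun ψ n => (√(n : ℝ) : ℂ) * ψ (n - 1)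
  map_add' := fun a b => by ext i; simp [mul_add]
  map_smul' := fun c a => by ext i; simp; ring

/-- The Hamiltonian `ε a†a` of the oscillator with level spacing `ε = hν = ħω`. -/
def oscillatorHam (ε : ℝ) : Fock →ₗ.[ℂ] Fock :=
  maximalOp ((ε : ℂ) • (raise ∘ₗ lower))

theorem raise_comp_lower (ε : ℝ) :
    (ε : ℂ) • (raise ∘ₗ lower) = diagonal (fun n : ℕ => ε * n) := by
  ext ψ n
  rcases n with _ | n
  · simp [raise, lower, diagonal]
  · have h : ((√((n : ℝ) + 1) : ℝ) : ℂ) * ((√((n : ℝ) + 1) : ℝ) : ℂ) = (n : ℂ) + 1 := by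
      rw [← Complex.ofReal_mul, Real.mul_self_sqrt (by positivity)]
      push_cast; ring
    simp only [raise, lower, diagonal, LinearMap.smul_apply, LinearMap.comp_apply,
      LinearMap.coe_mk, AddHom.coe_mk, Pi.smul_apply, smul_eq_mul, Nat.cast_add, Nat.cast_one,
      Nat.add_sub_cancel, Complex.ofReal_mul, Complex.ofReal_natCast]
    rw [← mul_assoc ((√((n : ℝ) + 1) : ℝ) : ℂ), h]
    ring

theorem isSelfAdjoint_oscillatorHam (ε : ℝ) : IsSelfAdjoint (oscillatorHam ε) := by
  rw [oscillatorHam, raise_comp_lower]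
  exact isSelfAdjoint_diagonal _

/-- The position operator `q = √(ħ / (2mω)) (a† + a)`. -/
def position (hbar m ω : ℝ) : Fock →ₗ.[ℂ] Fock :=
  maximalOp ((√(hbar / (2 * m * ω)) : ℂ) • (raise + lower))

/-- The momentum operator `p = i √(ħmω / 2) (a† - a)`. -/
def momentum (hbar m ω : ℝ) : Fock →ₗ.[ℂ] Fock :=
  maximalOp ((Complex.I * (√(hbar * m * ω / 2) : ℂ)) • (raise - lower))

/-! ### Coherent states -/

/-- The formal generator `α a† - α* a` of the displacement `D(α) = exp (α a† - α* a)`. -/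
def displacementGenerator (α : ℂ) : (ℕ → ℂ) →ₗ[ℂ] (ℕ → ℂ) :=
  α • raise - (starRingEnd ℂ α) • lower

/-- The sequence `(α a† - α* a) ^ j |0⟩`. -/
def displacementSeq (α : ℂ) (j : ℕ) : ℕ → ℂ :=
  ((displacementGenerator α) ^ j) (Pi.single 0 1)

theorem displacementSeq_succ (α : ℂ) (j n : ℕ) :
    displacementSeq α (j + 1) n =
      α * ((√(n : ℝ) : ℂ) * displacementSeq α j (n - 1)) -
        (starRingEnd ℂ α) * ((√((n : ℝ) + 1) : ℂ) * displacementSeq α j (n + 1)) := by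
  simp [displacementSeq, pow_succ', displacementGenerator, raise, lower]

theorem displacementSeq_eq_zero (α : ℂ) (j : ℕ) :
    ∀ n, j < n → displacementSeq α j n = 0 := by
  induction j with
  | zero => intro n hn; simp [displacementSeq, hn.ne']
  | succ j ih =>
    intro n hn
    rw [displacementSeq_succ, ih (n - 1) (by omega), ih (n + 1) (by omega)]
    simp

theorem memℓp_displacementSeq (α : ℂ) (j : ℕ) : Memℓp (displacementSeq α j) 2 := by
  refine memℓp_gen (summable_of_ne_finset_zero (s := Finset.range (j + 1)) fun n hn => ?_)
  rw [displacementSeq_eq_zero α j n (by simpa using hn)]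
  simp

/-- The vector `(α a† - α* a) ^ j |0⟩`. -/
def displacementVec (α : ℂ) (j : ℕ) : Fock :=
  ⟨displacementSeq α j, memℓp_displacementSeq α j⟩

/-- The coherent state `|α⟩ = D(α) |0⟩ = exp (α a† - α* a) |0⟩`, by the exponential series applied
to the vacuum; the series converges in norm (`summable_displacement` below). -/
def coherentState (α : ℂ) : Fock :=
  ∑' j : ℕ, ((Nat.factorial j : ℂ)⁻¹) • displacementVec α j

theorem sum_norm_displacementSeq_le (α : ℂ) (j : ℕ) :
    ∑ n ∈ Finset.range (j + 1), ‖displacementSeq α j n‖ ≤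
      (2 * ‖α‖) ^ j * √(Nat.factorial j : ℝ) := by
  induction j with
  | zero => simp [displacementSeq]
  | succ j ih =>
    set S := ∑ n ∈ Finset.range (j + 1), ‖displacementSeq α j n‖ with hS
    have hsq : ∀ n : ℕ, n ≤ j + 1 → √(n : ℝ) ≤ √((j : ℝ) + 1) := fun n hn =>
      Real.sqrt_le_sqrt (by exact_mod_cast hn)
    have h1 : ∑ n ∈ Finset.range (j + 1 + 1), √(n : ℝ) * ‖displacementSeq α j (n - 1)‖ ≤
        √((j : ℝ) + 1) * S := by
      rw [Finset.sum_range_succ', hS, Finset.mul_sum]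
      simp only [Nat.cast_zero, Real.sqrt_zero, zero_mul, add_zero, Nat.add_sub_cancel]
      refine Finset.sum_le_sum fun n hn => ?_
      have := Finset.mem_range.1 hn
      exact mul_le_mul_of_nonneg_right (hsq (n + 1) (by omega)) (norm_nonneg _)
    have h2 : ∑ n ∈ Finset.range (j + 1 + 1), √((n : ℝ) + 1) * ‖displacementSeq α j (n + 1)‖ ≤
        √((j : ℝ) + 1) * S := by
      rw [Finset.sum_range_succ, Finset.sum_range_succ,
        displacementSeq_eq_zero α j (j + 1) (by omega),
        displacementSeq_eq_zero α j (j + 1 + 1) (by omega), hS, Finset.mul_sum,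
        Finset.sum_range_succ']
      have : ∑ n ∈ Finset.range j, √((n : ℝ) + 1) * ‖displacementSeq α j (n + 1)‖ ≤
          ∑ n ∈ Finset.range j, √((j : ℝ) + 1) * ‖displacementSeq α j (n + 1)‖ := by
        refine Finset.sum_le_sum fun n hn => ?_
        have := Finset.mem_range.1 hn
        refine mul_le_mul_of_nonneg_right ?_ (norm_nonneg _)
        exact_mod_cast hsq (n + 1) (by omega)
      have h0 : 0 ≤ √((j : ℝ) + 1) * ‖displacementSeq α j 0‖ := by positivity
      simp only [norm_zero, mul_zero, add_zero]
      linarith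
    have h3 : ∑ n ∈ Finset.range (j + 1 + 1), ‖displacementSeq α (j + 1) n‖ ≤
        ‖α‖ * (√((j : ℝ) + 1) * S) + ‖α‖ * (√((j : ℝ) + 1) * S) := by
      calc ∑ n ∈ Finset.range (j + 1 + 1), ‖displacementSeq α (j + 1) n‖
          ≤ ∑ n ∈ Finset.range (j + 1 + 1),
              (‖α‖ * (√(n : ℝ) * ‖displacementSeq α j (n - 1)‖) +
                ‖α‖ * (√((n : ℝ) + 1) * ‖displacementSeq α j (n + 1)‖)) := by
            refine Finset.sum_le_sum fun n _ => ?_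
            rw [displacementSeq_succ]
            refine (norm_sub_le _ _).trans (le_of_eq ?_)
            simp only [norm_mul, RCLike.norm_conj, Complex.norm_real, Real.norm_eq_abs,
              abs_of_nonneg (Real.sqrt_nonneg _)]
        _ = ‖α‖ * ∑ n ∈ Finset.range (j + 1 + 1), √(n : ℝ) * ‖displacementSeq α j (n - 1)‖ +
            ‖α‖ * ∑ n ∈ Finset.range (j + 1 + 1),
              √((n : ℝ) + 1) * ‖displacementSeq α j (n + 1)‖ := by
            rw [Finset.sum_add_distrib, Finset.mul_sum, Finset.mul_sum]
        _ ≤ _ := by gcongr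
    have h4 : √((Nat.factorial (j + 1) : ℕ) : ℝ) =
        √((j : ℝ) + 1) * √(Nat.factorial j : ℝ) := by
      rw [Nat.factorial_succ, Nat.cast_mul, Real.sqrt_mul (by positivity)]
      push_cast; rfl
    rw [h4]
    calc _ ≤ 2 * ‖α‖ * √((j : ℝ) + 1) * S := by linarith
      _ ≤ 2 * ‖α‖ * √((j : ℝ) + 1) * ((2 * ‖α‖) ^ j * √(Nat.factorial j : ℝ)) := by gcongr
      _ = _ := by ring

theorem norm_displacementVec_le (α : ℂ) (j : ℕ) :
    ‖displacementVec α j‖ ≤ (2 * ‖α‖) ^ j * √(Nat.factorial j : ℝ) := by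
  refine le_trans ?_ (sum_norm_displacementSeq_le α j)
  have h : displacementVec α j =
      ∑ n ∈ Finset.range (j + 1), (lp.single 2 n (displacementSeq α j n) : Fock) := by
    have h1 := lp.hasSum_single (p := 2) (by norm_num) (displacementVec α j)
    have h2 := hasSum_sum_of_ne_finset_zero
      (f := fun n => (lp.single 2 n (displacementVec α j n) : Fock))
      (s := Finset.range (j + 1)) (L := SummationFilter.unconditional ℕ) (fun n hn => by
        have : displacementVec α j n = 0 :=
          displacementSeq_eq_zero α j n (by simpa using hn)
        rw [this, lp.single_zero])
    exact h1.unique h2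
  rw [h]
  refine (norm_sum_le _ _).trans (Finset.sum_le_sum fun n _ => ?_)
  rw [lp.norm_single (by norm_num)]

theorem summable_displacement (α : ℂ) :
    Summable fun j : ℕ => ((Nat.factorial j : ℂ)⁻¹) • displacementVec α j := by
  set c : ℝ := 2 * ‖α‖ with hc
  have hsum : Summable fun j : ℕ => (2 * c ^ 2) ^ j / (Nat.factorial j : ℝ) + (1 / 2 : ℝ) ^ j :=
    (Real.summable_pow_div_factorial _).add (summable_geometric_of_lt_one (by norm_num)
      (by norm_num))
  refine Summable.of_norm_bounded hsum fun j => ?_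
  have hf : (0 : ℝ) < (Nat.factorial j : ℝ) := by exact_mod_cast Nat.factorial_pos j
  have hs : 0 < √(Nat.factorial j : ℝ) := Real.sqrt_pos.2 hf
  have hss : √(Nat.factorial j : ℝ) ^ 2 = (Nat.factorial j : ℝ) := Real.sq_sqrt hf.le
  have h2 : (0 : ℝ) < √2 ^ j := by positivity
  have e1 : (√2 ^ j) ^ 2 = (2 : ℝ) ^ j := by
    rw [← pow_mul, mul_comm, pow_mul, Real.sq_sqrt (by norm_num)]
  calc ‖((Nat.factorial j : ℂ)⁻¹) • displacementVec α j‖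
      = (Nat.factorial j : ℝ)⁻¹ * ‖displacementVec α j‖ := by
        rw [norm_smul, norm_inv, Complex.norm_natCast]
    _ ≤ (Nat.factorial j : ℝ)⁻¹ * (c ^ j * √(Nat.factorial j : ℝ)) := by
        gcongr
        exact norm_displacementVec_le α j
    _ = (√2 ^ j * c ^ j / √(Nat.factorial j : ℝ)) * (√2 ^ j)⁻¹ := by
        have e2 : (Nat.factorial j : ℝ)⁻¹ * √(Nat.factorial j : ℝ) =
            (√(Nat.factorial j : ℝ))⁻¹ := by
          conv_lhs => rw [← hss]
          rw [Real.sqrt_sq hs.le]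
          field_simp
        rw [mul_comm (c ^ j), ← mul_assoc, e2]
        field_simp
    _ ≤ (√2 ^ j * c ^ j / √(Nat.factorial j : ℝ)) ^ 2 + ((√2 ^ j)⁻¹) ^ 2 := by
        nlinarith [sq_nonneg (√2 ^ j * c ^ j / √(Nat.factorial j : ℝ) - (√2 ^ j)⁻¹),
          sq_nonneg (√2 ^ j * c ^ j / √(Nat.factorial j : ℝ)), sq_nonneg ((√2 ^ j)⁻¹)]
    _ = _ := by
        clear_value c
        rw [div_pow, mul_pow, hss, e1, inv_pow, e1, one_div, inv_pow, mul_pow 2, ← pow_mul c,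
          ← pow_mul c, mul_comm j 2]

/-- The rigid energy translation `Δ = ∑ₙ |n + 1⟩⟨n|`. -/
def energyShift : Fock →ₗ[ℂ] Fock :=
  relabel ⟨Nat.succ, Nat.succ_injective⟩

/-- The translated coherent state `|α, k⟩ = Δᵏ |α⟩`. -/
def shiftedCoherent (α : ℂ) (k : ℕ) : Fock :=
  (energyShift ^ k) (coherentState α)

/-- The set `𝒞` of all `e^{-iLt} |α, k⟩`, with `L` a Hermitian observable commuting with the
Hamiltonian. -/
def classC (ε : ℝ) : Set Fock :=
  {ψ | ∃ (α : ℂ) (k : ℕ) (t : ℝ) (L : Fock →L[ℂ] Fock), IsSelfAdjoint L ∧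
    (∀ x y, (x, y) ∈ (oscillatorHam ε).graph → (L x, L y) ∈ (oscillatorHam ε).graph) ∧
    ψ = NormedSpace.exp ((-(Complex.I * t)) • L) (shiftedCoherent α k)}

/-! ### Coherent work processes -/

section Processes

variable {E : Type*} [NormedAddCommGroup E] [InnerProductSpace ℂ E]
variable {F : Type*} [NormedAddCommGroup F] [InnerProductSpace ℂ F]

/-- The Hilbert space tensor product. -/
abbrev HilbertTensor (E F : Type*) [NormedAddCommGroup E] [InnerProductSpace ℂ E]
    [NormedAddCommGroup F] [InnerProductSpace ℂ F] :=
  UniformSpace.Completion (E ⊗[ℂ] F)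

/-- The product vector `x ⊗ y`. -/
def prodVec (x : E) (y : F) : HilbertTensor E F := ((x ⊗ₜ[ℂ] y : E ⊗[ℂ] F) : HilbertTensor E F)

/-- The graph of the total Hamiltonian `H ⊗ 1 + 1 ⊗ K`, that is, of the closure of this operator
from the algebraic tensor product of the two domains. -/
def totalHamGraph (H : E →ₗ.[ℂ] E) (K : F →ₗ.[ℂ] F) :
    Submodule ℂ (HilbertTensor E F × HilbertTensor E F) :=
  (Submodule.span ℂ {z | ∃ (x : H.domain) (y : K.domain),
    z = (prodVec (x : E) (y : F), prodVec (H x) (y : F) + prodVec (x : E) (K y))}).topologicalClosure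

/-- An auxiliary weight system on the Hilbert space `F`: a self-adjoint Hamiltonian with a
normalised default energy eigenstate `|0⟩`, of energy `energy`. -/
structure Weight (F : Type*) [NormedAddCommGroup F] [InnerProductSpace ℂ F] [CompleteSpace F] where
  ham : F →ₗ.[ℂ] F
  selfAdjoint : IsSelfAdjoint ham
  init : F
  norm_init : ‖init‖ = 1
  energy : ℝ
  init_eigen : (init, (energy : ℂ) • init) ∈ ham.graph

variable [CompleteSpace F]

/-- The coherent work process `|ψ⟩ → |φ⟩` with coherent work output `|ω⟩`: between pure states, a
unitary `U` of the joint system that conserves energy, `U (H ⊗ 1 + 1 ⊗ H_A) U⁻¹ = H ⊗ 1 + 1 ⊗ H_A`,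
takes `|ψ⟩ ⊗ |0⟩` to `|φ⟩ ⊗ |ω⟩`. -/
structure CoherentWorkProcess (H : E →ₗ.[ℂ] E) (A : Weight F) (ψ φ : E) (ω : F) : Prop where
  norm_input : ‖ψ‖ = 1
  norm_final : ‖φ‖ = 1
  norm_output : ‖ω‖ = 1
  exists_unitary : ∃ U : HilbertTensor E F ≃ₗᵢ[ℂ] HilbertTensor E F,
    (∀ z w, (z, w) ∈ totalHamGraph H A.ham ↔ (U z, U w) ∈ totalHamGraph H A.ham) ∧
    U (prodVec ψ A.init) = prodVec φ ω

/-- The reversible transformation `|ψ⟩ ↔ |φ⟩` whose work output, in either direction, is the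
default state `|0⟩` of the weight. -/
def ReversibleWithoutWork (H : E →ₗ.[ℂ] E) (A : Weight F) (ψ φ : E) : Prop :=
  CoherentWorkProcess H A ψ φ A.init ∧ CoherentWorkProcess H A φ ψ A.init

/-- Modulo phases of energy eigenstates, `ω` is the state `|l, n⟩` of the weight for the level
spacing `ε`, that is, `∑ⱼ e^{-l²/2} lʲ / √(j!) |n + j⟩`, where `|i⟩` has energy `energy + i ε`.
The phases are absorbed in the vectors `w j`. -/
def HasCanonicalForm (A : Weight F) (ε l : ℝ) (n : ℤ) (ω : F) : Prop :=
  ∃ w : ℕ → F,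
    (∀ j, (w j, (((A.energy + ((n : ℝ) + j) * ε : ℝ)) : ℂ) • w j) ∈ A.ham.graph) ∧
    (∀ j, ‖w j‖ = Real.exp (-l ^ 2 / 2) * l ^ j / √(Nat.factorial j : ℝ)) ∧
    HasSum w ω

end Processes

/-- The doubly infinite ladder, `H_A = ∑ₙ n ε |n⟩⟨n|` over `n ∈ ℤ`, with default state `|0⟩`. -/
def ladder (ε : ℝ) : Weight (Ell2 ℤ) where
  ham := maximalOp (diagonal fun n : ℤ => ε * n)
  selfAdjoint := isSelfAdjoint_diagonal _
  init := lp.single 2 0 1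
  norm_init := by rw [lp.norm_single (by norm_num)]; simp
  energy := 0
  init_eigen := by
    have h := single_mem_diagonal_graph (fun n : ℤ => ε * n) 0
    simp only [Int.cast_zero, mul_zero] at h
    convert h

/-- The state `|l, n⟩` of the ladder: the coherent state `|l⟩` with `|j⟩` replaced by `|j + n⟩`. -/
def ladderState (l : ℝ) (n : ℤ) : Ell2 ℤ :=
  relabel ⟨fun j : ℕ => (j : ℤ) + n, fun i j h => by simpa using h⟩ (coherentState l)

/-! ### Statistics and the classical limit -/

/-- `ψ` is in the domain of the observable `T`, which has mean `μ` and standard deviation `σ` in the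
(normalised) state `ψ`. -/
def HasMoments {E : Type*} [NormedAddCommGroup E] [InnerProductSpace ℂ E] (T : E →ₗ.[ℂ] E) (ψ : E)
    (μ σ : ℝ) : Prop :=
  ∃ χ, (ψ, χ) ∈ T.graph ∧ inner ℂ ψ χ = (μ : ℂ) ∧ ‖χ - (μ : ℂ) • ψ‖ = σ

/-- In the family of states `ψ s`, as the scale `s` tends to infinity, the observable `T` measured in
units of `s ^ d` becomes sharp with the value `c`: its mean tends to `c`, its standard deviation
to `0`. -/
def SharpLimit {E : Type*} [NormedAddCommGroup E] [InnerProductSpace ℂ E] (T : E →ₗ.[ℂ] E)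
    (ψ : ℝ → E) (d : ℕ) (c : ℝ) : Prop :=
  ∃ μ σ : ℝ → ℝ, (∀ᶠ s in atTop, HasMoments T (ψ s) (μ s) (σ s)) ∧
    Tendsto (fun s => μ s / s ^ d) atTop (𝓝 c) ∧ Tendsto (fun s => σ s / s ^ d) atTop (𝓝 0)

/-- The energy of the classical oscillator at the phase space point `(x, p)`. -/
def classicalEnergy (m ω x p : ℝ) : ℝ := p ^ 2 / (2 * m) + m * ω ^ 2 * x ^ 2 / 2

end CoherentWork

end

open CoherentWork

namespace CoherentWork

/-! ### Number amplitudes of coherent states -/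

/-! Everything is governed by number distributions. The coherent state has amplitudes `e^{-|α|²/2}
αⁿ / √n!`, so its number distribution is Poisson with mean `|α|²`, and `Δᵏ` translates it by `k`.
The spectrum of the oscillator is simple, so a Hermitian `L` commuting with it is diagonal and
`e^{-iLt}` changes phases only. Hence `𝒞` consists of all states with a translated Poisson
distribution (`mem_classC_iff`).

An energy-conserving unitary takes each energy component of `ψ ⊗ |0⟩` to the component of `φ ⊗ ω` of
the same energy, with the same norm. Energies add in a product, so the number distribution of `ψ` is
the convolution of that of `φ` with the energy distribution of `ω`
(`CoherentWorkProcess.exists_components`). By Raikov's theorem the factors of a Poisson law are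
Poisson (`raikov`). This gives the closure of `𝒞` and the canonical form of the output; additivity
of the parameters gives `λ² = |α|² - |α'|²`.

Conversely, Poisson laws convolve to Poisson laws, so the energy components of a prospective output
have the same norms as those of the input. A unitary that matches them and preserves the total
Hamiltonian rotates phases along the differences of matching components and is the identity
elsewhere (`IsClosedSymmetric.exists_unitary`); closedness and symmetry of the Hamiltonian suffice
for it.

Energy moments are Poisson moments. For the recovery of classical processes both ends get the same
displacement modulus `√s`, so that `λ = 0` and work of either sign is possible, while translations
of order `s²` carry the energy. Such a state is an eigenvector of `a` up to an error `o(s)`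
(`norm_lower_shiftedCoherent_sub_sq_le`), which controls position and momentum. -/

theorem hasSum_apply {ι κ : Type*} {f : κ → Ell2 ι} {v : Ell2 ι} (h : HasSum f v) (i : ι) :
    HasSum (fun j => f j i) (v i) :=
  h.mapL (lp.evalCLM ℂ (fun _ : ι => ℂ) 2 i)

/-- The amplitudes `e^{-|α|²/2} αⁿ / √(n!)`. -/
noncomputable def coherentAmp (α : ℂ) (n : ℕ) : ℂ :=
  Complex.exp (-(‖α‖ ^ 2 / 2 : ℝ)) * α ^ n / √(Nat.factorial n : ℝ)

/-- The amplitudes of `|tα⟩`, continued to an entire function of `t`. -/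
noncomputable def coherentCurve (α t : ℂ) (n : ℕ) : ℂ :=
  Complex.exp (-(t ^ 2 * (‖α‖ ^ 2 / 2 : ℝ))) * (t * α) ^ n / √(Nat.factorial n : ℝ)

theorem displacementGenerator_apply (α : ℂ) (f : ℕ → ℂ) (n : ℕ) :
    displacementGenerator α f n = α * ((√(n : ℝ) : ℂ) * f (n - 1)) -
      (starRingEnd ℂ α) * ((√((n : ℝ) + 1) : ℂ) * f (n + 1)) := by
  simp [displacementGenerator, raise, lower]

theorem sqrt_factorial_succ (n : ℕ) : ((√(Nat.factorial (n + 1) : ℝ) : ℝ) : ℂ) =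
    (√((n : ℝ) + 1) : ℝ) * (√(Nat.factorial n : ℝ) : ℝ) := by
  rw [← Complex.ofReal_mul, ← Real.sqrt_mul (by positivity), Nat.factorial_succ]
  push_cast
  rfl

theorem sqrt_factorial_ne_zero (n : ℕ) : ((√(Nat.factorial n : ℝ) : ℝ) : ℂ) ≠ 0 := by
  have : (0 : ℝ) < (Nat.factorial n : ℝ) := by exact_mod_cast Nat.factorial_pos n
  exact_mod_cast (Real.sqrt_pos.2 this).ne'

theorem sqrt_succ_mul_self (n : ℕ) : ((√((n : ℝ) + 1) : ℝ) : ℂ) * (√((n : ℝ) + 1) : ℝ) = n + 1 := by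
  rw [← Complex.ofReal_mul, Real.mul_self_sqrt (by positivity)]
  push_cast
  rfl

theorem sqrt_succ_ne_zero (n : ℕ) : ((√((n : ℝ) + 1) : ℝ) : ℂ) ≠ 0 := by
  exact_mod_cast (Real.sqrt_pos.2 (by positivity : (0 : ℝ) < (n : ℝ) + 1)).ne'

/-- The Gaussian factor contributes the `a` term of the derivative and the power contributes the
`a†` term. The curve thus solves the differential equation of the displacement coordinatewise, and
the exponential of two non-commuting operators need not be disentangled. -/
theorem hasDerivAt_coherentCurve (α t : ℂ) (n : ℕ) :
    HasDerivAt (fun t => coherentCurve α t n)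
      (displacementGenerator α (coherentCurve α t) n) t := by
  have hα : starRingEnd ℂ α * α = ((‖α‖ ^ 2 : ℝ) : ℂ) := by
    rw [mul_comm, Complex.mul_conj, Complex.normSq_eq_norm_sq]
  have h1 : HasDerivAt (fun t : ℂ => Complex.exp (-(t ^ 2 * ((‖α‖ ^ 2 / 2 : ℝ) : ℂ))))
      (Complex.exp (-(t ^ 2 * ((‖α‖ ^ 2 / 2 : ℝ) : ℂ))) *
        (-(2 * t * ((‖α‖ ^ 2 / 2 : ℝ) : ℂ)))) t := by
    have := (((hasDerivAt_id t).pow 2).mul_const ((‖α‖ ^ 2 / 2 : ℝ) : ℂ)).neg.cexp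
    simpa using this
  have h2 : HasDerivAt (fun t : ℂ => (t * α) ^ n) (n * (t * α) ^ (n - 1) * α) t := by
    refine (((hasDerivAt_id t).mul_const α).pow n).congr_deriv ?_
    simp
  refine ((h1.mul h2).div_const _).congr_deriv ?_
  rw [displacementGenerator_apply]
  simp only [coherentCurve]
  set e := Complex.exp (-(t ^ 2 * ((‖α‖ ^ 2 / 2 : ℝ) : ℂ)))
  have e2 : starRingEnd ℂ α * ((√((n : ℝ) + 1) : ℂ) *
      (e * (t * α) ^ (n + 1) / √(Nat.factorial (n + 1) : ℝ))) =
      e * (2 * t * ((‖α‖ ^ 2 / 2 : ℝ) : ℂ)) * (t * α) ^ n / √(Nat.factorial n : ℝ) := by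
    rw [sqrt_factorial_succ]
    have := sqrt_succ_ne_zero n
    have := sqrt_factorial_ne_zero n
    push_cast at hα ⊢
    field_simp
    linear_combination e * t * (t * α) ^ n * hα
  rw [e2]
  rcases n with _ | n
  · simp
  · have e1 : ((√((n + 1 : ℕ) : ℝ) : ℝ) : ℂ) * (e * (t * α) ^ (n + 1 - 1) /
        √(Nat.factorial (n + 1 - 1) : ℝ)) =
        e * ((n + 1 : ℕ) * (t * α) ^ n) / √(Nat.factorial (n + 1) : ℝ) := by
      rw [sqrt_factorial_succ, Nat.add_sub_cancel]
      have := sqrt_succ_ne_zero n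
      have := sqrt_factorial_ne_zero n
      push_cast
      field_simp
      rw [sq, sqrt_succ_mul_self]
      ring
    rw [e1, Nat.add_sub_cancel]
    push_cast
    ring

theorem hasDerivAt_generator_pow (α : ℂ) (j : ℕ) : ∀ (n : ℕ) (t : ℂ),
    HasDerivAt (fun t => (displacementGenerator α ^ j) (coherentCurve α t) n)
      ((displacementGenerator α ^ (j + 1)) (coherentCurve α t) n) t := by
  induction j with
  | zero => intro n t; simpa using hasDerivAt_coherentCurve α t n
  | succ j ih =>
    intro n t
    have h := (((ih (n - 1) t).const_mul (√(n : ℝ) : ℂ)).const_mul α).sub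
      (((ih (n + 1) t).const_mul (√((n : ℝ) + 1) : ℂ)).const_mul (starRingEnd ℂ α))
    rw [pow_succ' _ (j + 1), Module.End.mul_apply, displacementGenerator_apply]
    refine h.congr_of_eventuallyEq (Eventually.of_forall fun s => ?_)
    simp only [pow_succ' _ j, Module.End.mul_apply, displacementGenerator_apply]
    rfl

theorem iteratedDeriv_coherentCurve (α : ℂ) (n j : ℕ) :
    iteratedDeriv j (fun t => coherentCurve α t n) =
      fun t => (displacementGenerator α ^ j) (coherentCurve α t) n := by
  induction j with
  | zero => ext t; simp
  | succ j ih =>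
    ext t
    rw [iteratedDeriv_succ, ih]
    exact (hasDerivAt_generator_pow α j n t).deriv

/-- Both sides are the Taylor series at `0`, evaluated at `1`, of the entire function `t ↦
coherentCurve α t n`: the curve starts at the vacuum, so its `j`-th derivative at `0` is the `n`-th
coordinate of the `j`-th power of the generator applied to `|0⟩`. -/
theorem coherentState_apply (α : ℂ) (n : ℕ) : coherentState α n = coherentAmp α n := by
  have h1 := hasSum_apply (summable_displacement α).hasSum n
  have hd : Differentiable ℂ fun t => coherentCurve α t n := fun t =>
    (hasDerivAt_coherentCurve α t n).differentiableAt
  have h2 := Complex.hasSum_taylorSeries_of_entire hd 0 1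
  have h0 : coherentCurve α 0 = Pi.single 0 1 := by
    ext i
    rcases i with _ | i <;> simp [coherentCurve]
  have h3 : coherentCurve α 1 n = coherentAmp α n := by
    simp [coherentCurve, coherentAmp]
  rw [h3] at h2
  refine h1.unique (h2.congr_fun ?_)
  intro j
  simp only [sub_zero, one_pow, one_smul, iteratedDeriv_coherentCurve, h0]
  rfl

/-! ### Translated states and their number distributions -/

theorem energyShift_apply_succ (ψ : Fock) (n : ℕ) : energyShift ψ (n + 1) = ψ n :=
  Nat.succ_injective.extend_apply _ _ _

theorem energyShift_apply_zero (ψ : Fock) : energyShift ψ 0 = 0 :=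
  Function.extend_apply' _ _ _ (by simp)

theorem energyShift_pow_add (ψ : Fock) (k n : ℕ) : (energyShift ^ k) ψ (k + n) = ψ n := by
  induction k with
  | zero => simp
  | succ k ih => rw [pow_succ', Module.End.mul_apply, add_right_comm, energyShift_apply_succ, ih]

theorem energyShift_pow_of_lt (ψ : Fock) (k : ℕ) : ∀ n < k, (energyShift ^ k) ψ n = 0 := by
  induction k with
  | zero => simp
  | succ k ih =>
    intro n hn
    rw [pow_succ', Module.End.mul_apply]
    rcases n with _ | n
    · exact energyShift_apply_zero _
    · rw [energyShift_apply_succ]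
      exact ih n (by omega)

theorem shiftedCoherent_add (α : ℂ) (k n : ℕ) :
    shiftedCoherent α k (k + n) = coherentAmp α n := by
  rw [shiftedCoherent, energyShift_pow_add, coherentState_apply]

theorem shiftedCoherent_of_lt (α : ℂ) {k n : ℕ} (h : n < k) : shiftedCoherent α k n = 0 :=
  energyShift_pow_of_lt _ k n h

theorem norm_coherentAmp (α : ℂ) (n : ℕ) : ‖coherentAmp α n‖ =
    Real.exp (-‖α‖ ^ 2 / 2) * ‖α‖ ^ n / √(Nat.factorial n : ℝ) := by
  rw [coherentAmp, norm_div, norm_mul, norm_pow, Complex.norm_exp, Complex.norm_real,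
    Real.norm_of_nonneg (Real.sqrt_nonneg _)]
  congr 3
  rw [← Complex.ofReal_neg, Complex.ofReal_re]
  ring_nf

/-- The Poisson weights `e^{-λ} λⁿ / n!`. -/
noncomputable def poisson (l : ℝ) (n : ℕ) : ℝ := Real.exp (-l) * l ^ n / Nat.factorial n

theorem sq_coherent_weight (r : ℝ) (n : ℕ) :
    (Real.exp (-r ^ 2 / 2) * r ^ n / √(Nat.factorial n : ℝ)) ^ 2 = poisson (r ^ 2) n := by
  rw [poisson, div_pow, Real.sq_sqrt (by positivity), mul_pow, ← Real.exp_nat_mul, ← pow_mul,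
    ← pow_mul, mul_comm n]
  congr 3
  push_cast
  ring

theorem norm_coherentAmp_sq (α : ℂ) (n : ℕ) : ‖coherentAmp α n‖ ^ 2 = poisson (‖α‖ ^ 2) n := by
  rw [norm_coherentAmp, sq_coherent_weight]

theorem poisson_nonneg {l : ℝ} (hl : 0 ≤ l) (n : ℕ) : 0 ≤ poisson l n := by
  unfold poisson; positivity

theorem hasSum_poisson (l : ℝ) : HasSum (poisson l) 1 := by
  have h := (NormedSpace.expSeries_div_hasSum_exp (𝔸 := ℝ) l).mul_left (Real.exp (-l))
  rw [← Real.exp_eq_exp_ℝ, ← Real.exp_add, neg_add_cancel, Real.exp_zero] at h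
  refine h.congr_fun fun n => ?_
  rw [poisson, mul_div_assoc]

theorem hasSum_norm_sq {ι : Type*} (ψ : Ell2 ι) : HasSum (fun i => ‖ψ i‖ ^ 2) (‖ψ‖ ^ 2) := by
  have := lp.hasSum_norm (p := 2) (by norm_num) ψ
  simpa using this

/-- `ψ` has the number distribution of `|α, k⟩` with `|α| = r`. -/
def HasShiftedPoisson (r : ℝ) (k : ℕ) (ψ : Fock) : Prop :=
  (∀ n < k, ψ n = 0) ∧ ∀ n, ‖ψ (k + n)‖ ^ 2 = poisson (r ^ 2) n

theorem hasShiftedPoisson_shiftedCoherent (α : ℂ) (k : ℕ) :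
    HasShiftedPoisson ‖α‖ k (shiftedCoherent α k) :=
  ⟨fun _ h => shiftedCoherent_of_lt α h, fun n => by
    rw [shiftedCoherent_add, norm_coherentAmp_sq]⟩

theorem HasShiftedPoisson.norm_eq {r : ℝ} {k : ℕ} {ψ φ : Fock} (hψ : HasShiftedPoisson r k ψ)
    (hφ : HasShiftedPoisson r k φ) (n : ℕ) : ‖ψ n‖ = ‖φ n‖ := by
  rcases lt_or_ge n k with h | h
  · rw [hψ.1 n h, hφ.1 n h]
  · obtain ⟨j, rfl⟩ := Nat.exists_eq_add_of_le h
    have := (hψ.2 j).trans (hφ.2 j).symm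
    exact (sq_eq_sq₀ (norm_nonneg _) (norm_nonneg _)).1 this

theorem HasShiftedPoisson.of_norm_eq {r : ℝ} {k : ℕ} {ψ φ : Fock} (hψ : HasShiftedPoisson r k ψ)
    (h : ∀ n, ‖φ n‖ = ‖ψ n‖) : HasShiftedPoisson r k φ :=
  ⟨fun n hn => by rw [← norm_eq_zero, h, hψ.1 n hn, norm_zero], fun n => by rw [h, hψ.2]⟩

theorem hasSum_add_iff_of_lt {M : Type*} [AddCommMonoid M] [TopologicalSpace M] {f : ℕ → M} {k : ℕ}
    {a : M} (h : ∀ n < k, f n = 0) : HasSum (fun n => f (k + n)) a ↔ HasSum f a := by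
  refine Function.Injective.hasSum_iff (g := fun n => k + n) (add_right_injective k) ?_
  intro n hn
  refine h n (not_le.1 fun hk => hn ⟨n - k, ?_⟩)
  dsimp only
  omega

theorem HasShiftedPoisson.norm {r : ℝ} {k : ℕ} {ψ : Fock} (hψ : HasShiftedPoisson r k ψ) :
    ‖ψ‖ = 1 := by
  have h1 : HasSum (fun n => ‖ψ (k + n)‖ ^ 2) 1 := by
    simp only [hψ.2]
    exact hasSum_poisson _
  rw [hasSum_add_iff_of_lt (f := fun n => ‖ψ n‖ ^ 2)
    fun n hn => by simp [hψ.1 n hn]] at h1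
  have := (hasSum_norm_sq ψ).unique h1
  nlinarith [norm_nonneg ψ]

/-! ### Raikov's theorem: the factors of a Poisson distribution are Poisson -/

/-- A zero-free entire function of exponential type is an exponential. -/
theorem eq_exp_of_ne_zero {f : ℂ → ℂ} (hf : Differentiable ℂ f) (h0 : ∀ z, f z ≠ 0) {C c : ℝ}
    (hc : 0 ≤ c) (hfC : ∀ z, ‖f z‖ ≤ C * Real.exp (c * ‖z‖)) :
    ∃ μ : ℂ, ∀ z, f z = f 0 * Complex.exp (μ * z) := by
  have hd : Differentiable ℂ (deriv f) :=
    (hf.contDiff (n := 2)).differentiable_deriv_two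
  -- A primitive `h` of the logarithmic derivative with `h 0 = 0` is a logarithm of `f / f 0`. It
  -- remains to show that `h` is linear.
  have hL : Differentiable ℂ fun z => deriv f z / f z := hd.div hf h0
  obtain ⟨h, hh0, hh⟩ := (Complex.IsConservativeOn.isExactOn_univ hL.continuous
    hL.differentiableOn.isConservativeOn).with_val_at 0 0
  simp only [Set.mem_univ, true_implies] at hh
  have hhd : Differentiable ℂ h := fun z => (hh z).differentiableAt
  have hexp : ∀ z, f z = f 0 * Complex.exp (h z) := by
    have hder : ∀ z, HasDerivAt (fun z => f z * Complex.exp (-h z)) 0 z := fun z => by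
      refine ((hf z).hasDerivAt.mul (hh z).neg.cexp).congr_deriv ?_
      have := h0 z
      field_simp
      ring
    have hconst := is_const_of_deriv_eq_zero (fun z => (hder z).differentiableAt)
      (fun z => (hder z).deriv)
    intro z
    have := hconst z 0
    rw [hh0, neg_zero, Complex.exp_zero, mul_one] at this
    rw [← this, mul_assoc, ← Complex.exp_add, neg_add_cancel, Complex.exp_zero, mul_one]
  have hf0 : 0 < ‖f 0‖ := norm_pos_iff.2 (h0 0)
  have hC : 0 < C := by
    have := hfC 0
    simp only [norm_zero, mul_zero, Real.exp_zero, mul_one] at this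
    linarith
  -- The summand `1` keeps `K` positive, so that the disc of radius `‖z‖ + K` used below is never
  -- degenerate.
  set K : ℝ := |Real.log (C / ‖f 0‖)| + 1 with hK
  have hKpos : 0 < K := by positivity
  -- The growth of `f` bounds only the real part of `h`. Borel–Carathéodory on the disc of radius
  -- `2‖z‖` turns this into a linear bound on `‖h‖`, Cauchy's estimate into a bound on `h'`, and
  -- Liouville makes `h'` constant.
  have hre : ∀ z, (h z).re ≤ c * ‖z‖ + K := fun z => by
    have h1 := hfC z
    rw [hexp z, norm_mul, Complex.norm_exp] at h1
    have h2 : Real.exp (h z).re ≤ Real.exp (Real.log (C / ‖f 0‖) + c * ‖z‖) := by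
      rw [Real.exp_add, Real.exp_log (by positivity), div_mul_eq_mul_div, le_div_iff₀ hf0]
      linarith
    have h3 := Real.exp_le_exp.1 h2
    have := le_abs_self (Real.log (C / ‖f 0‖))
    linarith
  have hbd : ∀ z, ‖h z‖ ≤ 4 * c * ‖z‖ + 2 * K := fun z => by
    by_cases hz : z = 0
    · rw [hz, hh0]
      simp [hKpos.le]
    · have hzp : 0 < ‖z‖ := norm_pos_iff.2 hz
      have := Complex.borelCaratheodory_zero (M := c * (2 * ‖z‖) + K) (R := 2 * ‖z‖) (z := z)
        (by positivity) hhd.differentiableOn (fun w hw => by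
          have hw' : ‖w‖ < 2 * ‖z‖ := by simpa using hw
          have h2 : c * ‖w‖ ≤ c * (2 * ‖z‖) := by gcongr
          exact (hre w).trans (by linarith)) (by positivity)
        (by simpa using by linarith) hh0
      refine this.trans (le_of_eq ?_)
      field_simp
      ring
  have hdb : ∀ z, ‖deriv h z‖ ≤ 8 * c + 2 := fun z => by
    set R := ‖z‖ + K
    have hR : 0 < R := by positivity
    have := Complex.norm_deriv_le_of_forall_mem_sphere_norm_le (c := z) (R := R)
      (C := 4 * c * (‖z‖ + R) + 2 * K) hR hhd.diffContOnCl (fun w hw => by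
        have : ‖w‖ ≤ ‖z‖ + R := by
          have h1 : ‖w - z‖ = R := by simpa [dist_eq_norm] using hw
          have := norm_add_le z (w - z)
          rw [add_sub_cancel, h1] at this
          exact this
        refine (hbd w).trans ?_
        gcongr)
    refine this.trans ?_
    rw [div_le_iff₀ hR]
    have : c * ‖z‖ ≤ c * R := by
      gcongr
      exact le_add_of_nonneg_right hKpos.le
    have h3 : K ≤ R := le_add_of_nonneg_left (norm_nonneg z)
    nlinarith
  have hhd' : Differentiable ℂ (deriv h) := (hhd.contDiff (n := 2)).differentiable_deriv_two
  obtain ⟨μ, hμ⟩ := hhd'.exists_const_forall_eq_of_bounded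
    (isBounded_iff_forall_norm_le.2 ⟨_, by rintro _ ⟨z, rfl⟩; exact hdb z⟩)
  refine ⟨μ, fun z => ?_⟩
  have hlin : ∀ z, HasDerivAt (fun z => h z - μ * z) 0 z := fun z => by
    refine ((hhd z).hasDerivAt.sub ((hasDerivAt_id z).const_mul μ)).congr_deriv ?_
    rw [hμ]
    simp
  have := is_const_of_deriv_eq_zero (fun z => (hlin z).differentiableAt)
    (fun z => (hlin z).deriv) z 0
  rw [hh0, mul_zero, sub_zero, sub_eq_zero] at this
  rw [hexp z, this]

theorem summable_coeff_of_le {a : ℕ → ℂ} {C c : ℝ} (ha : ∀ i, ‖a i‖ ≤ C * (c ^ i / Nat.factorial i))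
    (z : ℂ) : Summable fun i => ‖a i * z ^ i‖ := by
  refine Summable.of_nonneg_of_le (fun i => norm_nonneg _) (fun i => ?_)
    ((Real.summable_pow_div_factorial (c * ‖z‖)).mul_left C)
  rw [norm_mul, norm_pow, mul_pow]
  calc ‖a i‖ * ‖z‖ ^ i ≤ C * (c ^ i / Nat.factorial i) * ‖z‖ ^ i := by
        gcongr
        exact ha i
    _ = _ := by ring

theorem hasFPowerSeriesOnBall_of_le {a : ℕ → ℂ} {C c : ℝ}
    (ha : ∀ i, ‖a i‖ ≤ C * (c ^ i / Nat.factorial i)) :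
    HasFPowerSeriesOnBall (fun z : ℂ => ∑' i, a i * z ^ i)
      (FormalMultilinearSeries.ofScalars ℂ a) 0 ⊤ := by
  have hr : (FormalMultilinearSeries.ofScalars ℂ a).radius = ⊤ := by
    refine FormalMultilinearSeries.radius_eq_top_of_summable_norm _ fun r => ?_
    refine (summable_coeff_of_le ha r).congr fun i => ?_
    simp
  have h := (FormalMultilinearSeries.ofScalars ℂ a).hasFPowerSeriesOnBall (by rw [hr]; simp)
  rw [hr] at h
  refine h.congr fun z _ => ?_
  change FormalMultilinearSeries.ofScalarsSum a z = _
  rw [FormalMultilinearSeries.ofScalarsSum_eq_tsum]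
  simp

theorem coeff_eq_of_tsum_eq {a b : ℕ → ℂ} {C c D d : ℝ}
    (ha : ∀ i, ‖a i‖ ≤ C * (c ^ i / Nat.factorial i))
    (hb : ∀ i, ‖b i‖ ≤ D * (d ^ i / Nat.factorial i))
    (h : ∀ z, ∑' i, a i * z ^ i = ∑' i, b i * z ^ i) : a = b := by
  have h1 := (hasFPowerSeriesOnBall_of_le ha).hasFPowerSeriesAt
  have h2 := (hasFPowerSeriesOnBall_of_le hb).hasFPowerSeriesAt
  have h3 := h1.eq_formalMultilinearSeries_of_eventually h2 (Eventually.of_forall h)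
  exact FormalMultilinearSeries.ofScalars_series_injective ℂ ℂ h3

theorem tsum_exp_coeff (a μ z : ℂ) :
    ∑' i : ℕ, (a * (μ ^ i / Nat.factorial i)) * z ^ i = a * Complex.exp (μ * z) := by
  have h := (NormedSpace.expSeries_div_hasSum_exp (𝔸 := ℂ) (μ * z)).mul_left a
  rw [← Complex.exp_eq_exp_ℂ] at h
  rw [← h.tsum_eq]
  refine tsum_congr fun i => ?_
  rw [mul_pow]
  ring

/-- If a product of two nonnegative power series is that of a Poisson distribution, then the first
factor has the coefficients of a Poisson distribution. -/
theorem coeff_of_poisson_factor {l : ℝ} (hl : 0 ≤ l) {A B : ℕ → ℝ} (hA : ∀ i, 0 ≤ A i)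
    (hB : ∀ i, 0 ≤ B i)
    (h : ∀ q, ∑ p ∈ Finset.HasAntidiagonal.antidiagonal q, A p.1 * B p.2 = poisson l q) :
    ∃ μ : ℝ, 0 ≤ μ ∧ A 1 = A 0 * μ ∧ ∀ i, A i = A 0 * (μ ^ i / Nat.factorial i) := by
  have h0 : A 0 * B 0 = Real.exp (-l) := by simpa [poisson] using h 0
  have hA0 : 0 < A 0 := (hA 0).lt_of_ne' fun e => by
    rw [e, zero_mul] at h0
    exact (Real.exp_pos _).ne h0
  have hB0 : 0 < B 0 := (hB 0).lt_of_ne' fun e => by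
    rw [e, mul_zero] at h0
    exact (Real.exp_pos _).ne h0
  -- A coefficient times the positive leading coefficient of the other series is one term of a
  -- convolution of nonnegative numbers. Both series therefore inherit the factorial decay of the
  -- Poisson weights and are entire of exponential type.
  have hAle : ∀ i, ‖(A i : ℂ)‖ ≤ (Real.exp (-l) / B 0) * (l ^ i / Nat.factorial i) := fun i => by
    rw [Complex.norm_real, Real.norm_of_nonneg (hA i), div_mul_eq_mul_div, le_div_iff₀ hB0]
    calc A i * B 0 ≤ ∑ p ∈ Finset.HasAntidiagonal.antidiagonal i, A p.1 * B p.2 :=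
          Finset.single_le_sum (f := fun p : ℕ × ℕ => A p.1 * B p.2)
            (fun p _ => mul_nonneg (hA _) (hB _)) (a := (i, 0)) (by simp)
      _ = _ := by rw [h, poisson, mul_div_assoc]
  have hBle : ∀ i, ‖(B i : ℂ)‖ ≤ (Real.exp (-l) / A 0) * (l ^ i / Nat.factorial i) := fun i => by
    rw [Complex.norm_real, Real.norm_of_nonneg (hB i), div_mul_eq_mul_div, le_div_iff₀ hA0]
    calc B i * A 0 = A 0 * B i := mul_comm _ _
      _ ≤ ∑ p ∈ Finset.HasAntidiagonal.antidiagonal i, A p.1 * B p.2 :=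
          Finset.single_le_sum (f := fun p : ℕ × ℕ => A p.1 * B p.2)
            (fun p _ => mul_nonneg (hA _) (hB _)) (a := (0, i)) (by simp)
      _ = _ := by rw [h, poisson, mul_div_assoc]
  set f : ℂ → ℂ := fun z => ∑' i, (A i : ℂ) * z ^ i with hf
  set g : ℂ → ℂ := fun z => ∑' i, (B i : ℂ) * z ^ i with hg
  have hfg : ∀ z, f z * g z = Complex.exp (-l) * Complex.exp (l * z) := fun z => by
    rw [hf, hg]
    dsimp only
    rw [tsum_mul_tsum_eq_tsum_sum_antidiagonal_of_summable_norm (summable_coeff_of_le hAle z)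
      (summable_coeff_of_le hBle z), ← tsum_exp_coeff]
    refine tsum_congr fun q => ?_
    have hq := congrArg (fun x : ℝ => (x : ℂ)) (h q)
    simp only [poisson] at hq
    push_cast at hq
    rw [← mul_div_assoc, ← hq, Finset.sum_mul]
    refine Finset.sum_congr rfl fun p hp => ?_
    rw [← Finset.HasAntidiagonal.mem_antidiagonal.1 hp, pow_add]
    ring
  -- The product of the two generating functions is an exponential, so neither factor has a zero.
  have hf0 : ∀ z, f z ≠ 0 := fun z e => by
    have := hfg z
    rw [e, zero_mul] at this
    exact mul_ne_zero (Complex.exp_ne_zero _) (Complex.exp_ne_zero _) this.symm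
  have hfd : Differentiable ℂ f := by
    have := (hasFPowerSeriesOnBall_of_le hAle).differentiableOn
    rw [Metric.eball_top] at this
    exact differentiableOn_univ.1 this
  have hfb : ∀ z, ‖f z‖ ≤ (Real.exp (-l) / B 0) * Real.exp (l * ‖z‖) := fun z => by
    have hs := (NormedSpace.expSeries_div_hasSum_exp (𝔸 := ℝ) (l * ‖z‖)).mul_left
      (Real.exp (-l) / B 0)
    rw [← Real.exp_eq_exp_ℝ] at hs
    refine tsum_of_norm_bounded hs fun i => ?_
    rw [norm_mul, norm_pow, mul_pow]
    calc ‖(A i : ℂ)‖ * ‖z‖ ^ i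
        ≤ (Real.exp (-l) / B 0) * (l ^ i / Nat.factorial i) * ‖z‖ ^ i := by
          gcongr
          exact hAle i
      _ = _ := by ring
  obtain ⟨μ, hμ⟩ := eq_exp_of_ne_zero hfd hf0 hl hfb
  have hf00 : f 0 = A 0 := by
    rw [hf]
    dsimp only
    rw [tsum_eq_single 0 (fun i hi => by simp [hi])]
    simp
  have hco : (fun i => (A i : ℂ)) = fun i => (A 0 : ℂ) * (μ ^ i / Nat.factorial i) := by
    refine coeff_eq_of_tsum_eq (C := Real.exp (-l) / B 0) (c := l) (D := A 0) (d := ‖μ‖) hAle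
      (fun i => ?_) fun z => ?_
    · rw [norm_mul, norm_div, norm_pow, Complex.norm_natCast, Complex.norm_real,
        Real.norm_of_nonneg (hA 0)]
    · rw [tsum_exp_coeff, ← hf00, ← hμ]
  -- The exponent comes from complex analysis; the coefficient of order one shows that it is real
  -- and nonnegative.
  have hμr : μ = ((A 1 / A 0 : ℝ) : ℂ) := by
    have := congrFun hco 1
    simp only [pow_one, Nat.factorial_one, Nat.cast_one, div_one] at this
    have hne : (A 0 : ℂ) ≠ 0 := by exact_mod_cast hA0.ne'
    push_cast
    rw [this]
    field_simp
  refine ⟨A 1 / A 0, div_nonneg (hA 1) (hA 0), by field_simp, fun i => ?_⟩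
  have := congrFun hco i
  simp only [hμr] at this
  exact_mod_cast this

/-- Raikov's theorem for nonnegative sequences whose convolution is a Poisson distribution. -/
theorem raikov {l : ℝ} (hl : 0 ≤ l) {A B : ℕ → ℝ} (hA : ∀ i, 0 ≤ A i) (hB : ∀ i, 0 ≤ B i)
    (h : ∀ q, ∑ p ∈ Finset.HasAntidiagonal.antidiagonal q, A p.1 * B p.2 = poisson l q) (hA1 : HasSum A 1)
    (hB1 : HasSum B 1) :
    ∃ μ ν : ℝ, 0 ≤ μ ∧ 0 ≤ ν ∧ μ + ν = l ∧ (∀ i, A i = poisson μ i) ∧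
      ∀ i, B i = poisson ν i := by
  -- Total mass one forces the leading coefficient to be `e^{-μ}`.
  have norm : ∀ {A : ℕ → ℝ} {μ : ℝ}, HasSum A 1 → (∀ i, A i = A 0 * (μ ^ i / Nat.factorial i)) →
      ∀ i, A i = poisson μ i := by
    intro A μ h1 hA
    have h2 : HasSum A (A 0 * Real.exp μ) := by
      have hs := (NormedSpace.expSeries_div_hasSum_exp (𝔸 := ℝ) μ).mul_left (A 0)
      rw [← Real.exp_eq_exp_ℝ] at hs
      exact hs.congr_fun hA
    have h3 : A 0 = Real.exp (-μ) := by
      rw [Real.exp_neg]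
      exact eq_inv_of_mul_eq_one_left (h2.unique h1)
    intro i
    rw [hA i, h3, poisson, mul_div_assoc]
  obtain ⟨μ, hμ, hAμ, hAi⟩ := coeff_of_poisson_factor hl hA hB h
  obtain ⟨ν, hν, hBν, hBi⟩ := coeff_of_poisson_factor hl hB hA fun q => by
    rw [← h q, ← Finset.Nat.sum_antidiagonal_swap]
    exact Finset.sum_congr rfl fun p _ => mul_comm _ _
  refine ⟨μ, ν, hμ, hν, ?_, norm hA1 hAi, norm hB1 hBi⟩
  -- The coefficients of orders zero and one of the convolution give `μ + ν = l`.
  have h0 : A 0 * B 0 = Real.exp (-l) := by simpa [poisson] using h 0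
  have h1 : A 0 * B 1 + A 1 * B 0 = Real.exp (-l) * l := by
    simpa [poisson, Finset.Nat.antidiagonal_succ] using h 1
  rw [hAμ, hBν] at h1
  have h2 : Real.exp (-l) * (μ + ν) = Real.exp (-l) * l := by
    rw [← h1, ← h0]
    ring
  exact mul_left_cancel₀ (Real.exp_pos _).ne' h2

/-! ### Energy-conserving unitaries -/

theorem hasSum_mem_of_isClosed {M ι : Type*} [AddCommGroup M] [Module ℂ M] [TopologicalSpace M]
    {S : Submodule ℂ M} (hS : IsClosed (S : Set M)) {f : ι → M} {a : M} (h : HasSum f a)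
    (hf : ∀ i, f i ∈ S) : a ∈ S :=
  hS.mem_of_tendsto h (Eventually.of_forall fun _ => Submodule.sum_mem _ fun i _ => hf i)

theorem memℓp_phase {ι : Type*} {c : ι → ℂ} (hc : ∀ i, ‖c i‖ = 1) (ψ : Ell2 ι) :
    Memℓp (fun i => c i * ψ i) 2 := by
  refine memℓp_gen (((memℓp_gen_iff (by norm_num)).1 (lp.memℓp ψ)).congr fun i => ?_)
  rw [norm_mul, hc, one_mul]

/-- The diagonal unitary `|i⟩ ↦ c i |i⟩`. -/
noncomputable def phaseUnitary {ι : Type*} (c : ι → ℂ) (hc : ∀ i, ‖c i‖ = 1) :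
    Ell2 ι ≃ₗᵢ[ℂ] Ell2 ι where
  toFun := fun ψ => ⟨fun i => c i * ψ i, memℓp_phase hc ψ⟩
  invFun := fun ψ => ⟨fun i => starRingEnd ℂ (c i) * ψ i, memℓp_phase (by simpa using hc) ψ⟩
  map_add' := fun a b => by ext i; exact mul_add _ _ _
  map_smul' := fun r a => by ext i; exact mul_left_comm _ _ _
  left_inv := fun ψ => by
    ext i
    change starRingEnd ℂ (c i) * (c i * ψ i) = ψ i
    rw [← mul_assoc, Complex.conj_mul', hc]
    simp
  right_inv := fun ψ => by
    ext i
    change c i * (starRingEnd ℂ (c i) * ψ i) = ψ i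
    rw [← mul_assoc, Complex.mul_conj', hc]
    simp
  norm_map' := fun ψ => by
    have h1 := hasSum_norm_sq ψ
    have h2 := hasSum_norm_sq (⟨fun i => c i * ψ i, memℓp_phase hc ψ⟩ : Ell2 ι)
    refine (sq_eq_sq₀ (norm_nonneg _) (norm_nonneg _)).1 (h2.unique (h1.congr_fun fun i => ?_))
    change ‖c i * ψ i‖ ^ 2 = ‖ψ i‖ ^ 2
    rw [norm_mul, hc, one_mul]

theorem phaseUnitary_apply {ι : Type*} (c : ι → ℂ) (hc : ∀ i, ‖c i‖ = 1) (ψ : Ell2 ι) (i : ι) :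
    phaseUnitary c hc ψ i = c i * ψ i := rfl

theorem phaseUnitary_symm {ι : Type*} (c : ι → ℂ) (hc : ∀ i, ‖c i‖ = 1) :
    (phaseUnitary c hc).symm = phaseUnitary (fun i => starRingEnd ℂ (c i)) (by simpa using hc) := by
  ext ψ i
  rfl

section Graph

variable {G : Type*} [NormedAddCommGroup G] [InnerProductSpace ℂ G]

/-- A closed subspace of `G × G` that is symmetric, such as the graph of a closed symmetric
operator. -/
structure IsClosedSymmetric (Γ : Submodule ℂ (G × G)) : Prop where
  isClosed : IsClosed (Γ : Set (G × G))
  symm : ∀ {z w z' w'}, (z, w) ∈ Γ → (z', w') ∈ Γ → inner ℂ w z' = inner ℂ z w'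

namespace IsClosedSymmetric

variable {Γ : Submodule ℂ (G × G)}

theorem inner_eigen (h : IsClosedSymmetric Γ) {x z w : G} {e : ℝ} (hx : (x, (e : ℂ) • x) ∈ Γ)
    (hz : (z, w) ∈ Γ) : inner ℂ x w = e * inner ℂ x z := by
  rw [← h.symm hx hz, inner_smul_left, Complex.conj_ofReal]

theorem orthogonal (h : IsClosedSymmetric Γ) {x y : G} {e e' : ℝ} (hx : (x, (e : ℂ) • x) ∈ Γ)
    (hy : (y, (e' : ℂ) • y) ∈ Γ) (hee : e ≠ e') : inner ℂ x y = 0 := by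
  have h1 := h.inner_eigen hx hy
  rw [inner_smul_right] at h1
  have h2 : ((e' : ℂ) - e) * inner ℂ x y = 0 := by linear_combination h1
  refine (mul_eq_zero.1 h2).resolve_left fun h3 => hee ?_
  exact_mod_cast (sub_eq_zero.1 h3).symm

/-- The unitary that multiplies the vectors `b i` of a Hilbert basis by phases. -/
noncomputable def basisPhase {κ : Type*} (b : HilbertBasis κ ℂ G) (c : κ → ℂ)
    (hc : ∀ i, ‖c i‖ = 1) : G ≃ₗᵢ[ℂ] G :=
  (b.repr.trans (phaseUnitary c hc)).trans b.repr.symm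

theorem repr_basisPhase {κ : Type*} (b : HilbertBasis κ ℂ G) (c : κ → ℂ) (hc : ∀ i, ‖c i‖ = 1)
    (z : G) (i : κ) : b.repr (basisPhase b c hc z) i = c i * b.repr z i := by
  simp [basisPhase, phaseUnitary_apply]

theorem basisPhase_symm {κ : Type*} (b : HilbertBasis κ ℂ G) (c : κ → ℂ) (hc : ∀ i, ‖c i‖ = 1) :
    (basisPhase b c hc).symm =
      basisPhase b (fun i => starRingEnd ℂ (c i)) (by simpa using hc) := by
  rw [basisPhase, basisPhase, ← phaseUnitary_symm c hc]
  rfl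

/-- Write `U` for the unitary. `U - 1` acts only along the eigenvectors that acquire a nontrivial
phase, and by symmetry the coefficient of `w` along such a vector is `e` times that of `z`. So `(U z
- z, U w - w)` is a convergent sum of eigenpairs and lies in the closed graph. The other basis
vectors need not even be in the domain. -/
theorem basisPhase_mem (h : IsClosedSymmetric Γ) {κ : Type*} (b : HilbertBasis κ ℂ G) (c : κ → ℂ)
    (hc : ∀ i, ‖c i‖ = 1) (hb : ∀ i, c i ≠ 1 → ∃ e : ℝ, (b i, (e : ℂ) • b i) ∈ Γ) {z w : G}
    (hzw : (z, w) ∈ Γ) : (basisPhase b c hc z, basisPhase b c hc w) ∈ Γ := by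
  have hs : ∀ z, HasSum (fun i => ((c i - 1) * b.repr z i) • b i) (basisPhase b c hc z - z) := by
    intro z
    refine ((b.hasSum_repr _).sub (b.hasSum_repr z)).congr_fun fun i => ?_
    rw [repr_basisPhase, ← sub_smul, sub_mul, one_mul]
  have h1 : (basisPhase b c hc z - z, basisPhase b c hc w - w) ∈ Γ := by
    refine hasSum_mem_of_isClosed h.isClosed ((hs z).prodMk (hs w)) fun i => ?_
    by_cases hi : c i = 1
    · simp only [hi, sub_self, zero_mul, zero_smul]
      exact Γ.zero_mem
    · obtain ⟨e, he⟩ := hb i hi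
      have h2 := h.inner_eigen he hzw
      have h3 : (((c i - 1) * b.repr z i) • b i, ((c i - 1) * b.repr w i) • b i) =
          ((c i - 1) * b.repr z i) • (b i, (e : ℂ) • b i) := by
        rw [Prod.smul_mk, smul_smul, b.repr_apply_apply w, h2, b.repr_apply_apply]
        congr 2
        ring
      rw [h3]
      exact Γ.smul_mem _ he
  have := Γ.add_mem h1 hzw
  simpa using this

variable [CompleteSpace G]

/-- Two families of eigenvectors with the same distinct eigenvalues and the same norms are
related by a unitary that preserves the graph. -/
theorem exists_unitary (h : IsClosedSymmetric Γ) {ι : Type*} (x y : ι → G) (e : ι → ℝ)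
    (he : Function.Injective e) (hx : ∀ i, (x i, (e i : ℂ) • x i) ∈ Γ)
    (hy : ∀ i, (y i, (e i : ℂ) • y i) ∈ Γ) (hxy : ∀ i, ‖x i‖ = ‖y i‖) :
    ∃ U : G ≃ₗᵢ[ℂ] G, (∀ z w, (z, w) ∈ Γ ↔ (U z, U w) ∈ Γ) ∧ ∀ i, U (x i) = y i := by
  classical
  -- Since `x i` and `y i` have equal norms, `d i` has inner products `a i` and `-conj (a i)` with
  -- them, and `‖d i‖² = 2 Re (a i)`. The phase `-conj (a i) / a i` along `d i`, with the identity
  -- on the complement, therefore takes `x i` to `y i`. Distinct eigenvalues make the `d i`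
  -- orthogonal to one another, so all these phases can be applied at once.
  set d : ι → G := fun i => x i - y i with hd
  have hdΓ : ∀ i, (d i, (e i : ℂ) • d i) ∈ Γ := fun i => by
    have := Γ.sub_mem (hx i) (hy i)
    rwa [Prod.mk_sub_mk, ← smul_sub] at this
  set a : ι → ℂ := fun i => inner ℂ (d i) (x i) with ha
  have hdy : ∀ i, inner ℂ (d i) (y i) = -starRingEnd ℂ (a i) := fun i => by
    simp only [ha, hd, inner_sub_left, map_sub, inner_conj_symm]
    rw [inner_self_eq_norm_sq_to_K, inner_self_eq_norm_sq_to_K, hxy]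
    ring
  have haz : ∀ i, d i ≠ 0 → a i ≠ 0 := fun i hi h0 => hi <| by
    rw [← inner_self_eq_zero (𝕜 := ℂ)]
    change inner ℂ (d i) (x i - y i) = 0
    rw [inner_sub_right, hdy i]
    change a i - _ = 0
    rw [h0]
    simp
  set v : {i // d i ≠ 0} → G := fun i => ((‖d i‖⁻¹ : ℝ) : ℂ) • d i with hv
  have hvd : ∀ i : {i // d i ≠ 0}, d i = (‖d i‖ : ℂ) • v i := fun i => by
    rw [hv]
    dsimp only
    rw [smul_smul, ← Complex.ofReal_mul, mul_inv_cancel₀ (norm_ne_zero_iff.2 i.2),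
      Complex.ofReal_one, one_smul]
  have hvo : Orthonormal ℂ v := by
    refine ⟨fun i => ?_, fun i j hij => ?_⟩
    · rw [hv]
      dsimp only
      rw [norm_smul, Complex.norm_real, norm_inv, norm_norm,
        inv_mul_cancel₀ (norm_ne_zero_iff.2 i.2)]
    · rw [hv]
      dsimp only
      rw [inner_smul_left, inner_smul_right, h.orthogonal (hdΓ i) (hdΓ j)
        (fun hh => hij (Subtype.ext (he hh)))]
      simp
  obtain ⟨W, b, hsub, hbW⟩ := hvo.toSubtypeRange.exists_hilbertBasis_extension
  have hinj : Function.Injective v := hvo.linearIndependent.injective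
  set c₀ : {i // d i ≠ 0} → ℂ := fun i => -starRingEnd ℂ (a i) / a i with hc₀
  -- The default value `1` of the extension leaves all other basis vectors fixed.
  set c : W → ℂ := fun j => Function.extend v c₀ 1 j with hcdef
  have hc : ∀ j, ‖c j‖ = 1 := fun j => by
    rw [hcdef]
    dsimp only
    by_cases hj : ∃ i, v i = j
    · obtain ⟨i, hi⟩ := hj
      rw [← hi, hinj.extend_apply, hc₀]
      dsimp only
      rw [norm_div, norm_neg, RCLike.norm_conj, div_self (norm_ne_zero_iff.2 (haz i i.2))]
    · rw [Function.extend_apply' _ _ _ hj]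
      simp
  have hcb : ∀ j, c j ≠ 1 → ∃ e : ℝ, (b j, (e : ℂ) • b j) ∈ Γ := fun j hj => by
    by_cases hj' : ∃ i, v i = j
    · obtain ⟨i, hi⟩ := hj'
      refine ⟨e i, ?_⟩
      rw [hbW, ← hi]
      have := Γ.smul_mem ((‖d i‖⁻¹ : ℝ) : ℂ) (hdΓ i)
      rwa [Prod.smul_mk, smul_comm] at this
    · exact absurd (Function.extend_apply' _ _ _ hj') hj
  refine ⟨basisPhase b c hc, fun z w => ⟨h.basisPhase_mem b c hc hcb, fun hU => ?_⟩, fun n => ?_⟩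
  · have := h.basisPhase_mem b (fun i => starRingEnd ℂ (c i)) (by simpa using hc)
      (fun j hj => hcb j fun hh => hj (by simp [hh])) hU
    rw [← basisPhase_symm b c hc] at this
    simpa using this
  · refine b.repr.injective ?_
    ext j
    rw [repr_basisPhase, b.repr_apply_apply, b.repr_apply_apply, hbW]
    dsimp only
    by_cases hj : ∃ i, v i = j
    · obtain ⟨i, hi⟩ := hj
      rw [hcdef]
      dsimp only
      rw [← hi, hinj.extend_apply, hv]
      dsimp only
      rw [inner_smul_left, inner_smul_left]
      by_cases hin : (i : ι) = n
      · rw [← hin, hdy, hc₀]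
        dsimp only
        change _ * (_ * a i) = _
        have := haz i i.2
        field_simp
      · rw [h.orthogonal (hdΓ i) (hx n) (he.ne hin), h.orthogonal (hdΓ i) (hy n) (he.ne hin)]
        simp
    · rw [hcdef]
      dsimp only
      rw [Function.extend_apply' _ _ _ hj, Pi.one_apply, one_mul, ← sub_eq_zero, ← inner_sub_right]
      change inner ℂ (j : G) (d n) = 0
      by_cases hn : d n = 0
      · rw [hn, inner_zero_right]
      · have hjn : j ≠ ⟨v ⟨n, hn⟩, hsub ⟨_, rfl⟩⟩ := fun hh => hj ⟨⟨n, hn⟩, by rw [hh]⟩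
        have := b.orthonormal.2 hjn
        rw [hbW] at this
        rw [hvd ⟨n, hn⟩, inner_smul_right, this, mul_zero]

end IsClosedSymmetric

end Graph

/-! ### Graphs of diagonal operators -/

theorem mem_maximalOp_graph {ι : Type*} {T : (ι → ℂ) →ₗ[ℂ] (ι → ℂ)} {ψ χ : Ell2 ι} :
    (ψ, χ) ∈ (maximalOp T).graph ↔ ∀ i, χ i = T ψ i := by
  rw [LinearPMap.mem_graph_iff]
  constructor
  · rintro ⟨x, rfl, rfl⟩ i
    rfl
  · intro h
    have h' : (χ : ι → ℂ) = T ψ := funext h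
    have hm : Memℓp (T ψ) 2 := h' ▸ lp.memℓp χ
    exact ⟨⟨ψ, hm⟩, rfl, lp.ext h'.symm⟩

theorem mem_oscillatorHam_graph {ε : ℝ} {ψ χ : Fock} :
    (ψ, χ) ∈ (oscillatorHam ε).graph ↔ ∀ n, χ n = ((ε * n : ℝ) : ℂ) * ψ n := by
  rw [oscillatorHam, mem_maximalOp_graph, raise_comp_lower]
  rfl

theorem mem_ladder_graph {ε : ℝ} {ψ χ : Ell2 ℤ} :
    (ψ, χ) ∈ (ladder ε).ham.graph ↔ ∀ n, χ n = ((ε * n : ℝ) : ℂ) * ψ n :=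
  mem_maximalOp_graph

/-- The number state `|n⟩`. -/
noncomputable def number (n : ℕ) : Fock := lp.single 2 n 1

theorem number_apply (n j : ℕ) : number n j = if j = n then 1 else 0 := by
  rw [number, lp.single_apply, Pi.single_apply]

theorem norm_number (n : ℕ) : ‖number n‖ = 1 := by
  rw [number, lp.norm_single (by norm_num), norm_one]

theorem hasSum_number (ψ : Fock) : HasSum (fun n => ψ n • number n) ψ := by
  refine (lp.hasSum_single (p := 2) (by norm_num) ψ).congr_fun fun n => ?_
  rw [number, ← lp.single_smul, smul_eq_mul, mul_one]

theorem number_mem_graph (ε : ℝ) (n : ℕ) :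
    (number n, ((ε * n : ℝ) : ℂ) • number n) ∈ (oscillatorHam ε).graph := by
  rw [mem_oscillatorHam_graph]
  intro j
  rw [lp.coeFn_smul, Pi.smul_apply, smul_eq_mul, number_apply]
  split_ifs with h
  · rw [h]
  · simp

/-! ### The joint system of the oscillator and a weight -/

section Symmetric

variable {F : Type*} [NormedAddCommGroup F] [InnerProductSpace ℂ F] [CompleteSpace F]

theorem isClosedSymmetric_of_isSelfAdjoint {T : F →ₗ.[ℂ] F} (hT : IsSelfAdjoint T) :
    IsClosedSymmetric T.graph where
  isClosed := hT.isClosed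
  symm := by
    intro z w z' w' h h'
    rw [LinearPMap.mem_graph_iff] at h h'
    obtain ⟨x, rfl, rfl⟩ := h
    obtain ⟨y, rfl, rfl⟩ := h'
    have h1 := LinearPMap.adjoint_isFormalAdjoint hT.dense_domain
    rw [LinearPMap.isSelfAdjoint_def.1 hT] at h1
    exact h1 x y

end Symmetric

section Products

variable {E : Type*} [NormedAddCommGroup E] [InnerProductSpace ℂ E]
variable {F : Type*} [NormedAddCommGroup F] [InnerProductSpace ℂ F]

/-- The product vector `x ⊗ y` as a continuous bilinear map. -/
noncomputable def prodVecL : E →L[ℂ] F →L[ℂ] HilbertTensor E F :=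
  (ContinuousLinearMap.compL ℂ F (E ⊗[ℂ] F) (HilbertTensor E F)
    UniformSpace.Completion.toComplL).comp (TensorProduct.mkL ℂ E F)

theorem prodVecL_apply (x : E) (y : F) : prodVecL x y = prodVec x y := rfl

theorem norm_prodVec (x : E) (y : F) : ‖prodVec x y‖ = ‖x‖ * ‖y‖ := by
  rw [prodVec, UniformSpace.Completion.norm_coe, TensorProduct.norm_tmul]

theorem prodVec_mem_totalHamGraph {H : E →ₗ.[ℂ] E} {K : F →ₗ.[ℂ] F} {x x' : E} {y y' : F}
    (hx : (x, x') ∈ H.graph) (hy : (y, y') ∈ K.graph) :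
    (prodVec x y, prodVec x' y + prodVec x y') ∈ totalHamGraph H K := by
  rw [LinearPMap.mem_graph_iff] at hx hy
  obtain ⟨x, rfl, rfl⟩ := hx
  obtain ⟨y, rfl, rfl⟩ := hy
  exact subset_closure (Submodule.subset_span ⟨x, y, rfl⟩)

theorem prodVec_eigen {H : E →ₗ.[ℂ] E} {K : F →ₗ.[ℂ] F} {x : E} {y : F} {a b : ℝ}
    (hx : (x, (a : ℂ) • x) ∈ H.graph) (hy : (y, (b : ℂ) • y) ∈ K.graph) :
    (prodVec x y, ((a + b : ℝ) : ℂ) • prodVec x y) ∈ totalHamGraph H K := by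
  have h := prodVec_mem_totalHamGraph hx hy
  simp only [← prodVecL_apply, map_smul, smul_apply, ← add_smul] at h ⊢
  rwa [Complex.ofReal_add]

end Products

/-! ### Partial inner products with number states -/

section Fibers

variable {F : Type*} [NormedAddCommGroup F] [InnerProductSpace ℂ F]

theorem memℓp_smul_const (x : Fock) (y : F) : Memℓp (fun n => x n • y) 2 := by
  refine memℓp_gen ((((memℓp_gen_iff (by norm_num)).1 (lp.memℓp x)).mul_right
    (‖y‖ ^ (2 : ENNReal).toReal)).congr fun n => ?_)
  rw [norm_smul, Real.mul_rpow (norm_nonneg _) (norm_nonneg _)]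

/-- The sequence of the vectors `(⟨n| ⊗ 1) z` for `z` in the algebraic tensor product. -/
noncomputable def algFibers : Fock ⊗[ℂ] F →ₗ[ℂ] lp (fun _ : ℕ => F) 2 :=
  TensorProduct.lift (LinearMap.mk₂ ℂ (fun x y => ⟨fun n => x n • y, memℓp_smul_const x y⟩)
    (fun a b y => by ext n; exact add_smul _ _ _)
    (fun c a y => by ext n; exact mul_smul _ _ _)
    (fun a y y' => by ext n; exact smul_add _ _ _)
    (fun c a y => by ext n; exact smul_comm _ _ _))

theorem algFibers_tmul (x : Fock) (y : F) (n : ℕ) : algFibers (x ⊗ₜ[ℂ] y) n = x n • y := rfl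

theorem inner_algFibers (u v : Fock ⊗[ℂ] F) :
    inner ℂ (algFibers u) (algFibers v) = inner ℂ u v := by
  induction u using TensorProduct.induction_on with
  | zero => simp
  | add a b ha hb => rw [map_add, inner_add_left, inner_add_left, ha, hb]
  | tmul x y =>
    induction v using TensorProduct.induction_on with
    | zero => simp
    | add a b ha hb => rw [map_add, inner_add_right, inner_add_right, ha, hb]
    | tmul x' y' =>
      rw [TensorProduct.inner_tmul]
      have h1 := lp.hasSum_inner (𝕜 := ℂ) (algFibers (x ⊗ₜ[ℂ] y)) (algFibers (x' ⊗ₜ[ℂ] y'))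
      have h2 := (lp.hasSum_inner (𝕜 := ℂ) x x').mul_right (inner ℂ y y')
      refine h1.unique (h2.congr_fun fun n => ?_)
      rw [algFibers_tmul, algFibers_tmul, inner_smul_left, inner_smul_right, ← mul_assoc]
      rw [RCLike.inner_apply]
      ring

/-- `algFibers` as an isometry. -/
noncomputable def algFibersₗᵢ : Fock ⊗[ℂ] F →ₗᵢ[ℂ] lp (fun _ : ℕ => F) 2 :=
  algFibers.isometryOfInner inner_algFibers

variable [CompleteSpace F]

/-- The sequence of the vectors `(⟨n| ⊗ 1) z`. -/
noncomputable def fibers : HilbertTensor Fock F →L[ℂ] lp (fun _ : ℕ => F) 2 :=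
  algFibersₗᵢ.toContinuousLinearMap.extend UniformSpace.Completion.toComplL

theorem fibers_coe (u : Fock ⊗[ℂ] F) : fibers (u : HilbertTensor Fock F) = algFibers u :=
  ContinuousLinearMap.extend_eq (e := UniformSpace.Completion.toComplL) _
    UniformSpace.Completion.denseRange_coe
    (UniformSpace.Completion.isUniformInducing_coe _) u

theorem norm_fibers (z : HilbertTensor Fock F) : ‖fibers z‖ = ‖z‖ := by
  induction z using UniformSpace.Completion.induction_on with
  | hp => exact isClosed_eq (by fun_prop) (by fun_prop)
  | ih u =>
    rw [fibers_coe, UniformSpace.Completion.norm_coe]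
    exact algFibersₗᵢ.norm_map u

theorem inner_fibers (z w : HilbertTensor Fock F) :
    inner ℂ (fibers z) (fibers w) = inner ℂ z w :=
  LinearIsometry.inner_map_map ⟨fibers.toLinearMap, norm_fibers⟩ z w

/-- The partial inner product `⟨n| ⊗ 1`. -/
noncomputable def fiber (n : ℕ) : HilbertTensor Fock F →L[ℂ] F :=
  (lp.evalCLM ℂ (fun _ : ℕ => F) 2 n).comp fibers

theorem fiber_prodVec (n : ℕ) (x : Fock) (y : F) : fiber n (prodVec x y) = x n • y := by
  change fibers ((x ⊗ₜ[ℂ] y : Fock ⊗[ℂ] F) : HilbertTensor Fock F) n = _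
  rw [fibers_coe, algFibers_tmul]

theorem fiber_ext {z w : HilbertTensor Fock F} (h : ∀ n, fiber n z = fiber n w) : z = w := by
  rw [← sub_eq_zero, ← norm_eq_zero, ← norm_fibers, norm_eq_zero, map_sub, sub_eq_zero]
  exact lp.ext (funext h)

theorem hasSum_norm_fiber (z : HilbertTensor Fock F) :
    HasSum (fun n => ‖fiber n z‖ ^ 2) (‖z‖ ^ 2) := by
  rw [← norm_fibers]
  have := lp.hasSum_norm (p := 2) (by norm_num) (fibers z)
  simp only [ENNReal.toReal_ofNat, Real.rpow_ofNat] at this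
  exact this

theorem hasSum_inner_fiber (z w : HilbertTensor Fock F) :
    HasSum (fun n => inner ℂ (fiber n z) (fiber n w)) (inner ℂ z w) := by
  rw [← inner_fibers]
  exact lp.hasSum_inner _ _

/-- Fiberwise the total Hamiltonian acts as `εn + K`. This is immediate on the generators `x ⊗ y`,
and the condition is linear and closed because the graph of `K` is closed, so it passes to the
closed span. -/
theorem fiber_mem_graph {ε : ℝ} {K : F →ₗ.[ℂ] F} (hK : IsSelfAdjoint K)
    {z w : HilbertTensor Fock F} (h : (z, w) ∈ totalHamGraph (oscillatorHam ε) K) (n : ℕ) :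
    (fiber n z, fiber n w - ((ε * n : ℝ) : ℂ) • fiber n z) ∈ K.graph := by
  set M : HilbertTensor Fock F × HilbertTensor Fock F →L[ℂ] F × F :=
    ((fiber n).comp (ContinuousLinearMap.fst ℂ _ _)).prod
      ((fiber n).comp (ContinuousLinearMap.snd ℂ _ _) -
        ((ε * n : ℝ) : ℂ) • (fiber n).comp (ContinuousLinearMap.fst ℂ _ _)) with hM
  have hcl : IsClosed ((K.graph.comap M.toLinearMap : Submodule ℂ _) : Set
      (HilbertTensor Fock F × HilbertTensor Fock F)) := hK.isClosed.preimage M.continuous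
  have hle : totalHamGraph (oscillatorHam ε) K ≤ K.graph.comap M.toLinearMap := by
    refine Submodule.topologicalClosure_minimal _ (Submodule.span_le.2 ?_) hcl
    rintro _ ⟨x, y, rfl⟩
    change (fiber n (prodVec (x : Fock) (y : F)), fiber n (prodVec (oscillatorHam ε x) (y : F) +
      prodVec (x : Fock) (K y)) - ((ε * n : ℝ) : ℂ) • fiber n (prodVec (x : Fock) (y : F))) ∈ K.graph
    have hx := mem_oscillatorHam_graph.1 (LinearPMap.mem_graph (oscillatorHam ε) x) n
    have hy := K.graph.smul_mem ((x : Fock) n) (LinearPMap.mem_graph K y)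
    rw [map_add, fiber_prodVec, fiber_prodVec, fiber_prodVec, hx, mul_smul, add_sub_cancel_left]
    exact hy
  exact hle h

theorem fiber_eigen {ε : ℝ} {K : F →ₗ.[ℂ] F} (hK : IsSelfAdjoint K)
    {z : HilbertTensor Fock F} {e : ℝ}
    (h : (z, (e : ℂ) • z) ∈ totalHamGraph (oscillatorHam ε) K) (n : ℕ) :
    (fiber n z, ((e - ε * n : ℝ) : ℂ) • fiber n z) ∈ K.graph := by
  have := fiber_mem_graph hK h n
  rwa [map_smul, ← sub_smul, ← Complex.ofReal_sub] at this

/-- The inner product is a sum over fibers, and in each fiber symmetry is that of `K`, the real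
terms `εn` cancelling. -/
theorem isClosedSymmetric_totalHamGraph {ε : ℝ} {K : F →ₗ.[ℂ] F} (hK : IsSelfAdjoint K) :
    IsClosedSymmetric (totalHamGraph (oscillatorHam ε) K) where
  isClosed := Submodule.isClosed_topologicalClosure _
  symm := by
    intro z w z' w' h h'
    refine (hasSum_inner_fiber w z').unique ((hasSum_inner_fiber z w').congr_fun fun n => ?_)
    have h1 := (isClosedSymmetric_of_isSelfAdjoint hK).symm (fiber_mem_graph hK h n)
      (fiber_mem_graph hK h' n)
    rw [inner_sub_left, inner_sub_right, inner_smul_left, inner_smul_right,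
      Complex.conj_ofReal] at h1
    linear_combination h1

end Fibers

/-! ### The structure of coherent work processes -/

/-- The eigenspace is closed because the graph is, hence has an orthogonal projection, which kills
the other eigenvectors by symmetry. Only eigenvectors occur below, so these projections stand in for
spectral projections of the weight. -/
theorem IsClosedSymmetric.exists_projection {G : Type*} [NormedAddCommGroup G]
    [InnerProductSpace ℂ G] [CompleteSpace G] {Γ : Submodule ℂ (G × G)} (h : IsClosedSymmetric Γ)
    (e : ℝ) : ∃ P : G →L[ℂ] G, (∀ x, (P x, (e : ℂ) • P x) ∈ Γ) ∧
      (∀ x, (x, (e : ℂ) • x) ∈ Γ → P x = x) ∧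
      ∀ (x : G) (e' : ℝ), e' ≠ e → (x, (e' : ℂ) • x) ∈ Γ → P x = 0 := by
  set M : G →L[ℂ] G × G := (ContinuousLinearMap.id ℂ G).prod
    ((e : ℂ) • ContinuousLinearMap.id ℂ G) with hM
  set V : Submodule ℂ G := Γ.comap M.toLinearMap with hV
  have hmem : ∀ x, x ∈ V ↔ (x, (e : ℂ) • x) ∈ Γ := fun x => Iff.rfl
  have hcl : IsClosed (V : Set G) := h.isClosed.preimage M.continuous
  have : CompleteSpace V := hcl.completeSpace_coe
  refine ⟨V.starProjection, fun x => ?_, fun x hx => ?_, fun x e' he hx => ?_⟩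
  · exact (hmem _).1 (Submodule.starProjection_apply_mem V x)
  · exact Submodule.starProjection_eq_self_iff.2 ((hmem x).2 hx)
  · refine (Submodule.starProjection_apply_eq_zero_iff V).2 ((Submodule.mem_orthogonal _ _).2 ?_)
    exact fun y hy => h.orthogonal ((hmem y).1 hy) hx he.symm

theorem hasSum_norm_sq_of_orthogonal {G : Type*} [NormedAddCommGroup G] [InnerProductSpace ℂ G]
    {w : ℕ → G} {x : G} (h : HasSum w x) (ho : ∀ i j, i ≠ j → inner ℂ (w i) (w j) = 0) :
    HasSum (fun j => ‖w j‖ ^ 2) (‖x‖ ^ 2) := by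
  have h1 : ∀ j, inner ℂ (w j) x = ((‖w j‖ ^ 2 : ℝ) : ℂ) := fun j => by
    have h2 : HasSum (fun i => inner ℂ (w j) (w i)) (inner ℂ (w j) x) :=
      h.mapL (innerSL ℂ (w j))
    have h3 := hasSum_single (f := fun i => inner ℂ (w j) (w i)) j fun i hi => ho j i hi.symm
    rw [h2.unique h3, inner_self_eq_norm_sq_to_K]
    push_cast
    rfl
  have h4 : HasSum (fun j => inner ℂ x (w j)) (inner ℂ x x) := h.mapL (innerSL ℂ x)
  have h5 : ∀ j, inner ℂ x (w j) = ((‖w j‖ ^ 2 : ℝ) : ℂ) := fun j => by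
    rw [← inner_conj_symm, h1, Complex.conj_ofReal]
  have h6 : inner ℂ x x = ((‖x‖ ^ 2 : ℝ) : ℂ) := by
    rw [inner_self_eq_norm_sq_to_K]
    push_cast
    rfl
  simp only [h5, h6] at h4
  exact Complex.hasSum_ofReal.1 h4

section

variable {F : Type*} [NormedAddCommGroup F] [InnerProductSpace ℂ F] [CompleteSpace F]

theorem Weight.isClosedSymmetric (A : Weight F) : IsClosedSymmetric A.ham.graph :=
  isClosedSymmetric_of_isSelfAdjoint A.selfAdjoint

/-- Let `v q` be the image of the component of `ψ ⊗ |0⟩` at level `k + q`. Its fiber along `|j⟩` is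
an eigenvector of the weight with energy `E₀ + (k + q - j) ε`. The `v q` sum to `φ ⊗ η`, whose fiber
along `|j⟩` is `φ j • η`, so projecting onto that energy isolates a single `q` and gives `fiber j (v
q) = φ j • W (k + q - j)`, where `W z` is the component of `η` at energy `E₀ + z ε`. Norms then give
the convolution. As `φ k' ≠ 0`, the fiber along `|k'⟩` shows all of `η`: it is the sum of its
components `W z`, and none lies below `z = k - k'`. -/
theorem CoherentWorkProcess.exists_components {ε : ℝ} (hε : ε ≠ 0) {A : Weight F} {ψ φ : Fock}
    {η : F} (h : CoherentWorkProcess (oscillatorHam ε) A ψ φ η) {k k' : ℕ}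
    (hψ : ∀ n < k, ψ n = 0) (hk' : φ k' ≠ 0) (hφ : ∀ n < k', φ n = 0) :
    ∃ w : ℕ → F,
      (∀ j : ℕ, (w j, ((A.energy + ((((k : ℤ) - k' : ℤ) : ℝ) + j) * ε : ℝ) : ℂ) • w j) ∈
        A.ham.graph) ∧
      HasSum w η ∧
      ∀ q, ‖ψ (k + q)‖ ^ 2 = ∑ p ∈ Finset.HasAntidiagonal.antidiagonal q,
        ‖φ (k' + p.1)‖ ^ 2 * ‖w p.2‖ ^ 2 := by
  obtain ⟨U, hUΓ, hU⟩ := h.exists_unitary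
  set v : ℕ → HilbertTensor Fock F :=
    fun q => U (ψ (k + q) • prodVec (number (k + q)) A.init) with hv
  have hvΓ : ∀ q, (v q, ((ε * (k + q : ℕ) + A.energy : ℝ) : ℂ) • v q) ∈
      totalHamGraph (oscillatorHam ε) A.ham := fun q => by
    have h1 := (totalHamGraph (oscillatorHam ε) A.ham).smul_mem (ψ (k + q))
      (prodVec_eigen (number_mem_graph ε (k + q)) A.init_eigen)
    rw [Prod.smul_mk, smul_comm] at h1
    have h2 := (hUΓ _ _).1 h1
    rwa [map_smul U ((ε * (k + q : ℕ) + A.energy : ℝ) : ℂ)] at h2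
  have hvnorm : ∀ q, ‖v q‖ = ‖ψ (k + q)‖ := fun q => by
    rw [hv]
    dsimp only
    rw [U.norm_map, norm_smul, norm_prodVec, norm_number, A.norm_init, mul_one, mul_one]
  have hvsum : HasSum v (prodVec φ η) := by
    rw [← hU]
    have h1 : HasSum (fun n => ψ n • prodVec (number n) A.init) (prodVec ψ A.init) := by
      refine ((hasSum_number ψ).mapL (prodVecL.flip A.init)).congr_fun fun n => ?_
      rw [map_smul]
      rfl
    exact ((hasSum_add_iff_of_lt fun n hn => by rw [hψ n hn, zero_smul]).2 h1).mapL
      U.toContinuousLinearEquiv.toContinuousLinearMap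
  choose P hP1 hP2 hP3 using A.isClosedSymmetric.exists_projection
  set W : ℤ → F := fun z => P (A.energy + (z : ℝ) * ε) η with hW
  have hfe : ∀ j q, (fiber j (v q), ((A.energy + (((k + q : ℕ) : ℤ) - (j : ℤ) : ℤ) * ε : ℝ) : ℂ) •
      fiber j (v q)) ∈ A.ham.graph := fun j q => by
    have := fiber_eigen A.selfAdjoint (hvΓ q) j
    convert this using 4
    push_cast
    ring
  have hfs : ∀ j (e : ℝ), HasSum (fun q => P e (fiber j (v q))) (φ j • P e η) := fun j e => by
    have := (hvsum.mapL (fiber j)).mapL (P e)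
    rwa [fiber_prodVec, map_smul] at this
  have hinj : ∀ {z z' : ℤ}, z ≠ z' → A.energy + (z : ℝ) * ε ≠ A.energy + (z' : ℝ) * ε := by
    intro z z' hz hh
    exact hz (by exact_mod_cast mul_right_cancel₀ hε (add_left_cancel hh))
  have hWeq : ∀ j q, φ j • W (((k + q : ℕ) : ℤ) - j) = fiber j (v q) := fun j q => by
    refine (hfs j _).unique ?_
    have := hasSum_single
      (f := fun q' => P (A.energy + (((k + q : ℕ) : ℤ) - (j : ℤ) : ℤ) * ε) (fiber j (v q'))) q
      fun q' hq' => hP3 _ _ _ (hinj (by push_cast; omega)) (hfe j q')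
    rwa [hP2 _ _ (hfe j q)] at this
  have hWlt : ∀ z : ℤ, z < (k : ℤ) - k' → W z = 0 := fun z hz => by
    have h1 := (hfs k' (A.energy + (z : ℝ) * ε)).unique (hasSum_zero.congr_fun fun q =>
      hP3 _ _ _ (hinj (by push_cast; omega)) (hfe k' q))
    exact (smul_eq_zero.1 h1).resolve_left hk'
  refine ⟨fun j => W ((k : ℤ) - k' + j), fun j => ?_, ?_, fun q => ?_⟩
  · have := hP1 (A.energy + (((k : ℤ) - k' + j : ℤ) : ℝ) * ε) η
    convert this using 5
    push_cast
    ring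
  · have h1 := (hvsum.mapL (fiber k')).const_smul (φ k')⁻¹
    rw [fiber_prodVec, inv_smul_smul₀ hk'] at h1
    refine h1.congr_fun fun q => ?_
    rw [← hWeq, inv_smul_smul₀ hk']
    congr 1
    push_cast
    ring
  -- Pythagoras over the fibers of `v q`. Levels below `k'` vanish with `φ`, levels above `k' + q`
  -- vanish with `W`, and an antidiagonal sum remains.
  · have h1 := hasSum_norm_fiber (v q)
    rw [← hasSum_add_iff_of_lt (k := k') fun n hn => by
      rw [← hWeq, hφ n hn, zero_smul, norm_zero, sq, zero_mul]] at h1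
    have h2 := hasSum_sum_of_ne_finset_zero (f := fun n => ‖fiber (k' + n) (v q)‖ ^ 2)
      (s := Finset.range (q + 1)) (L := SummationFilter.unconditional ℕ) (fun n hn => by
        have hn' : q < n := by simpa using hn
        rw [← hWeq, hWlt _ (by push_cast; omega), smul_zero, norm_zero, sq, zero_mul])
    rw [← hvnorm, h1.unique h2, Finset.Nat.sum_antidiagonal_eq_sum_range_succ
      (fun i j => ‖φ (k' + i)‖ ^ 2 * ‖W ((k : ℤ) - k' + j)‖ ^ 2)]
    refine Finset.sum_congr rfl fun i hi => ?_
    have hi' := Finset.mem_range.1 hi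
    rw [← hWeq, norm_smul, mul_pow]
    congr 4
    push_cast [show i ≤ q by omega]
    ring

theorem HasCanonicalForm.orthogonal {A : Weight F} {ε : ℝ} (hε : ε ≠ 0) {n : ℤ} {w : ℕ → F}
    (hw : ∀ j : ℕ, (w j, ((A.energy + ((n : ℝ) + j) * ε : ℝ) : ℂ) • w j) ∈ A.ham.graph)
    (i j : ℕ) (hij : i ≠ j) : inner ℂ (w i) (w j) = 0 :=
  A.isClosedSymmetric.orthogonal (hw i) (hw j) fun h => hij (by
    have := add_left_cancel (mul_right_cancel₀ hε (add_left_cancel h))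
    exact_mod_cast this)

/-- A process that starts with a shifted Poisson distribution ends with one, and its work output is
canonical. -/
theorem CoherentWorkProcess.exists_poisson {ε : ℝ} (hε : ε ≠ 0) {A : Weight F} {ψ φ : Fock}
    {η : F} (h : CoherentWorkProcess (oscillatorHam ε) A ψ φ η) {r : ℝ} (hr : 0 ≤ r) {k k' : ℕ}
    (hψ : HasShiftedPoisson r k ψ) (hk' : φ k' ≠ 0) (hφ : ∀ n < k', φ n = 0) :
    ∃ r' : ℝ, 0 ≤ r' ∧ r' ≤ r ∧ HasShiftedPoisson r' k' φ ∧
      HasCanonicalForm A ε (√(r ^ 2 - r' ^ 2)) ((k : ℤ) - k') η := by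
  obtain ⟨w, hw1, hw2, hw3⟩ := h.exists_components hε hψ.1 hk' hφ
  have hA1 : HasSum (fun i => ‖φ (k' + i)‖ ^ 2) 1 := by
    have := hasSum_norm_sq φ
    rw [h.norm_final, one_pow] at this
    exact (hasSum_add_iff_of_lt (f := fun n => ‖φ n‖ ^ 2)
      fun n hn => by simp [hφ n hn]).2 this
  have hB1 : HasSum (fun j => ‖w j‖ ^ 2) 1 := by
    have := hasSum_norm_sq_of_orthogonal hw2 (HasCanonicalForm.orthogonal hε hw1)
    rwa [h.norm_output, one_pow] at this
  obtain ⟨μ, ν, hμ, hν, hμν, hA, hB⟩ := raikov (l := r ^ 2) (by positivity)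
    (fun i => by positivity) (fun i => by positivity) (fun q => by rw [← hw3, hψ.2]) hA1 hB1
  have hr' : √μ ^ 2 = μ := Real.sq_sqrt hμ
  refine ⟨√μ, Real.sqrt_nonneg _, ?_, ⟨hφ, fun n => by rw [hr', hA]⟩, w, hw1, fun j => ?_, hw2⟩
  · rw [Real.sqrt_le_left hr]
    linarith
  · refine (sq_eq_sq₀ (norm_nonneg _) (by positivity)).1 ?_
    rw [sq_coherent_weight, hB, hr', Real.sq_sqrt (by linarith)]
    congr 1
    linarith

theorem HasShiftedPoisson.apply_ne_zero {r : ℝ} {k : ℕ} {ψ : Fock} (h : HasShiftedPoisson r k ψ) :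
    ψ k ≠ 0 := fun h0 => by
  have := h.2 0
  rw [add_zero, h0] at this
  simp [poisson] at this
  exact Real.exp_ne_zero _ this.symm

/-- The weight `e^{-r²}` of the lowest occupied level already determines `r`. -/
theorem HasShiftedPoisson.eq {r r' : ℝ} (hr : 0 ≤ r) (hr' : 0 ≤ r') {k : ℕ} {ψ : Fock}
    (h : HasShiftedPoisson r k ψ) (h' : HasShiftedPoisson r' k ψ) : r = r' := by
  have := (h.2 0).symm.trans (h'.2 0)
  simp only [poisson, pow_zero, Nat.factorial_zero, Nat.cast_one, mul_one, div_one] at this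
  have := neg_injective (Real.exp_injective this)
  exact (sq_eq_sq₀ hr hr').1 this

/-- The output of a process between shifted Poisson distributions. -/
theorem CoherentWorkProcess.canonical {ε : ℝ} (hε : ε ≠ 0) {A : Weight F} {ψ φ : Fock} {η : F}
    (h : CoherentWorkProcess (oscillatorHam ε) A ψ φ η) {r r' : ℝ} (hr : 0 ≤ r) (hr' : 0 ≤ r')
    {k k' : ℕ} (hψ : HasShiftedPoisson r k ψ) (hφ : HasShiftedPoisson r' k' φ) :
    r' ≤ r ∧ HasCanonicalForm A ε (√(r ^ 2 - r' ^ 2)) ((k : ℤ) - k') η := by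
  obtain ⟨ρ, hρ, hρr, hρφ, hc⟩ := h.exists_poisson hε hr hψ hφ.apply_ne_zero hφ.1
  obtain rfl := hρφ.eq hρ hr' hφ
  exact ⟨hρr, hc⟩

end

/-! ### The class of shifted Poisson distributions -/

theorem exp_apply_of_eigen {E : Type*} [NormedAddCommGroup E] [NormedSpace ℂ E] [CompleteSpace E]
    {T : E →L[ℂ] E} {x : E} {μ : ℂ} (h : T x = μ • x) :
    NormedSpace.exp T x = Complex.exp μ • x := by
  have h1 : HasSum (fun n : ℕ => (((Nat.factorial n : ℂ)⁻¹) • T ^ n) x) (NormedSpace.exp T x) :=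
    (NormedSpace.exp_series_hasSum_exp' (𝕂 := ℂ) T).mapL (ContinuousLinearMap.apply ℂ E x)
  have h2 := (NormedSpace.exp_series_hasSum_exp' (𝕂 := ℂ) μ).smul_const x
  rw [← Complex.exp_eq_exp_ℂ] at h2
  refine h1.unique (h2.congr_fun fun n => ?_)
  have h3 : ∀ n : ℕ, (T ^ n) x = μ ^ n • x := fun n => by
    induction n with
    | zero => simp
    | succ n ih =>
      rw [pow_succ', mul_apply_eq_comp, ih, map_smul, h, smul_smul, pow_succ]
  rw [smul_apply, h3, smul_smul, smul_eq_mul]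

theorem hasSum_diagonal_apply {T : Fock →L[ℂ] Fock} {c : ℕ → ℂ}
    (h : ∀ n, T (number n) = c n • number n) (ψ : Fock) (n : ℕ) : T ψ n = c n * ψ n := by
  have h1 := hasSum_apply ((hasSum_number ψ).mapL T) n
  have h2 := hasSum_single (f := fun j => T (ψ j • number j) n) n fun j hj => by
    rw [map_smul, h, lp.coeFn_smul, lp.coeFn_smul, Pi.smul_apply, Pi.smul_apply, number_apply,
      if_neg hj.symm, smul_zero, smul_zero]
  rw [h1.unique h2, map_smul, h, lp.coeFn_smul, lp.coeFn_smul, Pi.smul_apply, Pi.smul_apply,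
    number_apply, if_pos rfl, smul_eq_mul, smul_eq_mul]
  ring

theorem memℓp_bounded_mul {d : ℕ → ℝ} {C : ℝ} (hd : ∀ n, |d n| ≤ C) (ψ : Fock) :
    Memℓp (fun n => (d n : ℂ) * ψ n) 2 := by
  refine memℓp_gen (Summable.of_nonneg_of_le (fun n => by positivity) (fun n => ?_)
    (((memℓp_gen_iff (by norm_num)).1 (lp.memℓp ψ)).mul_left (C ^ (2 : ENNReal).toReal)))
  rw [norm_mul, Real.mul_rpow (norm_nonneg _) (norm_nonneg _), Complex.norm_real, Real.norm_eq_abs]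
  gcongr
  exact hd n

/-- The bounded diagonal operator with real eigenvalues `d n`. -/
noncomputable def boundedDiagonal (d : ℕ → ℝ) (C : ℝ) (hd : ∀ n, |d n| ≤ C) : Fock →L[ℂ] Fock :=
  LinearMap.mkContinuous
    { toFun := fun ψ => ⟨fun n => (d n : ℂ) * ψ n, memℓp_bounded_mul hd ψ⟩
      map_add' := fun a b => by ext n; exact mul_add _ _ _
      map_smul' := fun r a => by ext n; exact mul_left_comm _ _ _ } C fun ψ => by
    have hC : 0 ≤ C := (abs_nonneg _).trans (hd 0)
    refine (lp.norm_mono (y := (C : ℂ) • ψ) (by norm_num) fun n => ?_).trans (le_of_eq ?_)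
    · change ‖(d n : ℂ) * ψ n‖ ≤ ‖(C : ℂ) * ψ n‖
      rw [norm_mul, norm_mul, Complex.norm_real, Complex.norm_real, Real.norm_eq_abs,
        Real.norm_of_nonneg hC]
      exact mul_le_mul_of_nonneg_right (hd n) (norm_nonneg _)
    · rw [norm_smul, Complex.norm_real, Real.norm_of_nonneg hC]

theorem boundedDiagonal_apply (d : ℕ → ℝ) (C : ℝ) (hd : ∀ n, |d n| ≤ C) (ψ : Fock) (n : ℕ) :
    boundedDiagonal d C hd ψ n = (d n : ℂ) * ψ n := rfl

theorem isSelfAdjoint_boundedDiagonal (d : ℕ → ℝ) (C : ℝ) (hd : ∀ n, |d n| ≤ C) :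
    IsSelfAdjoint (boundedDiagonal d C hd) := by
  rw [ContinuousLinearMap.isSelfAdjoint_iff_isSymmetric]
  intro x y
  refine (lp.hasSum_inner _ _).unique ((lp.hasSum_inner _ _).congr_fun fun n => ?_)
  change inner ℂ ((d n : ℂ) * x n) (y n) = inner ℂ (x n) ((d n : ℂ) * y n)
  simp
  ring

/-- `L` maps the eigenspace of `εn` into itself, and this space is one-dimensional because `ε ≠ 0`.
Hermiticity makes the eigenvalue real. -/
theorem exists_eigenvalue_of_commute {ε : ℝ} (hε : ε ≠ 0) {L : Fock →L[ℂ] Fock}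
    (hcomm : ∀ x y, (x, y) ∈ (oscillatorHam ε).graph → (L x, L y) ∈ (oscillatorHam ε).graph)
    (hL : IsSelfAdjoint L) (n : ℕ) : ∃ l : ℝ, L (number n) = (l : ℂ) • number n := by
  have h1 := hcomm _ _ (number_mem_graph ε n)
  rw [map_smul, mem_oscillatorHam_graph] at h1
  have h2 : L (number n) = (L (number n) n) • number n := by
    ext j
    rw [lp.coeFn_smul, Pi.smul_apply, number_apply]
    split_ifs with hj
    · rw [hj, smul_eq_mul, mul_one]
    · rw [smul_zero]
      have h3 := h1 j
      rw [lp.coeFn_smul, Pi.smul_apply, smul_eq_mul] at h3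
      have h4 : ((ε * n - ε * j : ℝ) : ℂ) * L (number n) j = 0 := by
        push_cast at h3 ⊢
        linear_combination h3
      refine (mul_eq_zero.1 h4).resolve_left ?_
      rw [Complex.ofReal_eq_zero, ← mul_sub]
      exact mul_ne_zero hε (sub_ne_zero.2 (by exact_mod_cast Ne.symm hj))
  have h5 : inner ℂ (L (number n)) (number n) = inner ℂ (number n) (L (number n)) :=
    hL.isSymmetric (number n) (number n)
  rw [h2, inner_smul_left, inner_smul_right, inner_self_eq_norm_sq_to_K, norm_number] at h5
  simp only [RCLike.ofReal_one, one_pow, mul_one] at h5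
  refine ⟨(L (number n) n).re, ?_⟩
  rw [Complex.conj_eq_iff_re.1 h5]
  exact h2

/-- The unitaries `e^{-iLt}` in question realise exactly the changes of phase in the number basis,
so only the moduli of the amplitudes matter. -/
theorem mem_classC_iff {ε : ℝ} (hε : ε ≠ 0) {ψ : Fock} :
    ψ ∈ classC ε ↔ ∃ (r : ℝ) (k : ℕ), 0 ≤ r ∧ HasShiftedPoisson r k ψ := by
  constructor
  · rintro ⟨α, k, t, L, hL, hcomm, rfl⟩
    refine ⟨‖α‖, k, norm_nonneg α, (hasShiftedPoisson_shiftedCoherent α k).of_norm_eq fun n => ?_⟩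
    choose l hl using exists_eigenvalue_of_commute hε hcomm hL
    have h1 : ∀ n, NormedSpace.exp ((-(Complex.I * t)) • L) (number n) =
        Complex.exp (-(Complex.I * t) * l n) • number n := fun n =>
      exp_apply_of_eigen (by rw [smul_apply, hl, smul_smul])
    rw [hasSum_diagonal_apply h1, norm_mul, Complex.norm_exp]
    simp
  · rintro ⟨r, k, hr, hψ⟩
    have hα : HasShiftedPoisson r k (shiftedCoherent r k) := by
      have := hasShiftedPoisson_shiftedCoherent (r : ℂ) k
      rwa [Complex.norm_real, Real.norm_of_nonneg hr] at this
    -- Relative phases of `ψ` and `|r, k⟩`. Arguments are bounded by `π`, so the diagonal `L` with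
    -- eigenvalues `-θ n` is bounded and `t = 1` suffices. Where the amplitudes vanish, the quotient
    -- and its argument are `0` by convention.
    set θ : ℕ → ℝ := fun n => Complex.arg (ψ n / shiftedCoherent r k n) with hθ
    have hθ1 : ∀ n, |(-θ n)| ≤ Real.pi := fun n => by
      rw [abs_neg]
      exact Complex.abs_arg_le_pi _
    have hphase : ∀ n, ψ n = Complex.exp (θ n * Complex.I) * shiftedCoherent r k n := fun n => by
      by_cases h0 : shiftedCoherent r k n = 0
      · have := hψ.norm_eq hα n
        rw [h0, norm_zero, norm_eq_zero] at this
        rw [h0, this, mul_zero]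
      · have h1 := Complex.norm_mul_exp_arg_mul_I (ψ n / shiftedCoherent r k n)
        rw [norm_div, hψ.norm_eq hα n, div_self (norm_ne_zero_iff.2 h0), Complex.ofReal_one,
          one_mul] at h1
        rw [hθ]
        dsimp only
        rw [h1, div_mul_cancel₀ _ h0]
    refine ⟨r, k, 1, boundedDiagonal (fun n => -θ n) Real.pi hθ1,
      isSelfAdjoint_boundedDiagonal _ _ _, fun x y hxy => ?_, ?_⟩
    · rw [mem_oscillatorHam_graph] at hxy ⊢
      intro n
      rw [boundedDiagonal_apply, boundedDiagonal_apply, hxy n]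
      ring
    · ext n
      have h1 : ∀ n, NormedSpace.exp ((-(Complex.I * (1 : ℝ))) •
          boundedDiagonal (fun n => -θ n) Real.pi hθ1) (number n) =
          Complex.exp (θ n * Complex.I) • number n := fun n => by
        refine exp_apply_of_eigen ?_
        ext j
        rw [smul_apply, lp.coeFn_smul, Pi.smul_apply, boundedDiagonal_apply,
          lp.coeFn_smul, Pi.smul_apply, number_apply]
        split_ifs with hj
        · rw [hj]
          simp
          ring
        · simp
      rw [hasSum_diagonal_apply h1]
      exact hphase n

/-! ### Existence of processes -/

theorem sum_poisson_mul_poisson (μ ν : ℝ) (q : ℕ) :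
    ∑ p ∈ Finset.HasAntidiagonal.antidiagonal q, poisson μ p.1 * poisson ν p.2 =
      poisson (μ + ν) q := by
  have hq : (Nat.factorial q : ℝ) ≠ 0 := by exact_mod_cast Nat.factorial_ne_zero q
  rw [poisson, (Commute.all μ ν).add_pow', Finset.mul_sum, Finset.sum_div]
  refine Finset.sum_congr rfl fun p hp => ?_
  have h1 : Nat.choose q p.1 * Nat.factorial p.1 * Nat.factorial p.2 = Nat.factorial q := by
    rw [← Finset.HasAntidiagonal.mem_antidiagonal.1 hp, Nat.choose_symm_add]
    exact Nat.add_choose_mul_factorial_mul_factorial _ _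
  have h2 : (Nat.choose q p.1 : ℝ) * Nat.factorial p.1 * Nat.factorial p.2 = Nat.factorial q := by
    exact_mod_cast h1
  have hp1 : (Nat.factorial p.1 : ℝ) ≠ 0 := by exact_mod_cast Nat.factorial_ne_zero _
  have hp2 : (Nat.factorial p.2 : ℝ) ≠ 0 := by exact_mod_cast Nat.factorial_ne_zero _
  rw [poisson, poisson, nsmul_eq_mul, ← h2, neg_add, Real.exp_add]
  have hc : (Nat.choose q p.1 : ℝ) ≠ 0 := fun h0 => hq (by rw [← h2, h0, zero_mul, zero_mul])
  field_simp

section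

variable {F : Type*} [NormedAddCommGroup F] [InnerProductSpace ℂ F] [CompleteSpace F]

theorem HasCanonicalForm.norm {A : Weight F} {ε : ℝ} (hε : ε ≠ 0) {l : ℝ} {n : ℤ} {η : F}
    (h : HasCanonicalForm A ε l n η) : ‖η‖ = 1 := by
  obtain ⟨w, hw1, hw2, hw3⟩ := h
  have h1 := hasSum_norm_sq_of_orthogonal hw3 (HasCanonicalForm.orthogonal hε hw1)
  simp only [hw2, sq_coherent_weight] at h1
  have := h1.unique (hasSum_poisson _)
  nlinarith [norm_nonneg η]

/-- For `l = 0` the convention `0 ^ 0 = 1` leaves the single component `w 0`. -/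
theorem hasCanonicalForm_init (A : Weight F) (ε : ℝ) : HasCanonicalForm A ε 0 0 A.init := by
  refine ⟨fun j => if j = 0 then A.init else 0, fun j => ?_, fun j => ?_, ?_⟩
  · dsimp only
    split_ifs with hj
    · have := A.init_eigen
      rw [hj]
      simpa using this
    · rw [smul_zero]
      exact A.ham.graph.zero_mem
  · rcases j with _ | j
    · simp [A.norm_init]
    · simp
  · have := hasSum_single (f := fun j : ℕ => if j = 0 then A.init else 0) 0
      fun j hj => if_neg hj
    simpa using this

/-- Existence of a process reduces to prescribing the image `y q` of each energy component of the
input, with the right energy and norm. The sum of the `y q` converges because it is the unitary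
image of a convergent sum, so its value need only be checked fiber by fiber. -/
theorem coherentWorkProcess_of_eigen {ε : ℝ} (hε : ε ≠ 0) {A : Weight F} {ψ φ : Fock} {η : F}
    (hψn : ‖ψ‖ = 1) (hφn : ‖φ‖ = 1) (hηn : ‖η‖ = 1) {k : ℕ} (hψ : ∀ n < k, ψ n = 0)
    (y : ℕ → HilbertTensor Fock F)
    (hy : ∀ q, (y q, ((ε * (k + q : ℕ) + A.energy : ℝ) : ℂ) • y q) ∈
      totalHamGraph (oscillatorHam ε) A.ham)
    (hyn : ∀ q, ‖ψ (k + q)‖ = ‖y q‖)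
    (hys : ∀ m, HasSum (fun q => fiber m (y q)) (φ m • η)) :
    CoherentWorkProcess (oscillatorHam ε) A ψ φ η := by
  obtain ⟨U, hU1, hU2⟩ := (isClosedSymmetric_totalHamGraph (ε := ε) A.selfAdjoint).exists_unitary
    (fun q : ℕ => ψ (k + q) • prodVec (number (k + q)) A.init) y
    (fun q => ε * (k + q : ℕ) + A.energy)
    (fun i j hij => by
      have := mul_left_cancel₀ hε (add_right_cancel hij)
      have h2 : k + i = k + j := by exact_mod_cast this
      omega)
    (fun q => by
      have h1 := (totalHamGraph (oscillatorHam ε) A.ham).smul_mem (ψ (k + q))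
        (prodVec_eigen (number_mem_graph ε (k + q)) A.init_eigen)
      rwa [Prod.smul_mk, smul_comm] at h1)
    hy (fun q => by rw [norm_smul, norm_prodVec, norm_number, A.norm_init, mul_one, mul_one, hyn])
  refine ⟨hψn, hφn, hηn, U, hU1, ?_⟩
  have h1 : HasSum (fun n => ψ n • prodVec (number n) A.init) (prodVec ψ A.init) := by
    refine ((hasSum_number ψ).mapL (prodVecL.flip A.init)).congr_fun fun n => ?_
    rw [map_smul]
    rfl
  have h2 : HasSum y (U (prodVec ψ A.init)) :=
    (((hasSum_add_iff_of_lt fun n hn => by rw [hψ n hn, zero_smul]).2 h1).mapL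
      U.toContinuousLinearEquiv.toContinuousLinearMap).congr_fun fun q => (hU2 q).symm
  refine fiber_ext fun m => ?_
  rw [fiber_prodVec]
  exact (h2.mapL (fiber m)).unique (hys m)

/-- The energy components of `φ ⊗ η` are the antidiagonal sums `y q`. Their terms lie in different
fibers, so the squared norm of `y q` is a convolution of Poisson weights with parameters `r'²` and
`r² - r'²`, which is the weight of `ψ` at level `k + q`. -/
theorem HasCanonicalForm.process {ε : ℝ} (hε : ε ≠ 0) {A : Weight F} {ψ φ : Fock} {η : F}
    {r r' : ℝ} (hr' : 0 ≤ r') {k k' : ℕ} (hψ : HasShiftedPoisson r k ψ)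
    (hφ : HasShiftedPoisson r' k' φ) (hle : r' ≤ r) {n : ℤ} (hn : n + k' = k)
    (h : HasCanonicalForm A ε (√(r ^ 2 - r' ^ 2)) n η) :
    CoherentWorkProcess (oscillatorHam ε) A ψ φ η := by
  have hηn := h.norm hε
  obtain ⟨w, hw1, hw2, hw3⟩ := h
  set y : ℕ → HilbertTensor Fock F := fun q => ∑ p ∈ Finset.HasAntidiagonal.antidiagonal q,
    φ (k' + p.1) • prodVec (number (k' + p.1)) (w p.2) with hy
  have hfib : ∀ i q, fiber (k' + i) (y q) = if i ≤ q then φ (k' + i) • w (q - i) else 0 := by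
    intro i q
    simp only [hy, map_sum, map_smul, fiber_prodVec, number_apply, add_right_inj]
    rw [Finset.Nat.sum_antidiagonal_eq_sum_range_succ
      (fun a b => φ (k' + a) • (if i = a then (1 : ℂ) else 0) • w b)]
    split_ifs with hi
    · rw [Finset.sum_eq_single_of_mem i (by simpa using by omega)
        (fun b _ hb => by rw [if_neg hb.symm, zero_smul, smul_zero]), if_pos rfl, one_smul]
    · refine Finset.sum_eq_zero fun b hb => ?_
      have := Finset.mem_range.1 hb
      rw [if_neg (by omega), zero_smul, smul_zero]
  have hfib0 : ∀ m < k', ∀ q, fiber m (y q) = 0 := fun m hm q => by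
    simp only [hy, map_sum, map_smul, fiber_prodVec, number_apply]
    refine Finset.sum_eq_zero fun b hb => ?_
    rw [if_neg (by omega), zero_smul, smul_zero]
  refine coherentWorkProcess_of_eigen hε hψ.norm hφ.norm hηn hψ.1 y (fun q => ?_) (fun q => ?_)
    fun m => ?_
  · have h1 : (y q, ((ε * (k + q : ℕ) + A.energy : ℝ) : ℂ) • y q) =
        ∑ p ∈ Finset.HasAntidiagonal.antidiagonal q,
          φ (k' + p.1) • (prodVec (number (k' + p.1)) (w p.2),
            ((ε * (k + q : ℕ) + A.energy : ℝ) : ℂ) • prodVec (number (k' + p.1)) (w p.2)) := by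
      refine Prod.ext ?_ ?_
      · rw [Prod.fst_sum]
        rfl
      · rw [Prod.snd_sum]
        change _ • y q = _
        rw [hy]
        dsimp only
        rw [Finset.smul_sum]
        exact Finset.sum_congr rfl fun p _ => smul_comm _ _ _
    rw [h1]
    refine Submodule.sum_mem _ fun p hp => Submodule.smul_mem _ _ ?_
    have h2 := prodVec_eigen (number_mem_graph ε (k' + p.1)) (hw1 p.2)
    have h3 : ε * (k' + p.1 : ℕ) + (A.energy + ((n : ℝ) + (p.2 : ℕ)) * ε) =
        ε * (k + q : ℕ) + A.energy := by
      have hn' : (n : ℝ) + k' = k := by exact_mod_cast hn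
      rw [← Finset.HasAntidiagonal.mem_antidiagonal.1 hp]
      push_cast
      rw [← hn']
      ring
    rwa [h3] at h2
  · refine (sq_eq_sq₀ (norm_nonneg _) (norm_nonneg _)).1 ?_
    have h1 := hasSum_norm_fiber (y q)
    rw [← hasSum_add_iff_of_lt (k := k') fun n hn => by
      rw [hfib0 n hn, norm_zero, sq, zero_mul]] at h1
    have h2 := hasSum_sum_of_ne_finset_zero (f := fun i => ‖fiber (k' + i) (y q)‖ ^ 2)
      (s := Finset.range (q + 1)) (L := SummationFilter.unconditional ℕ) (fun i hi => by
        have hi' : q < i := by simpa using hi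
        rw [hfib, if_neg (by omega), norm_zero, sq, zero_mul])
    have hsub : r ^ 2 = r' ^ 2 + √(r ^ 2 - r' ^ 2) ^ 2 := by
      rw [Real.sq_sqrt (by nlinarith)]
      ring
    rw [h1.unique h2, hψ.2, hsub, ← sum_poisson_mul_poisson,
      Finset.Nat.sum_antidiagonal_eq_sum_range_succ
        (fun i j => poisson (r' ^ 2) i * poisson (√(r ^ 2 - r' ^ 2) ^ 2) j)]
    refine Finset.sum_congr rfl fun i hi => ?_
    have hi' := Finset.mem_range.1 hi
    rw [hfib, if_pos (by omega), norm_smul, mul_pow, hφ.2, hw2, sq_coherent_weight]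
  · rcases lt_or_ge m k' with hm | hm
    · rw [hφ.1 m hm, zero_smul]
      exact hasSum_zero.congr_fun fun q => hfib0 m hm q
    · obtain ⟨i, rfl⟩ := Nat.exists_eq_add_of_le hm
      rw [← hasSum_add_iff_of_lt (k := i) fun q hq => by rw [hfib, if_neg (by omega)]]
      refine (hw3.const_smul (φ (k' + i))).congr_fun fun j => ?_
      rw [hfib, if_pos (by omega), Nat.add_sub_cancel_left]

theorem reversibleWithoutWork_of_poisson {ε : ℝ} (hε : ε ≠ 0) (A : Weight F) {ψ φ : Fock}
    {r : ℝ} (hr : 0 ≤ r) {k : ℕ} (hψ : HasShiftedPoisson r k ψ) (hφ : HasShiftedPoisson r k φ) :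
    ReversibleWithoutWork (oscillatorHam ε) A ψ φ := by
  have h : HasCanonicalForm A ε (√(r ^ 2 - r ^ 2)) 0 A.init := by
    rw [sub_self, Real.sqrt_zero]
    exact hasCanonicalForm_init A ε
  exact ⟨h.process hε hr hψ hφ le_rfl (by simp), h.process hε hr hφ hψ le_rfl (by simp)⟩

/-- For `l = 0` the output is one eigenvector of energy `E₀ + n ε`. The default state has energy
`E₀`, and eigenvectors of different energies are orthogonal. -/
theorem HasCanonicalForm.eq_zero_of_init {A : Weight F} {ε : ℝ} (hε : ε ≠ 0) {n : ℤ}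
    (h : HasCanonicalForm A ε 0 n A.init) : n = 0 := by
  obtain ⟨w, hw1, hw2, hw3⟩ := h
  have h0 : w 0 = A.init := by
    refine (hasSum_single 0 fun j hj => ?_).unique hw3
    rw [← norm_eq_zero, hw2, zero_pow hj, mul_zero, zero_div]
  by_contra hn
  have h1 := A.isClosedSymmetric.orthogonal (hw1 0) A.init_eigen (by
    have : (n : ℝ) * ε ≠ 0 := mul_ne_zero (by exact_mod_cast hn) hε
    simpa using this)
  rw [h0, inner_self_eq_zero, ← norm_eq_zero, A.norm_init] at h1
  exact one_ne_zero h1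

/-- The two directions bound the displacements by each other. The output then has `λ = 0`, and its
energy fixes the translation. -/
theorem ReversibleWithoutWork.unique {ε : ℝ} (hε : ε ≠ 0) {A : Weight F} {ψ φ : Fock}
    {r r' : ℝ} (hr : 0 ≤ r) (hr' : 0 ≤ r') {k k' : ℕ} (hψ : HasShiftedPoisson r k ψ)
    (hφ : HasShiftedPoisson r' k' φ) (h : ReversibleWithoutWork (oscillatorHam ε) A ψ φ) :
    r' = r ∧ k' = k := by
  obtain ⟨h1, hc⟩ := h.1.canonical hε hr hr' hψ hφ
  obtain ⟨h2, -⟩ := h.2.canonical hε hr' hr hφ hψ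
  obtain rfl := le_antisymm h1 h2
  rw [sub_self, Real.sqrt_zero] at hc
  have := hc.eq_zero_of_init hε
  exact ⟨rfl, by omega⟩

end

/-! ### The ladder -/

theorem ladderState_add (l : ℝ) (n : ℤ) (j : ℕ) : ladderState l n (j + n) = coherentAmp l j := by
  rw [← coherentState_apply]
  exact Function.Embedding.injective (⟨fun j : ℕ => (j : ℤ) + n, fun i j h => by simpa using h⟩ :
    ℕ ↪ ℤ) |>.extend_apply _ _ j

theorem ladderState_of_lt (l : ℝ) {n z : ℤ} (h : z < n) : ladderState l n z = 0 :=
  Function.extend_apply' _ _ _ (by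
    rintro ⟨j, hj⟩
    change (j : ℤ) + n = z at hj
    omega)

theorem norm_ladderState_add {l : ℝ} (hl : 0 ≤ l) (n : ℤ) (j : ℕ) : ‖ladderState l n (j + n)‖ =
    Real.exp (-l ^ 2 / 2) * l ^ j / √(Nat.factorial j : ℝ) := by
  rw [ladderState_add, norm_coherentAmp, Complex.norm_real, Real.norm_of_nonneg hl]

/-- The ladder has simple spectrum, so each `w j` is a multiple of `|n + j⟩` and the canonical form
prescribes only moduli of coefficients. -/
theorem hasCanonicalForm_ladder_iff {ε : ℝ} (hε : ε ≠ 0) {l : ℝ} (hl : 0 ≤ l) {n : ℤ}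
    {η : Ell2 ℤ} :
    HasCanonicalForm (ladder ε) ε l n η ↔ ∀ z, ‖η z‖ = ‖ladderState l n z‖ := by
  have hinj : Function.Injective fun j : ℕ => (j : ℤ) + n := fun i j h => by simpa using h
  constructor
  · rintro ⟨w, hw1, hw2, hw3⟩ z
    have hwz : ∀ (j : ℕ) (z : ℤ), z ≠ (j : ℤ) + n → w j z = 0 := fun j z hz => by
      have h1 := mem_ladder_graph.1 (hw1 j) z
      rw [lp.coeFn_smul, Pi.smul_apply, smul_eq_mul] at h1
      have h2 : ((((n : ℝ) + j) * ε - ε * z : ℝ) : ℂ) * w j z = 0 := by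
        change ((0 + ((n : ℝ) + j) * ε : ℝ) : ℂ) * w j z = _ at h1
        push_cast at h1 ⊢
        linear_combination h1
      refine (mul_eq_zero.1 h2).resolve_left ?_
      rw [Complex.ofReal_eq_zero, mul_comm, ← mul_sub]
      refine mul_ne_zero hε (sub_ne_zero.2 fun hh => hz ?_)
      have : (n : ℤ) + j = z := by exact_mod_cast hh
      omega
    have hη := hasSum_apply hw3 z
    rcases lt_or_ge z n with hz | hz
    · rw [ladderState_of_lt l hz]
      rw [hη.unique (hasSum_zero.congr_fun fun j => hwz j z (by omega))]
    · obtain ⟨j, rfl⟩ : ∃ j : ℕ, z = j + n := ⟨(z - n).toNat, by omega⟩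
      rw [hη.unique (hasSum_single j fun i hi => hwz i _ (hinj.ne hi.symm)),
        norm_ladderState_add hl, ← hw2]
      have h1 := (hasSum_norm_sq (w j)).unique (hasSum_single ((j : ℤ) + n) fun z hz => by
        rw [hwz j z hz, norm_zero, sq, zero_mul])
      exact ((sq_eq_sq₀ (norm_nonneg _) (norm_nonneg _)).1 h1).symm
  · intro h
    refine ⟨fun j => lp.single 2 ((j : ℤ) + n) (η (j + n)), fun j => ?_, fun j => ?_, ?_⟩
    · rw [mem_ladder_graph]
      intro z
      rw [lp.coeFn_smul, Pi.smul_apply, smul_eq_mul, lp.single_apply, Pi.single_apply]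
      split_ifs with hz
      · change ((0 + ((n : ℝ) + j) * ε : ℝ) : ℂ) * _ = _
        rw [hz]
        push_cast
        ring
      · rw [mul_zero, mul_zero]
    · rw [lp.norm_single (by norm_num), h, norm_ladderState_add hl]
    · refine (hinj.hasSum_iff (f := fun z => (lp.single 2 z (η z) : Ell2 ℤ)) fun z hz => ?_).2
        (lp.hasSum_single (p := 2) (by norm_num) η)
      have hz' : z < n := not_le.1 fun hle => hz ⟨(z - n).toNat, by dsimp only; omega⟩
      have h0 : η z = 0 := by rw [← norm_eq_zero, h, ladderState_of_lt l hz', norm_zero]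
      rw [h0, lp.single_zero]

theorem norm_eq_iff_exists_phase {ι : Type*} (f g : ι → ℂ) :
    (∀ j, ‖f j‖ = ‖g j‖) ↔ ∃ θ : ι → ℝ, ∀ j, f j = Complex.exp (Complex.I * θ j) * g j := by
  constructor
  · intro h
    refine ⟨fun j => Complex.arg (f j / g j), fun j => ?_⟩
    by_cases h0 : g j = 0
    · have := h j
      rw [h0, norm_zero, norm_eq_zero] at this
      rw [h0, this, mul_zero]
    · have h1 := Complex.norm_mul_exp_arg_mul_I (f j / g j)
      rw [norm_div, h j, div_self (norm_ne_zero_iff.2 h0), Complex.ofReal_one, one_mul] at h1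
      rw [mul_comm Complex.I, h1, div_mul_cancel₀ _ h0]
  · rintro ⟨θ, hθ⟩ j
    rw [hθ, norm_mul, mul_comm Complex.I, Complex.norm_exp_ofReal_mul_I, one_mul]

/-! ### Moments of canonical forms -/

/-- Shifting the index by one with this identity reduces each moment to the preceding ones. -/
theorem succ_mul_poisson_succ (l : ℝ) (n : ℕ) :
    ((n : ℝ) + 1) * poisson l (n + 1) = l * poisson l n := by
  have h1 : (Nat.factorial n : ℝ) ≠ 0 := by exact_mod_cast Nat.factorial_ne_zero n
  have h2 : (n : ℝ) + 1 ≠ 0 := by positivity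
  rw [poisson, poisson, Nat.factorial_succ]
  push_cast
  field_simp
  ring

theorem hasSum_mul_poisson (l : ℝ) : HasSum (fun n : ℕ => n * poisson l n) l := by
  rw [← hasSum_add_iff_of_lt (k := 1) fun n hn => by simp [Nat.lt_one_iff.1 hn]]
  have := (hasSum_poisson l).mul_left l
  rw [mul_one] at this
  refine this.congr_fun fun n => ?_
  rw [← succ_mul_poisson_succ, add_comm 1 n]
  push_cast
  rfl

theorem hasSum_sq_mul_poisson (l : ℝ) : HasSum (fun n : ℕ => (n : ℝ) ^ 2 * poisson l n)
    (l * (l + 1)) := by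
  rw [← hasSum_add_iff_of_lt (k := 1) fun n hn => by simp [Nat.lt_one_iff.1 hn]]
  refine (((hasSum_mul_poisson l).add (hasSum_poisson l)).mul_left l).congr_fun fun n => ?_
  have := succ_mul_poisson_succ l n
  rw [add_comm 1 n]
  push_cast
  linear_combination ((n : ℝ) + 1) * this

theorem hasSum_variance_poisson (l : ℝ) : HasSum (fun n : ℕ => ((n : ℝ) - l) ^ 2 * poisson l n)
    l := by
  have := ((hasSum_sq_mul_poisson l).sub ((hasSum_mul_poisson l).mul_left (2 * l))).add
    ((hasSum_poisson l).mul_left (l ^ 2))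
  have h2 : l * (l + 1) - 2 * l * l + l ^ 2 * 1 = l := by ring
  rw [h2] at this
  refine this.congr_fun fun n => ?_
  ring

theorem summable_of_orthogonal {G : Type*} [NormedAddCommGroup G] [InnerProductSpace ℂ G]
    [CompleteSpace G] {x : ℕ → G} (ho : ∀ i j, i ≠ j → inner ℂ (x i) (x j) = 0)
    (hs : Summable fun j => ‖x j‖ ^ 2) : Summable x := by
  have h : OrthogonalFamily ℂ (fun i => (ℂ ∙ x i : Submodule ℂ G))
      fun i => (ℂ ∙ x i : Submodule ℂ G).subtypeₗᵢ := by
    refine OrthogonalFamily.of_pairwise fun i j hij => ?_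
    change (ℂ ∙ x i) ⟂ (ℂ ∙ x j)
    rw [Submodule.isOrtho_span]
    rintro u rfl v rfl
    exact ho i j hij
  exact (h.summable_iff_norm_sq_summable
    fun i => (⟨x i, Submodule.mem_span_singleton_self (x i)⟩ : (ℂ ∙ x i : Submodule ℂ G))).2 hs

/-- The deviation `∑ (eⱼ - μ) wⱼ` is an orthogonal sum whose squared norm is the Poisson variance
times `ε²`, so it converges. Closedness of the Hamiltonian then puts `η` in its domain, which the
canonical form does not assert. -/
theorem HasCanonicalForm.moments {F : Type*} [NormedAddCommGroup F] [InnerProductSpace ℂ F]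
    [CompleteSpace F] {A : Weight F} {ε : ℝ} (hε : 0 < ε) {l : ℝ} (hl : 0 ≤ l) {n : ℤ} {η : F}
    (h : HasCanonicalForm A ε l n η) :
    HasMoments A.ham η (A.energy + (n + l ^ 2) * ε) (ε * l) := by
  obtain ⟨w, hw1, hw2, hw3⟩ := h
  set e : ℕ → ℝ := fun j => A.energy + ((n : ℝ) + j) * ε with he
  set μ : ℝ := A.energy + (n + l ^ 2) * ε with hμ
  have ho := HasCanonicalForm.orthogonal hε.ne' hw1
  have hw2' : ∀ j, ‖w j‖ ^ 2 = poisson (l ^ 2) j := fun j => by rw [hw2, sq_coherent_weight]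
  have ho' : ∀ c : ℕ → ℂ, ∀ i j, i ≠ j → inner ℂ (c i • w i) (c j • w j) = 0 := by
    intro c i j hij
    rw [inner_smul_left, inner_smul_right, ho i j hij, mul_zero, mul_zero]
  have hvar : HasSum (fun j => ‖((e j - μ : ℝ) : ℂ) • w j‖ ^ 2) ((ε * l) ^ 2) := by
    rw [mul_pow]
    refine ((hasSum_variance_poisson (l ^ 2)).mul_left (ε ^ 2)).congr_fun fun j => ?_
    rw [norm_smul, mul_pow, hw2', Complex.norm_real, Real.norm_eq_abs, sq_abs, he, hμ]
    ring
  obtain ⟨u, hu⟩ := summable_of_orthogonal (ho' fun j => ((e j - μ : ℝ) : ℂ)) hvar.summable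
  have hun : ‖u‖ ^ 2 = (ε * l) ^ 2 :=
    (hasSum_norm_sq_of_orthogonal hu (ho' fun j => ((e j - μ : ℝ) : ℂ))).unique hvar
  have hχ : HasSum (fun j => (e j : ℂ) • w j) (u + (μ : ℂ) • η) := by
    refine (hu.add (hw3.const_smul (μ : ℂ))).congr_fun fun j => ?_
    rw [← add_smul]
    push_cast
    ring_nf
  refine ⟨u + (μ : ℂ) • η, ?_, ?_, ?_⟩
  · exact hasSum_mem_of_isClosed A.isClosedSymmetric.isClosed (hw3.prodMk hχ) hw1
  · have hη1 : HasSum (fun j => poisson (l ^ 2) j) (‖η‖ ^ 2) := by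
      have := hasSum_norm_sq_of_orthogonal hw3 ho
      simpa only [hw2'] using this
    have hη : ‖η‖ ^ 2 = 1 := hη1.unique (hasSum_poisson _)
    have hjη : ∀ j, inner ℂ η (w j) = ((poisson (l ^ 2) j : ℝ) : ℂ) := fun j => by
      have h1 : HasSum (fun i => inner ℂ (w j) (w i)) (inner ℂ (w j) η) :=
        hw3.mapL (innerSL ℂ (w j))
      rw [← inner_conj_symm, h1.unique (hasSum_single j fun i hi => ho j i hi.symm),
        inner_self_eq_norm_sq_to_K, ← hw2']
      simp
    have h2 : HasSum (fun j => inner ℂ η ((e j : ℂ) • w j)) (inner ℂ η (u + (μ : ℂ) • η)) :=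
      hχ.mapL (innerSL ℂ η)
    have h3 : HasSum (fun j => e j * poisson (l ^ 2) j) μ := by
      have := ((hasSum_poisson (l ^ 2)).mul_left (A.energy + n * ε)).add
        ((hasSum_mul_poisson (l ^ 2)).mul_left ε)
      have h4 : (A.energy + n * ε) * 1 + ε * l ^ 2 = μ := by rw [hμ]; ring
      rw [h4] at this
      refine this.congr_fun fun j => ?_
      rw [he]
      ring
    refine h2.unique ((Complex.hasSum_ofReal.2 h3).congr_fun fun j => ?_)
    rw [inner_smul_right, hjη]
    push_cast
    rfl
  · rw [add_sub_cancel_right]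
    exact (sq_eq_sq₀ (norm_nonneg _) (by positivity)).1 hun

/-- The oscillator, regarded as a weight. -/
noncomputable def oscillatorWeight (ε : ℝ) : Weight Fock where
  ham := oscillatorHam ε
  selfAdjoint := isSelfAdjoint_oscillatorHam ε
  init := number 0
  norm_init := norm_number 0
  energy := 0
  init_eigen := by simpa using number_mem_graph ε 0

/-- Makes the moments of states of `𝒞` a case of `HasCanonicalForm.moments`. -/
theorem HasShiftedPoisson.hasCanonicalForm (ε : ℝ) {r : ℝ} (hr : 0 ≤ r) {k : ℕ} {ψ : Fock}
    (h : HasShiftedPoisson r k ψ) : HasCanonicalForm (oscillatorWeight ε) ε r k ψ := by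
  refine ⟨fun j => ψ (k + j) • number (k + j), fun j => ?_, fun j => ?_, ?_⟩
  · have := (oscillatorHam ε).graph.smul_mem (ψ (k + j)) (number_mem_graph ε (k + j))
    rw [Prod.smul_mk, smul_comm] at this
    change (_, ((0 + (((k : ℤ) : ℝ) + j) * ε : ℝ) : ℂ) • _) ∈ (oscillatorHam ε).graph
    convert this using 4
    push_cast
    ring
  · rw [norm_smul, norm_number, mul_one]
    refine (sq_eq_sq₀ (norm_nonneg _) (by positivity)).1 ?_
    rw [h.2, sq_coherent_weight]
  · exact (hasSum_add_iff_of_lt (f := fun n => ψ n • number n)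
      fun n hn => by rw [h.1 n hn, zero_smul]).2 (hasSum_number ψ)

theorem HasShiftedPoisson.moments {ε : ℝ} (hε : 0 < ε) {r : ℝ} (hr : 0 ≤ r) {k : ℕ} {ψ : Fock}
    (h : HasShiftedPoisson r k ψ) :
    HasMoments (oscillatorHam ε) ψ (ε * (r ^ 2 + k)) (ε * r) := by
  have := (h.hasCanonicalForm ε hr).moments hε hr
  have h2 : (oscillatorWeight ε).energy + (((k : ℤ) : ℝ) + r ^ 2) * ε = ε * (r ^ 2 + k) := by
    change 0 + (((k : ℤ) : ℝ) + r ^ 2) * ε = _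
    push_cast
    ring
  rw [h2] at this
  exact this

/-! ### Position and momentum -/

theorem memℓp_two_of_summable {ι : Type*} {f : ι → ℂ} (h : Summable fun i => ‖f i‖ ^ 2) :
    Memℓp f 2 :=
  memℓp_gen (by simpa using h)

/-- A finite mean number puts `ψ` in the domains of `a` and `a†`. The last two conclusions express
adjointness and the commutator `[a, a†] = 1` in this state. -/
theorem exists_ladder_vectors {ψ : Fock} (hψ : ‖ψ‖ = 1)
    (hs : Summable fun n : ℕ => (n : ℝ) * ‖ψ n‖ ^ 2) :
    ∃ a c : Fock, (∀ n, a n = lower ψ n) ∧ (∀ n, c n = raise ψ n) ∧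
      inner ℂ ψ c = inner ℂ a ψ ∧ ‖c‖ ^ 2 = ‖a‖ ^ 2 + 1 := by
  have hl : ∀ n, ‖lower ψ n‖ ^ 2 = ((n + 1 : ℕ) : ℝ) * ‖ψ (n + 1)‖ ^ 2 := fun n => by
    change ‖((√((n : ℝ) + 1) : ℝ) : ℂ) * ψ (n + 1)‖ ^ 2 = _
    rw [norm_mul, mul_pow, Complex.norm_real, Real.norm_eq_abs, sq_abs,
      Real.sq_sqrt (by positivity)]
    push_cast
    rfl
  have hr : ∀ n, ‖raise ψ (n + 1)‖ ^ 2 = (n : ℝ) * ‖ψ n‖ ^ 2 + ‖ψ n‖ ^ 2 := fun n => by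
    change ‖((√((n + 1 : ℕ) : ℝ) : ℝ) : ℂ) * ψ n‖ ^ 2 = _
    rw [norm_mul, mul_pow, Complex.norm_real, Real.norm_eq_abs, sq_abs,
      Real.sq_sqrt (by positivity)]
    push_cast
    ring
  have hr0 : raise ψ 0 = 0 := by simp [raise]
  have hψs := hasSum_norm_sq ψ
  have hsum_l : Summable fun n => ‖lower ψ n‖ ^ 2 := by
    simp only [hl]
    exact (summable_nat_add_iff 1).2 hs
  have hsum_r : Summable fun n => ‖raise ψ n‖ ^ 2 := by
    refine (summable_nat_add_iff 1).1 ?_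
    simp only [hr]
    exact hs.add hψs.summable
  refine ⟨⟨lower ψ, memℓp_two_of_summable hsum_l⟩, ⟨raise ψ, memℓp_two_of_summable hsum_r⟩,
    fun n => rfl, fun n => rfl, ?_, ?_⟩
  · have h1 := lp.hasSum_inner (𝕜 := ℂ) ψ
      (⟨raise ψ, memℓp_two_of_summable hsum_r⟩ : Fock)
    have h2 := lp.hasSum_inner (𝕜 := ℂ) (⟨lower ψ, memℓp_two_of_summable hsum_l⟩ : Fock) ψ
    rw [← hasSum_add_iff_of_lt (k := 1) fun n hn => by
      rw [Nat.lt_one_iff.1 hn]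
      change inner ℂ (ψ 0) (raise ψ 0) = 0
      rw [hr0, inner_zero_right]] at h1
    refine h1.unique (h2.congr_fun fun n => ?_)
    rw [add_comm 1 n]
    change inner ℂ (ψ (n + 1)) (((√((n + 1 : ℕ) : ℝ) : ℝ) : ℂ) * ψ n) =
      inner ℂ (((√((n : ℝ) + 1) : ℝ) : ℂ) * ψ (n + 1)) (ψ n)
    simp
    ring
  · have h1 := hasSum_norm_sq (⟨raise ψ, memℓp_two_of_summable hsum_r⟩ : Fock)
    have h2 := hasSum_norm_sq (⟨lower ψ, memℓp_two_of_summable hsum_l⟩ : Fock)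
    rw [← hasSum_add_iff_of_lt (k := 1) fun n hn => by
      rw [Nat.lt_one_iff.1 hn]
      change ‖raise ψ 0‖ ^ 2 = 0
      rw [hr0, norm_zero, sq, zero_mul]] at h1
    have h3 : HasSum (fun n : ℕ => (n : ℝ) * ‖ψ n‖ ^ 2)
        (‖(⟨lower ψ, memℓp_two_of_summable hsum_l⟩ : Fock)‖ ^ 2) := by
      rw [← hasSum_add_iff_of_lt (k := 1) fun n hn => by simp [Nat.lt_one_iff.1 hn]]
      refine h2.congr_fun fun n => ?_
      rw [add_comm 1 n]
      exact (hl n).symm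
    have h4 := h3.add hψs
    rw [hψ, one_pow] at h4
    refine h1.unique (h4.congr_fun fun n => ?_)
    rw [add_comm 1 n]
    exact hr n

/-- The deviation of `a† ψ` from `β* ψ` in terms of that of `a ψ` from `β ψ`. -/
theorem norm_raise_sub_sq {ψ a c : Fock} (hac : inner ℂ ψ c = inner ℂ a ψ)
    (hn : ‖c‖ ^ 2 = ‖a‖ ^ 2 + 1) (β : ℂ) :
    ‖c - starRingEnd ℂ β • ψ‖ ^ 2 = ‖a - β • ψ‖ ^ 2 + 1 := by
  rw [norm_sub_sq (𝕜 := ℂ), norm_sub_sq (𝕜 := ℂ), norm_smul, norm_smul, inner_smul_right,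
    inner_smul_right, RCLike.norm_conj, hn, ← inner_conj_symm c ψ, hac, ← map_mul, RCLike.conj_re]
  ring

/-- Position and momentum are both of the form `C (κ a† + κ* a)`, with `κ = 1` and `κ = i`, and are
treated together. -/
theorem exists_quadrature {ψ a c : Fock} (ha : ∀ n, a n = lower ψ n) (hc : ∀ n, c n = raise ψ n)
    (hac : inner ℂ ψ c = inner ℂ a ψ) (C : ℝ) (κ : ℂ) :
    ∃ χ, (ψ, χ) ∈ (maximalOp ((C : ℂ) • (κ • raise + starRingEnd ℂ κ • lower))).graph ∧
      inner ℂ ψ χ = ((2 * C * (starRingEnd ℂ κ * inner ℂ ψ a).re : ℝ) : ℂ) ∧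
      ∀ β : ℂ, χ - ((2 * C * (starRingEnd ℂ κ * β).re : ℝ) : ℂ) • ψ =
        (C : ℂ) • (κ • (c - starRingEnd ℂ β • ψ) + starRingEnd ℂ κ • (a - β • ψ)) := by
  have hre : ∀ β : ℂ, ((2 * (starRingEnd ℂ κ * β).re : ℝ) : ℂ) =
      κ * starRingEnd ℂ β + starRingEnd ℂ κ * β := fun β => by
    rw [← Complex.add_conj, map_mul, Complex.conj_conj]
    ring
  refine ⟨(C : ℂ) • (κ • c + starRingEnd ℂ κ • a), ?_, ?_, fun β => ?_⟩
  · rw [mem_maximalOp_graph]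
    intro n
    simp only [lp.coeFn_smul, lp.coeFn_add, Pi.smul_apply, Pi.add_apply, ha, hc,
      LinearMap.smul_apply, LinearMap.add_apply]
  · rw [inner_smul_right, inner_add_right, inner_smul_right, inner_smul_right, hac,
      ← inner_conj_symm a ψ, ← hre]
    push_cast
    ring
  · have : ((2 * C * (starRingEnd ℂ κ * β).re : ℝ) : ℂ) =
        C * (κ * starRingEnd ℂ β + starRingEnd ℂ κ * β) := by
      rw [← hre]
      push_cast
      ring
    rw [this, mul_smul, ← smul_sub, smul_sub κ, smul_sub (starRingEnd ℂ κ), smul_smul, smul_smul,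
      add_smul]
    congr 1
    abel

theorem position_eq (hbar m ω : ℝ) : position hbar m ω =
    maximalOp ((√(hbar / (2 * m * ω)) : ℂ) • ((1 : ℂ) • raise + starRingEnd ℂ 1 • lower)) := by
  rw [position, map_one, one_smul, one_smul]

theorem momentum_eq (hbar m ω : ℝ) : momentum hbar m ω =
    maximalOp ((√(hbar * m * ω / 2) : ℂ) • (Complex.I • raise +
      starRingEnd ℂ Complex.I • lower)) := by
  rw [momentum, Complex.conj_I]
  congr 1
  ext ψ n
  simp only [LinearMap.smul_apply, LinearMap.sub_apply, LinearMap.add_apply, Pi.smul_apply,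
    Pi.sub_apply, Pi.add_apply, smul_eq_mul]
  ring

/-- An approximate eigenvector of the annihilation operator is approximately sharp for position and
momentum. -/
theorem exists_moments_of_lower {ψ a c : Fock} (hψ : ‖ψ‖ = 1) (ha : ∀ n, a n = lower ψ n)
    (hc : ∀ n, c n = raise ψ n) (hac : inner ℂ ψ c = inner ℂ a ψ) (hn : ‖c‖ ^ 2 = ‖a‖ ^ 2 + 1)
    {C : ℝ} (hC : 0 ≤ C) {κ : ℂ} (hκ : ‖κ‖ = 1) (β : ℂ) :
    ∃ μ σ : ℝ,
      HasMoments (maximalOp ((C : ℂ) • (κ • raise + starRingEnd ℂ κ • lower))) ψ μ σ ∧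
      0 ≤ σ ∧ |μ - 2 * C * (starRingEnd ℂ κ * β).re| ≤ C * (2 * ‖a - β • ψ‖ + 1) ∧
      σ ≤ 2 * (C * (2 * ‖a - β • ψ‖ + 1)) := by
  obtain ⟨χ, h1, h2, h3⟩ := exists_quadrature ha hc hac C κ
  set μ : ℝ := 2 * C * (starRingEnd ℂ κ * inner ℂ ψ a).re
  set μ' : ℝ := 2 * C * (starRingEnd ℂ κ * β).re
  set δ := ‖a - β • ψ‖
  have hδ : 0 ≤ δ := norm_nonneg _
  have hu : ‖χ - (μ' : ℂ) • ψ‖ ≤ C * (2 * δ + 1) := by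
    rw [h3, norm_smul, Complex.norm_real, Real.norm_of_nonneg hC]
    refine mul_le_mul_of_nonneg_left ?_ hC
    refine (norm_add_le _ _).trans ?_
    rw [norm_smul, norm_smul, RCLike.norm_conj, hκ, one_mul, one_mul]
    have h4 := norm_raise_sub_sq hac hn β
    have h5 : ‖c - starRingEnd ℂ β • ψ‖ ≤ δ + 1 := by
      refine (sq_le_sq₀ (norm_nonneg _) (by positivity)).1 ?_
      rw [h4]
      change δ ^ 2 + 1 ≤ _
      nlinarith
    change _ + δ ≤ _
    linarith
  -- Cauchy–Schwarz: the error of the mean is at most the deviation from `μ'`. Recentring at the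
  -- true mean therefore at most doubles the deviation.
  have hμ : |μ - μ'| ≤ ‖χ - (μ' : ℂ) • ψ‖ := by
    have h4 : inner ℂ ψ (χ - (μ' : ℂ) • ψ) = ((μ - μ' : ℝ) : ℂ) := by
      rw [inner_sub_right, h2, inner_smul_right, inner_self_eq_norm_sq_to_K, hψ]
      push_cast
      simp
    have h5 := norm_inner_le_norm (𝕜 := ℂ) ψ (χ - (μ' : ℂ) • ψ)
    rwa [h4, hψ, one_mul, Complex.norm_real, Real.norm_eq_abs] at h5
  refine ⟨μ, ‖χ - (μ : ℂ) • ψ‖, ⟨χ, h1, h2, rfl⟩, norm_nonneg _, hμ.trans hu, ?_⟩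
  have h6 : χ - (μ : ℂ) • ψ = (χ - (μ' : ℂ) • ψ) - ((μ - μ' : ℝ) : ℂ) • ψ := by
    push_cast
    rw [sub_smul]
    abel
  rw [h6]
  refine (norm_sub_le _ _).trans ?_
  rw [norm_smul, hψ, mul_one, Complex.norm_real, Real.norm_eq_abs]
  linarith

theorem HasShiftedPoisson.summable {r : ℝ} {k : ℕ} {ψ : Fock} (h : HasShiftedPoisson r k ψ) :
    Summable fun n : ℕ => (n : ℝ) * ‖ψ n‖ ^ 2 := by
  have h1 : HasSum (fun n : ℕ => ((k + n : ℕ) : ℝ) * ‖ψ (k + n)‖ ^ 2) (k * 1 + r ^ 2) := by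
    refine (((hasSum_poisson (r ^ 2)).mul_left (k : ℝ)).add
      (hasSum_mul_poisson (r ^ 2))).congr_fun fun n => ?_
    rw [h.2]
    push_cast
    ring
  exact ((hasSum_add_iff_of_lt (f := fun n : ℕ => (n : ℝ) * ‖ψ n‖ ^ 2)
    fun n hn => by simp [h.1 n hn]).1 h1).summable

theorem coherentAmp_succ (α : ℂ) (n : ℕ) :
    ((√((n : ℝ) + 1) : ℝ) : ℂ) * coherentAmp α (n + 1) = α * coherentAmp α n := by
  rw [coherentAmp, coherentAmp, sqrt_factorial_succ]
  have := sqrt_succ_ne_zero n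
  have := sqrt_factorial_ne_zero n
  field_simp
  ring

theorem hasShiftedPoisson_coherentState (α : ℂ) :
    HasShiftedPoisson ‖α‖ 0 (coherentState α) :=
  hasShiftedPoisson_shiftedCoherent α 0

/-- The exact moments of position and momentum in a coherent state. -/
theorem hasMoments_coherentState (α : ℂ) {C : ℝ} (hC : 0 ≤ C) {κ : ℂ} (hκ : ‖κ‖ = 1) :
    HasMoments (maximalOp ((C : ℂ) • (κ • raise + starRingEnd ℂ κ • lower))) (coherentState α)
      (2 * C * (starRingEnd ℂ κ * α).re) C := by
  have hp := hasShiftedPoisson_coherentState α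
  obtain ⟨a, c, ha, hc, hac, hn⟩ := exists_ladder_vectors hp.norm hp.summable
  obtain ⟨χ, h1, h2, h3⟩ := exists_quadrature ha hc hac C κ
  have haα : a = α • coherentState α := by
    ext n
    rw [ha, lp.coeFn_smul, Pi.smul_apply, smul_eq_mul, coherentState_apply, ← coherentAmp_succ,
      ← coherentState_apply]
    rfl
  refine ⟨χ, h1, ?_, ?_⟩
  · rw [h2, haα, inner_smul_right, inner_self_eq_norm_sq_to_K, hp.norm]
    simp
  -- Here `a ψ = α ψ` exactly, so only the commutator contributes and the deviation of `a†` has norm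
  -- one.
  · have h4 := norm_raise_sub_sq hac hn α
    rw [haα, sub_self, norm_zero, sq, sq, zero_mul, zero_add] at h4
    have h5 : ‖c - starRingEnd ℂ α • coherentState α‖ = 1 := by
      nlinarith [norm_nonneg (c - starRingEnd ℂ α • coherentState α)]
    rw [h3, haα, sub_self, smul_zero, add_zero, norm_smul, norm_smul, hκ, h5, Complex.norm_real,
      Real.norm_of_nonneg hC, mul_one, mul_one]

/-! ### The classical limit -/

theorem sq_sub_le_abs_sq_sub_sq {x y : ℝ} (hx : 0 ≤ x) (hy : 0 ≤ y) :
    (x - y) ^ 2 ≤ |x ^ 2 - y ^ 2| := by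
  have h1 : |x - y| ≤ x + y := by rw [abs_le]; constructor <;> linarith
  calc (x - y) ^ 2 = |x - y| * |x - y| := by rw [abs_mul_abs_self, sq]
    _ ≤ (x + y) * |x - y| := by gcongr
    _ = |x ^ 2 - y ^ 2| := by
      rw [← abs_of_nonneg (add_nonneg hx hy), ← abs_mul]
      ring_nf

/-- The state `|√s u, k⟩` is nearly an eigenvector of the annihilation operator, with eigenvalue
`s b u`, if `k` is close to `(b s)²`. -/
theorem norm_lower_shiftedCoherent_sub_sq_le {s b : ℝ} (hs : 0 < s) (hb : 0 ≤ b) {u : ℂ}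
    (hu : ‖u‖ = 1) (k : ℕ) {a : Fock}
    (ha : ∀ n, a n = lower (shiftedCoherent ((√s : ℝ) * u) k) n) :
    ‖a - (((s * b : ℝ) : ℂ) * u) • shiftedCoherent ((√s : ℝ) * u) k‖ ^ 2 ≤
      |(k : ℝ) - b ^ 2 * s ^ 2| + s + b ^ 2 * √s * s := by
  have hr : 0 < √s := Real.sqrt_pos.2 hs
  have hrs : √s ^ 2 = s := Real.sq_sqrt hs.le
  set α : ℂ := (√s : ℝ) * u with hα
  have hαn : ‖α‖ = √s := by
    rw [hα, norm_mul, hu, mul_one, Complex.norm_real, Real.norm_of_nonneg hr.le]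
  set β : ℂ := ((s * b : ℝ) : ℂ) * u with hβ
  have hβα : β = ((b * √s : ℝ) : ℂ) * α := by
    rw [hβ, hα]
    have : s * b = b * √s * √s := by rw [mul_assoc, ← sq, hrs, mul_comm]
    rw [this]
    push_cast
    ring
  set ψ := shiftedCoherent α k with hψ
  -- `g` is `ψ` moved up by one level, so that the `m`-th term compares `√m ψₘ` with `β ψₘ₋₁`; the
  -- case distinction guards against `0 - 1 = 0`.
  set g : ℕ → ℂ := fun m => if m = 0 then 0 else ψ (m - 1) with hg
  have hgk : ∀ i : ℕ, β * g (k + i) = ((b * √s * √(i : ℝ) : ℝ) : ℂ) * coherentAmp α i := by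
    intro i
    rcases i with _ | i
    · have : g k = 0 := by
        rw [hg]
        dsimp only
        split_ifs with hk
        · rfl
        · exact shiftedCoherent_of_lt α (by omega)
      simp [this]
    · have : g (k + (i + 1)) = coherentAmp α i := by
        rw [hg]
        dsimp only
        rw [if_neg (by omega), show k + (i + 1) - 1 = k + i by omega, hψ, shiftedCoherent_add]
      have h1 := coherentAmp_succ α i
      rw [this, hβα, mul_assoc, ← h1]
      push_cast
      ring
  have hsum : HasSum (fun m : ℕ => ‖((√(m : ℝ) : ℝ) : ℂ) * ψ m - β * g m‖ ^ 2)
      (‖a - β • ψ‖ ^ 2) := by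
    rw [← hasSum_add_iff_of_lt (k := 1) fun n hn => by simp [Nat.lt_one_iff.1 hn, hg]]
    refine (hasSum_norm_sq (a - β • ψ)).congr_fun fun n => ?_
    rw [lp.coeFn_sub, Pi.sub_apply, lp.coeFn_smul, Pi.smul_apply, ha, smul_eq_mul, add_comm 1 n, hg]
    dsimp only
    rw [if_neg (by omega), Nat.add_sub_cancel]
    change _ = ‖((√((n : ℝ) + 1) : ℝ) : ℂ) * ψ (n + 1) - β * ψ n‖ ^ 2
    push_cast
    rfl
  rw [← hasSum_add_iff_of_lt (k := k) fun n hn => by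
    have h1 : g n = 0 := by
      rw [hg]
      dsimp only
      split_ifs
      · rfl
      · exact shiftedCoherent_of_lt α (by omega)
    rw [h1, hψ, shiftedCoherent_of_lt α hn]
    simp] at hsum
  have hbound : HasSum (fun i : ℕ => (|(k : ℝ) - b ^ 2 * s ^ 2| * poisson s i + i * poisson s i) +
      (b ^ 2 * √s / 2 * (((i : ℝ) - s) ^ 2 * poisson s i) + b ^ 2 * √s / 2 * s * poisson s i))
      ((|(k : ℝ) - b ^ 2 * s ^ 2| * 1 + s) + (b ^ 2 * √s / 2 * s + b ^ 2 * √s / 2 * s * 1)) :=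
    (((hasSum_poisson s).mul_left _).add (hasSum_mul_poisson s)).add
      (((hasSum_variance_poisson s).mul_left _).add ((hasSum_poisson s).mul_left _))
  refine (hasSum_le (fun i => ?_) hsum hbound).trans (le_of_eq (by ring))
  have hp : 0 ≤ poisson s i := poisson_nonneg hs.le i
  rw [hgk, hψ, shiftedCoherent_add, ← sub_mul, ← Complex.ofReal_sub, norm_mul, mul_pow,
    norm_coherentAmp_sq, hαn, hrs, Complex.norm_real, Real.norm_eq_abs, sq_abs]
  -- Under the Poisson law of mean `s` the index `i` is close to `s`, and `b² s i` is close to `b²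
  -- s²`. The fluctuation `b² s |i - s|` is split by the arithmetic-geometric inequality with weight
  -- `√s`, so that the variance `s` bounds its mean by `b² s^{3/2}`.
  have h1 : (√((k + i : ℕ) : ℝ) - b * √s * √(i : ℝ)) ^ 2 ≤
      |(k : ℝ) - b ^ 2 * s ^ 2| + i + b ^ 2 * √s / 2 * (((i : ℝ) - s) ^ 2 + s) := by
    refine (sq_sub_le_abs_sq_sub_sq (Real.sqrt_nonneg _) (by positivity)).trans ?_
    rw [Real.sq_sqrt (by positivity), mul_pow, mul_pow, hrs, Real.sq_sqrt (by positivity)]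
    have h2 : ((k + i : ℕ) : ℝ) - b ^ 2 * s * i =
        ((k : ℝ) - b ^ 2 * s ^ 2) + i - b ^ 2 * s * ((i : ℝ) - s) := by
      push_cast
      ring
    have h3 : |b ^ 2 * s * ((i : ℝ) - s)| ≤ b ^ 2 * √s / 2 * (((i : ℝ) - s) ^ 2 + s) := by
      have h4 : √s * |(i : ℝ) - s| ≤ (((i : ℝ) - s) ^ 2 + s) / 2 := by
        have := sq_nonneg (|(i : ℝ) - s| - √s)
        rw [sub_sq, sq_abs, hrs] at this
        linarith
      rw [abs_mul, abs_of_nonneg (by positivity : 0 ≤ b ^ 2 * s)]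
      calc b ^ 2 * s * |(i : ℝ) - s| = b ^ 2 * √s * (√s * |(i : ℝ) - s|) := by
            nth_rewrite 1 [← hrs]
            ring
        _ ≤ b ^ 2 * √s * ((((i : ℝ) - s) ^ 2 + s) / 2) := by gcongr
        _ = _ := by ring
    rw [h2]
    refine (abs_sub _ _).trans (add_le_add ((abs_add_le _ _).trans (le_of_eq ?_)) h3)
    rw [Nat.abs_cast]
  calc _ ≤ (|(k : ℝ) - b ^ 2 * s ^ 2| + i + b ^ 2 * √s / 2 * (((i : ℝ) - s) ^ 2 + s)) *
        poisson s i := by gcongr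
    _ = _ := by ring

/-- The displacement `√s e^{i arg β}` that represents, at scale `s`, the classical amplitude `β`. -/
noncomputable def recoveryDisplacement (β : ℂ) (s : ℝ) : ℂ :=
  (√s : ℝ) * Complex.exp (Complex.arg β * Complex.I)

/-- The translation that represents, at scale `s`, the classical amplitude `β`. -/
noncomputable def recoveryShift (β : ℂ) (s : ℝ) : ℕ := ⌊‖β‖ ^ 2 * s ^ 2⌋₊

/-- The translated coherent states that represent the classical amplitude `β` at scale `s`. -/
noncomputable def recoveryState (β : ℂ) (s : ℝ) : Fock :=
  shiftedCoherent (recoveryDisplacement β s) (recoveryShift β s)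

theorem norm_recoveryDisplacement (β : ℂ) (s : ℝ) : ‖recoveryDisplacement β s‖ = √s := by
  rw [recoveryDisplacement, norm_mul, Complex.norm_exp_ofReal_mul_I, mul_one, Complex.norm_real,
    Real.norm_of_nonneg (Real.sqrt_nonneg s)]

theorem hasShiftedPoisson_recoveryState (β : ℂ) (s : ℝ) :
    HasShiftedPoisson √s (recoveryShift β s) (recoveryState β s) := by
  rw [← norm_recoveryDisplacement β s]
  exact hasShiftedPoisson_shiftedCoherent _ _

theorem tendsto_recoveryShift (β : ℂ) :
    Tendsto (fun s => (recoveryShift β s : ℝ) / s ^ 2) atTop (𝓝 (‖β‖ ^ 2)) :=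
  (tendsto_nat_floor_mul_div_atTop (sq_nonneg ‖β‖)).comp (tendsto_pow_atTop two_ne_zero)

theorem tendsto_sqrt_div : Tendsto (fun s : ℝ => √s / s) atTop (𝓝 0) := by
  have h : Tendsto (fun s : ℝ => (√s)⁻¹) atTop (𝓝 0) :=
    tendsto_inv_atTop_zero.comp Real.tendsto_sqrt_atTop
  refine h.congr' ?_
  filter_upwards [eventually_gt_atTop 0] with s hs
  rw [Real.sqrt_div_self]

theorem tendsto_recoveryBound (b : ℝ) :
    Tendsto (fun s : ℝ => √(1 + s + b ^ 2 * √s * s) / s) atTop (𝓝 0) := by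
  have h1 : Tendsto (fun s : ℝ => s⁻¹) atTop (𝓝 0) := tendsto_inv_atTop_zero
  have h2 : Tendsto (fun s : ℝ => s⁻¹ * s⁻¹ + s⁻¹ + b ^ 2 * (√s / s)) atTop (𝓝 0) := by
    have := ((h1.mul h1).add h1).add (tendsto_sqrt_div.const_mul (b ^ 2))
    simpa using this
  have h3 := h2.sqrt
  rw [Real.sqrt_zero] at h3
  refine h3.congr' ?_
  filter_upwards [eventually_gt_atTop 0] with s hs
  have h4 : s⁻¹ * s⁻¹ + s⁻¹ + b ^ 2 * (√s / s) = (1 + s + b ^ 2 * √s * s) / s ^ 2 := by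
    field_simp
  rw [h4, Real.sqrt_div (by positivity), Real.sqrt_sq hs.le]

/-- The recovery state is an eigenvector of `a` with eigenvalue `s β` up to an error `O(s^{3/4})`,
which is negligible against `s`. The displacement grows, yet contributes only `s` to a mean number
of order `s²`. -/
theorem sharpLimit_quadrature (β : ℂ) {C : ℝ} (hC : 0 ≤ C) {κ : ℂ} (hκ : ‖κ‖ = 1) :
    SharpLimit (maximalOp ((C : ℂ) • (κ • raise + starRingEnd ℂ κ • lower))) (recoveryState β) 1
      (2 * C * (starRingEnd ℂ κ * β).re) := by
  set B : ℝ → ℝ := fun s => C * (2 * √(1 + s + ‖β‖ ^ 2 * √s * s) + 1) with hB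
  have key : ∀ s : ℝ, ∃ μ σ : ℝ, 0 < s →
      HasMoments (maximalOp ((C : ℂ) • (κ • raise + starRingEnd ℂ κ • lower)))
        (recoveryState β s) μ σ ∧
      0 ≤ σ ∧ |μ - s * (2 * C * (starRingEnd ℂ κ * β).re)| ≤ B s ∧ σ ≤ 2 * B s := by
    intro s
    by_cases hs : 0 < s
    · have hp := hasShiftedPoisson_recoveryState β s
      obtain ⟨a, c, ha, hc, hac, hn⟩ := exists_ladder_vectors hp.norm hp.summable
      obtain ⟨μ, σ, h1, h2, h3, h4⟩ := exists_moments_of_lower hp.norm ha hc hac hn hC hκ (s * β)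
      have h5 := norm_lower_shiftedCoherent_sub_sq_le hs (norm_nonneg β)
        (Complex.norm_exp_ofReal_mul_I (Complex.arg β)) (recoveryShift β s) ha
      have h6 : ((s * ‖β‖ : ℝ) : ℂ) * Complex.exp (Complex.arg β * Complex.I) = s * β := by
        rw [Complex.ofReal_mul, mul_assoc, Complex.norm_mul_exp_arg_mul_I]
      rw [h6] at h5
      have h7 : |(recoveryShift β s : ℝ) - ‖β‖ ^ 2 * s ^ 2| ≤ 1 := by
        have h8 := Nat.floor_le (by positivity : 0 ≤ ‖β‖ ^ 2 * s ^ 2)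
        have h9 := Nat.lt_floor_add_one (‖β‖ ^ 2 * s ^ 2)
        change |((⌊‖β‖ ^ 2 * s ^ 2⌋₊ : ℕ) : ℝ) - _| ≤ 1
        rw [abs_le]
        constructor <;> linarith
      have h10 : ‖a - ((s : ℂ) * β) • recoveryState β s‖ ≤ √(1 + s + ‖β‖ ^ 2 * √s * s) := by
        refine Real.le_sqrt_of_sq_le (h5.trans ?_)
        linarith
      have h11 : C * (2 * ‖a - ((s : ℂ) * β) • recoveryState β s‖ + 1) ≤ B s := by
        rw [hB]
        dsimp only
        gcongr
      refine ⟨μ, σ, fun _ => ⟨h1, h2, ?_, by linarith⟩⟩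
      have h12 : 2 * C * (starRingEnd ℂ κ * ((s : ℂ) * β)).re =
          s * (2 * C * (starRingEnd ℂ κ * β).re) := by
        rw [mul_left_comm (starRingEnd ℂ κ), Complex.re_ofReal_mul]
        ring
      rw [h12] at h3
      exact h3.trans h11
    · exact ⟨0, 0, fun h => absurd h hs⟩
  choose μ σ hμσ using key
  have hBlim : Tendsto (fun s => B s / s) atTop (𝓝 0) := by
    have := ((tendsto_recoveryBound ‖β‖).const_mul (2 * C)).add
      (tendsto_inv_atTop_zero.const_mul C)
    rw [mul_zero, mul_zero, add_zero] at this
    refine this.congr fun s => ?_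
    rw [hB]
    ring
  refine ⟨μ, σ, ?_, ?_, ?_⟩
  · filter_upwards [eventually_gt_atTop 0] with s hs
    exact (hμσ s hs).1
  · rw [tendsto_iff_dist_tendsto_zero]
    refine squeeze_zero' (Eventually.of_forall fun s => dist_nonneg) ?_ hBlim
    filter_upwards [eventually_gt_atTop 0] with s hs
    obtain ⟨-, -, h3, -⟩ := hμσ s hs
    have h4 : μ s / s ^ 1 - 2 * C * (starRingEnd ℂ κ * β).re =
        (μ s - s * (2 * C * (starRingEnd ℂ κ * β).re)) / s := by
      field_simp
    rw [Real.dist_eq, h4, abs_div, abs_of_pos hs]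
    gcongr
  · have h2 := hBlim.const_mul 2
    rw [mul_zero] at h2
    refine squeeze_zero' ?_ ?_ h2
    · filter_upwards [eventually_gt_atTop 0] with s hs
      have := (hμσ s hs).2.1
      positivity
    · filter_upwards [eventually_gt_atTop 0] with s hs
      rw [pow_one, ← mul_div_assoc]
      have := (hμσ s hs).2.2.2
      gcongr

theorem sharpLimit_position (β : ℂ) (hbar m ω : ℝ) :
    SharpLimit (position hbar m ω) (recoveryState β) 1
      (√(hbar / (2 * m * ω)) * (2 * β.re)) := by
  have h := sharpLimit_quadrature β (Real.sqrt_nonneg (hbar / (2 * m * ω))) (κ := 1) (by simp)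
  rw [← position_eq, map_one, one_mul, mul_right_comm, mul_comm] at h
  exact h

theorem re_conj_I_mul (β : ℂ) : (starRingEnd ℂ Complex.I * β).re = β.im := by simp

theorem sharpLimit_momentum (β : ℂ) (hbar m ω : ℝ) :
    SharpLimit (momentum hbar m ω) (recoveryState β) 1
      (√(hbar * m * ω / 2) * (2 * β.im)) := by
  have h := sharpLimit_quadrature β (Real.sqrt_nonneg (hbar * m * ω / 2)) (κ := Complex.I) (by simp)
  rw [← momentum_eq, re_conj_I_mul, mul_right_comm, mul_comm] at h
  exact h

theorem tendsto_mul_sqrt_div_sq (ε : ℝ) :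
    Tendsto (fun s : ℝ => ε * √s / s ^ 2) atTop (𝓝 0) := by
  have := (tendsto_sqrt_div.mul tendsto_inv_atTop_zero).const_mul ε
  rw [mul_zero, mul_zero] at this
  refine this.congr fun s => ?_
  rw [sq]
  ring

theorem sharpLimit_oscillatorHam (β : ℂ) {ε : ℝ} (hε : 0 < ε) :
    SharpLimit (oscillatorHam ε) (recoveryState β) 2 (ε * ‖β‖ ^ 2) := by
  refine ⟨fun s => ε * (√s ^ 2 + recoveryShift β s), fun s => ε * √s,
    Eventually.of_forall fun s =>
      (hasShiftedPoisson_recoveryState β s).moments hε (Real.sqrt_nonneg s), ?_,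
    tendsto_mul_sqrt_div_sq ε⟩
  have := (tendsto_inv_atTop_zero.add (tendsto_recoveryShift β)).const_mul ε
  rw [zero_add] at this
  refine this.congr' ?_
  filter_upwards [eventually_gt_atTop 0] with s hs
  rw [Real.sq_sqrt hs.le]
  field_simp

theorem hasCanonicalForm_ladderState {ε : ℝ} (hε : ε ≠ 0) {l : ℝ} (hl : 0 ≤ l) (n : ℤ) :
    HasCanonicalForm (ladder ε) ε l n (ladderState l n) :=
  (hasCanonicalForm_ladder_iff hε hl).2 fun _ => rfl

/-- For `λ = 0` the output is a single rung of the ladder: the deviation is exactly zero, and the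
work is the difference of the two translations. -/
theorem sharpLimit_ladder (β β' : ℂ) {ε : ℝ} (hε : 0 < ε) :
    SharpLimit (ladder ε).ham
      (fun s => ladderState 0 ((recoveryShift β s : ℤ) - recoveryShift β' s)) 2
      (ε * ‖β‖ ^ 2 - ε * ‖β'‖ ^ 2) := by
  refine ⟨_, _, Eventually.of_forall fun s =>
    (hasCanonicalForm_ladderState hε.ne' le_rfl _).moments hε le_rfl, ?_, ?_⟩
  · have := ((tendsto_recoveryShift β).const_mul ε).sub ((tendsto_recoveryShift β').const_mul ε)
    refine this.congr fun s => ?_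
    change _ = (0 + ((((recoveryShift β s : ℤ) - recoveryShift β' s : ℤ) : ℝ) + 0 ^ 2) * ε) / s ^ 2
    push_cast
    ring
  · simp

theorem classicalEnergy_eq {hbar m ω : ℝ} (hhbar : 0 < hbar) (hm : 0 < m) (hω : 0 < ω)
    (β : ℂ) : classicalEnergy m ω (√(hbar / (2 * m * ω)) * (2 * β.re))
      (√(hbar * m * ω / 2) * (2 * β.im)) = hbar * ω * ‖β‖ ^ 2 := by
  rw [classicalEnergy, mul_pow (√(hbar * m * ω / 2)), mul_pow (√(hbar / (2 * m * ω))),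
    Real.sq_sqrt (by positivity), Real.sq_sqrt (by positivity),
    Complex.sq_norm, Complex.normSq_apply]
  field_simp
  ring

theorem exists_classical_amplitude {hbar m ω : ℝ} (hhbar : 0 < hbar) (hm : 0 < m) (hω : 0 < ω)
    (x p : ℝ) : ∃ β : ℂ, √(hbar / (2 * m * ω)) * (2 * β.re) = x ∧
      √(hbar * m * ω / 2) * (2 * β.im) = p := by
  have h1 : √(hbar / (2 * m * ω)) ≠ 0 := (Real.sqrt_pos.2 (by positivity)).ne'
  have h2 : √(hbar * m * ω / 2) ≠ 0 := (Real.sqrt_pos.2 (by positivity)).ne'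
  refine ⟨⟨x / (2 * √(hbar / (2 * m * ω))), p / (2 * √(hbar * m * ω / 2))⟩, ?_, ?_⟩
  · dsimp only
    field_simp
  · dsimp only
    field_simp

theorem position_moments (hbar m ω : ℝ) (α : ℂ) :
    HasMoments (position hbar m ω) (coherentState α)
      (√(hbar / (2 * m * ω)) * (2 * α.re)) (√(hbar / (2 * m * ω))) := by
  have h := hasMoments_coherentState α (Real.sqrt_nonneg (hbar / (2 * m * ω))) (κ := 1) (by simp)
  rw [← position_eq, map_one, one_mul, mul_comm (2 : ℝ), mul_assoc] at h
  exact h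

theorem momentum_moments (hbar m ω : ℝ) (α : ℂ) :
    HasMoments (momentum hbar m ω) (coherentState α)
      (√(hbar * m * ω / 2) * (2 * α.im)) (√(hbar * m * ω / 2)) := by
  have h := hasMoments_coherentState α (Real.sqrt_nonneg (hbar * m * ω / 2)) (κ := Complex.I)
    (by simp)
  rw [← momentum_eq, re_conj_I_mul, mul_comm (2 : ℝ), mul_assoc] at h
  exact h

theorem energy_moments {ε : ℝ} (hε : 0 < ε) (α : ℂ) :
    HasMoments (oscillatorHam ε) (coherentState α) (ε * ‖α‖ ^ 2) (ε * ‖α‖) := by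
  have h := (hasShiftedPoisson_coherentState α).moments hε (norm_nonneg α)
  rwa [Nat.cast_zero, add_zero] at h

end CoherentWork

/-! ### The main theorem -/

open CoherentWork
theorem mainTheorem3 (hbar m ω : ℝ) (hhbar : 0 < hbar) (hm : 0 < m) (hω : 0 < ω) :
    -- closure of the class under coherent work processes
    (∀ (F : Type u) [NormedAddCommGroup F] [InnerProductSpace ℂ F] [CompleteSpace F]
      (A : Weight F) (ψ φ : Fock) (η : F),
      ψ ∈ classC (hbar * ω) → CoherentWorkProcess (oscillatorHam (hbar * ω)) A ψ φ η →
        φ ∈ classC (hbar * ω)) ∧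
    -- the unique canonical state reversibly connected to a given state
    (∀ ψ ∈ classC (hbar * ω), ∃ (r : ℝ) (k : ℕ), 0 ≤ r ∧
      shiftedCoherent r k ∈ classC (hbar * ω) ∧
      (∀ (F : Type u) [NormedAddCommGroup F] [InnerProductSpace ℂ F] [CompleteSpace F]
        (A : Weight F),
        ReversibleWithoutWork (oscillatorHam (hbar * ω)) A ψ (shiftedCoherent r k)) ∧
      (∀ (F : Type u) [NormedAddCommGroup F] [InnerProductSpace ℂ F] [CompleteSpace F]
        (A : Weight F) (r' : ℝ) (k' : ℕ), 0 ≤ r' →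
        ReversibleWithoutWork (oscillatorHam (hbar * ω)) A ψ (shiftedCoherent r' k') →
          r' = r ∧ k' = k)) ∧
    -- the only possible processes between translated coherent states, for any weight
    (∀ (F : Type u) [NormedAddCommGroup F] [InnerProductSpace ℂ F] [CompleteSpace F]
      (A : Weight F) (α α' : ℂ) (k k' : ℕ) (η : F),
      CoherentWorkProcess (oscillatorHam (hbar * ω)) A (shiftedCoherent α k)
        (shiftedCoherent α' k') η →
      ‖α'‖ ≤ ‖α‖ ∧
        HasCanonicalForm A (hbar * ω) (√(‖α‖ ^ 2 - ‖α'‖ ^ 2)) ((k : ℤ) - k') η) ∧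
    -- all of these processes occur, with the ladder as weight
    (∀ (α α' : ℂ) (k k' : ℕ) (n : ℤ), ‖α'‖ ≤ ‖α‖ → n + k' = k →
      ∀ η : Ell2 ℤ,
        CoherentWorkProcess (oscillatorHam (hbar * ω)) (ladder (hbar * ω)) (shiftedCoherent α k)
          (shiftedCoherent α' k') η ↔
        ∃ θ : ℤ → ℝ, ∀ j, η j =
          Complex.exp (Complex.I * θ j) * ladderState (√(‖α‖ ^ 2 - ‖α'‖ ^ 2)) n j) ∧
    -- classical limit: statistics of coherent states
    (∀ α : ℂ,
      HasMoments (position hbar m ω) (coherentState α)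
        (√(hbar / (2 * m * ω)) * (2 * α.re)) (√(hbar / (2 * m * ω))) ∧
      HasMoments (momentum hbar m ω) (coherentState α)
        (√(hbar * m * ω / 2) * (2 * α.im)) (√(hbar * m * ω / 2)) ∧
      HasMoments (oscillatorHam (hbar * ω)) (coherentState α)
        (hbar * ω * ‖α‖ ^ 2) (hbar * ω * ‖α‖)) ∧
    -- classical limit: position, momentum and energy become sharp for large displacements
    (∀ δ : ℝ, 0 < δ → ∃ R : ℝ, ∀ α : ℂ,
      (R ≤ |α.re| → ∃ μ σ, HasMoments (position hbar m ω) (coherentState α) μ σ ∧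
        σ ≤ δ * |μ|) ∧
      (R ≤ |α.im| → ∃ μ σ, HasMoments (momentum hbar m ω) (coherentState α) μ σ ∧
        σ ≤ δ * |μ|) ∧
      (R ≤ ‖α‖ → ∃ μ σ, HasMoments (oscillatorHam (hbar * ω)) (coherentState α) μ σ ∧
        σ ≤ δ * μ)) ∧
    -- classical limit: the work depends only on the initial and the final state
    (∀ ψ ∈ classC (hbar * ω), ∀ φ ∈ classC (hbar * ω), ∃ (l : ℝ) (n : ℤ) (E₁ σ₁ E₂ σ₂ : ℝ),
      0 ≤ l ∧ HasMoments (oscillatorHam (hbar * ω)) ψ E₁ σ₁ ∧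
      HasMoments (oscillatorHam (hbar * ω)) φ E₂ σ₂ ∧
      ∀ (F : Type u) [NormedAddCommGroup F] [InnerProductSpace ℂ F] [CompleteSpace F]
        (A : Weight F) (η : F), CoherentWorkProcess (oscillatorHam (hbar * ω)) A ψ φ η →
        HasCanonicalForm A (hbar * ω) l n η ∧
        ∃ τ : ℝ, σ₁ ^ 2 = σ₂ ^ 2 + τ ^ 2 ∧ HasMoments A.ham η (A.energy + (E₁ - E₂)) τ) ∧
    -- classical limit: every classical work process is recovered
    (∀ x₀ p₀ x₁ p₁ : ℝ, ∃ (α α' : ℝ → ℂ) (k k' : ℝ → ℕ) (η : ℝ → Ell2 ℤ),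
      Tendsto (fun s => ‖α s‖) atTop atTop ∧ Tendsto (fun s => ‖α' s‖) atTop atTop ∧
      (∀ s : ℝ, 0 < s → CoherentWorkProcess (oscillatorHam (hbar * ω)) (ladder (hbar * ω))
        (shiftedCoherent (α s) (k s)) (shiftedCoherent (α' s) (k' s)) (η s)) ∧
      SharpLimit (position hbar m ω) (fun s => shiftedCoherent (α s) (k s)) 1 x₀ ∧
      SharpLimit (momentum hbar m ω) (fun s => shiftedCoherent (α s) (k s)) 1 p₀ ∧
      SharpLimit (oscillatorHam (hbar * ω)) (fun s => shiftedCoherent (α s) (k s)) 2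
        (classicalEnergy m ω x₀ p₀) ∧
      SharpLimit (position hbar m ω) (fun s => shiftedCoherent (α' s) (k' s)) 1 x₁ ∧
      SharpLimit (momentum hbar m ω) (fun s => shiftedCoherent (α' s) (k' s)) 1 p₁ ∧
      SharpLimit (oscillatorHam (hbar * ω)) (fun s => shiftedCoherent (α' s) (k' s)) 2
        (classicalEnergy m ω x₁ p₁) ∧
      SharpLimit (ladder (hbar * ω)).ham η 2
        (classicalEnergy m ω x₀ p₀ - classicalEnergy m ω x₁ p₁)) := by
  have hε : 0 < hbar * ω := mul_pos hhbar hω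
  have hε0 : hbar * ω ≠ 0 := hε.ne'
  have hcoh : ∀ (α : ℂ) k, HasShiftedPoisson ‖α‖ k (shiftedCoherent α k) :=
    hasShiftedPoisson_shiftedCoherent
  have hcohr : ∀ (r : ℝ) k, 0 ≤ r → HasShiftedPoisson r k (shiftedCoherent r k) := by
    intro r k hr
    have := hcoh r k
    rwa [Complex.norm_real, Real.norm_of_nonneg hr] at this
  refine ⟨?_, ?_, ?_, ?_, ?_, ?_, ?_, ?_⟩
  · intro F _ _ _ A ψ φ η hψ h
    obtain ⟨r, k, hr, hψ⟩ := (mem_classC_iff hε0).1 hψ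
    -- The translation of `φ` is its lowest occupied level, which exists because `φ` is a unit
    -- vector.
    have hφ : ∃ n, φ n ≠ 0 := by
      by_contra! hall
      have h0 : φ = 0 := lp.ext (funext hall)
      have := h.norm_final
      rw [h0, norm_zero] at this
      exact zero_ne_one this
    classical
    obtain ⟨r', hr', -, hφ', -⟩ := h.exists_poisson hε0 hr hψ (Nat.find_spec hφ)
      fun n hn => not_not.1 (Nat.find_min hφ hn)
    exact (mem_classC_iff hε0).2 ⟨r', _, hr', hφ'⟩
  · intro ψ hψ
    obtain ⟨r, k, hr, hψ⟩ := (mem_classC_iff hε0).1 hψ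
    refine ⟨r, k, hr, (mem_classC_iff hε0).2 ⟨r, k, hr, hcohr r k hr⟩, ?_, ?_⟩
    · intro F _ _ _ A
      exact reversibleWithoutWork_of_poisson hε0 A hr hψ (hcohr r k hr)
    · intro F _ _ _ A r' k' hr' h
      exact h.unique hε0 hr hr' hψ (hcohr r' k' hr')
  · intro F _ _ _ A α α' k k' η h
    exact h.canonical hε0 (norm_nonneg _) (norm_nonneg _) (hcoh α k) (hcoh α' k')
  · intro α α' k k' n hle hn η
    rw [← norm_eq_iff_exists_phase, ← hasCanonicalForm_ladder_iff hε0 (Real.sqrt_nonneg _)]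
    constructor
    · intro h
      have := (h.canonical hε0 (norm_nonneg _) (norm_nonneg _) (hcoh α k) (hcoh α' k')).2
      rwa [← hn, add_sub_cancel_right] at this
    · intro h
      exact h.process hε0 (norm_nonneg _) (hcoh α k) (hcoh α' k') hle hn
  · exact fun α => ⟨position_moments hbar m ω α, momentum_moments hbar m ω α, energy_moments hε α⟩
  · intro δ hδ
    have habs : ∀ c t : ℝ, 0 ≤ c → 1 / δ ≤ |t| → c ≤ δ * |c * (2 * t)| := by
      intro c t hc ht
      rw [div_le_iff₀ hδ] at ht
      rw [abs_mul, abs_mul, abs_of_nonneg hc, abs_two]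
      nlinarith
    -- The ratio of deviation to mean is `1 / (2|t|)` for the quadratures, with `t` the real or
    -- imaginary part of `α`, and `1 / ‖α‖` for the energy, so one threshold serves all three.
    refine ⟨1 / δ, fun α => ⟨fun h => ?_, fun h => ?_, fun h => ?_⟩⟩
    · exact ⟨_, _, position_moments hbar m ω α, habs _ _ (Real.sqrt_nonneg _) h⟩
    · exact ⟨_, _, momentum_moments hbar m ω α, habs _ _ (Real.sqrt_nonneg _) h⟩
    · refine ⟨_, _, energy_moments hε α, ?_⟩
      rw [div_le_iff₀ hδ] at h
      have h1 : 0 ≤ hbar * ω * ‖α‖ := by positivity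
      calc hbar * ω * ‖α‖ = hbar * ω * ‖α‖ * 1 := (mul_one _).symm
        _ ≤ hbar * ω * ‖α‖ * (‖α‖ * δ) := mul_le_mul_of_nonneg_left h h1
        _ = _ := by ring
  · intro ψ hψ φ hφ
    obtain ⟨r, k, hr, hψ⟩ := (mem_classC_iff hε0).1 hψ
    obtain ⟨r', k', hr', hφ⟩ := (mem_classC_iff hε0).1 hφ
    -- If `r < r'` the root is `0` by convention; this is harmless, as no process exists then.
    refine ⟨√(r ^ 2 - r' ^ 2), (k : ℤ) - k', _, _, _, _, Real.sqrt_nonneg _, hψ.moments hε hr,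
      hφ.moments hε hr', ?_⟩
    intro F _ _ _ A η h
    obtain ⟨hle, hc⟩ := h.canonical hε0 hr hr' hψ hφ
    have hsq : √(r ^ 2 - r' ^ 2) ^ 2 = r ^ 2 - r' ^ 2 := Real.sq_sqrt (by nlinarith)
    refine ⟨hc, hbar * ω * √(r ^ 2 - r' ^ 2), ?_, ?_⟩
    · rw [mul_pow _ (√_), hsq]
      ring
    · have h1 := hc.moments hε (Real.sqrt_nonneg _)
      rw [hsq] at h1
      convert h1 using 1
      push_cast
      ring
  · intro x₀ p₀ x₁ p₁
    obtain ⟨β, rfl, rfl⟩ := exists_classical_amplitude hhbar hm hω x₀ p₀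
    obtain ⟨β', rfl, rfl⟩ := exists_classical_amplitude hhbar hm hω x₁ p₁
    rw [classicalEnergy_eq hhbar hm hω, classicalEnergy_eq hhbar hm hω]
    -- Both displacements have modulus `√s`, so the condition `‖α'‖ ≤ ‖α‖` holds whatever the sign
    -- of the work.
    refine ⟨recoveryDisplacement β, recoveryDisplacement β', recoveryShift β, recoveryShift β',
      fun s => ladderState 0 ((recoveryShift β s : ℤ) - recoveryShift β' s), ?_, ?_, ?_,
      sharpLimit_position β hbar m ω, sharpLimit_momentum β hbar m ω,
      sharpLimit_oscillatorHam β hε, sharpLimit_position β' hbar m ω,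
      sharpLimit_momentum β' hbar m ω, sharpLimit_oscillatorHam β' hε, sharpLimit_ladder β β' hε⟩
    · simp only [norm_recoveryDisplacement]
      exact Real.tendsto_sqrt_atTop
    · simp only [norm_recoveryDisplacement]
      exact Real.tendsto_sqrt_atTop
    · intro s _
      have h := hasCanonicalForm_ladderState hε0 le_rfl
        ((recoveryShift β s : ℤ) - recoveryShift β' s)
      -- The parameter `0` is written as `√(√s² - √s²)`, the form required for a process between
      -- equal displacements.
      rw [← Real.sqrt_zero, ← sub_self (√s ^ 2)] at h
      have h2 := h.process hε0 (Real.sqrt_nonneg s) (hasShiftedPoisson_recoveryState β s)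
        (hasShiftedPoisson_recoveryState β' s) le_rfl (by ring)
      rwa [sub_self, Real.sqrt_zero] at h2
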